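/- Let $p>2$. Let $h:[0,\infty)\to\mathbb R$ be a nonnegative $C^1$ function such that $h(t)>0$ for all $t\ge t_0$, for some $t_0>0$, and $$\text{(H1)}\qquad \lim_{t\to\infty}\frac{h'(t)}{t^{p-1}h(t)}=0 ,$$ and put $f(t)=h(t)e^{t^p}$. For every $n$ let $\lambda_n>0$ and let $u_n\in C^2([0,1])$ solve $$-u_n''-\tfrac1r u_n'=\lambda_n f(u_n),\quad u_n>0\ \text{ in }(0,1),\qquad u_n(0)=\mu_n,\quad u_n'(0)=0=u_n(1),$$ and suppose $\mu_n\to\infty$. All limits below are as $n\to\infty$. **Constants.** There are unique sequences $(a_k)_{k\ge0}$, $(\delta_k)_{k\ge0}$ with $a_0=2$, $\delta_0=1$ and, for all $k\ge1$, $\delta_k\in(0,\delta_{k-1})$, $a_k\in(0,2)$, $$\frac{2p}{2+a_{k-1}}\Bigl(1-\frac{\delta_k}{\delta_{k-1}}\Bigr)-1+\Bigl(\frac{\delta_k}{\delta_{k-1}}\Bigr)^p=0,\qquad a_k=2-\Bigl(\frac{\delta_k}{\delta_{k-1}}\Bigr)^{p-1}(2+a_{k-1}).$$ **First bubble.** Call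 sequences $\gamma_{0,n}>0$ and $\rho_{0,n}\in(0,1)$ *admissible* if $p\lambda_n\mu_n^{p-1}f(\mu_n)\gamma_{0,n}^2=1$ for all $n$, $\gamma_{0,n}\to0$, $\rho_{0,n}\to0$, $\rho_{0,n}/\gamma_{0,n}\to\infty$, $u_n(\rho_{0,n})/\mu_n\to1$, $\|z_{0,n}-z_0\|_{C^1([0,\rho_{0,n}/\gamma_{0,n}])}\to0$, where $z_{0,n}(r)=p\mu_n^{p-1}(u_n(\gamma_{0,n}r)-\mu_n)$ and $z_0(r)=\log\frac{64}{(8+r^2)^2}$, and $p\mu_n^{p-1}\int_0^{\rho_{0,n}}\lambda_nf(u_n)\,r\,dr\to4$. Admissible sequences exist. **Limit profiles.** For $k\ge1$ set $b_k=(\sqrt2/a_k)^{a_k}$ and $$z_k(r)=\log\frac{2a_k^2b_k}{r^{2-a_k}(1+b_kr^{a_k})^2}\qquad(r>0).$$ Then $-z_k''-\frac1rz_k'=e^{z_k}$ in $(0,\infty)$, $z_k(a_k/\sqrt2)=0$, $-(a_k/\sqrt2)\,z_k'(a_k/\sqrt2)=2$, and $\int_0^\infty e^{z_k}r\,dr=2a_k$.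 **Infinite sequence of bubbles.** For every admissible $(\gamma_{0,n}),(\rho_{0,n})$ there are, for all $k\ge1$, sequences $(r_{k,n}),(\bar\rho_{k,n}),(\rho_{k,n})\subset(0,1)$ and $\gamma_{k,n}>0$ such that for every $k\ge1$: 1. $u_n(r_{k,n})/\mu_n\to\delta_k$, $u_n(\rho_{k,n})/\mu_n\to\delta_k$, $u_n(\bar\rho_{k,n})/\mu_n\to\delta_k$, and $$p\lambda_nr_{k,n}^2u_n(r_{k,n})^{p-1}f(u_n(r_{k,n}))\to\frac{a_k^2}{2};$$ 2. $\rho_{k-1,n}/\bar\rho_{k,n}\to0$, $\bar\rho_{k,n}/r_{k,n}\to0$, $r_{k,n}/\rho_{k,n}\to0$; 3. $\gamma_{k,n}^2\,p\lambda_nu_n(r_{k,n})^{p-1}f(u_n(r_{k,n}))=1$ for all $n$, $\gamma_{k,n}\to0$ and, with $z_{k,n}(r)=pu_n(r_{k,n})^{p-1}(u_n(\gamma_{k,n}r)-u_n(r_{k,n}))$, $$\|z_{k,n}-z_k\|_{C^2([\bar\rho_{k,n}/\gamma_{k,n},\,\rho_{k,n}/\gamma_{k,n}])}\to0;$$ 4.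 $\displaystyle p\mu_n^{p-1}\int_{\rho_{k-1,n}}^{\bar\rho_{k,n}}\lambda_nf(u_n)\,r\,dr\to0$ and $\displaystyle p\mu_n^{p-1}\int_{\bar\rho_{k,n}}^{\rho_{k,n}}\lambda_nf(u_n)\,r\,dr\to\frac{2a_k}{\delta_k^{p-1}}$; 5. $\displaystyle p\int_{\rho_{k-1,n}}^{\bar\rho_{k,n}}\lambda_nu_n^{p-1}f(u_n)\,r\,dr\to0$ and $\displaystyle p\int_{\bar\rho_{k,n}}^{\rho_{k,n}}\lambda_nu_n^{p-1}f(u_n)\,r\,dr\to2a_k$. -/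

import Mathlib

open Filter Topology Set MeasureTheory
open scoped ENNReal

noncomputable section

/-- The standing assumption on the factor `h : [0, ∞) → ℝ` of the nonlinearity: it is nonnegative,
`C¹` on `[0, ∞)`, and positive from some point on. -/
structure IsGrowthFactor (h : ℝ → ℝ) : Prop where
  contDiffOn : ContDiffOn ℝ 1 h (Ici 0)
  nonneg : ∀ t, 0 ≤ t → 0 ≤ h t
  eventually_pos : ∃ t₀ : ℝ, 0 < t₀ ∧ ∀ t, t₀ ≤ t → 0 < h t

/-- `h'(t) / (t^{p-1} h(t)) → 0` as `t → ∞`. -/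
def SubordinateGrowth (p : ℝ) (h : ℝ → ℝ) : Prop :=
  Tendsto (fun t : ℝ => deriv h t / (t ^ (p - 1) * h t)) atTop (𝓝 0)

/-- The nonlinearity `f(t) = h(t) e^{t^p}`. -/
def nonlin (p : ℝ) (h : ℝ → ℝ) (t : ℝ) : ℝ := h t * Real.exp (t ^ p)

/-- `u` is a classical solution on `[0, 1]` of `-u'' - u'/r = lam f(u)`, `u > 0` in `(0, 1)`,
`u(0) = mu`, `u'(0) = 0 = u(1)`, where `lam > 0`. -/
structure IsRadialSolution (p : ℝ) (h : ℝ → ℝ) (lam mu : ℝ) (u : ℝ → ℝ) : Prop where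
  lam_pos : 0 < lam
  contDiffOn : ContDiffOn ℝ 2 u (Icc 0 1)
  equation : ∀ r ∈ Ioo (0 : ℝ) 1,
    -deriv (deriv u) r - 1 / r * deriv u r = lam * nonlin p h (u r)
  pos : ∀ r ∈ Ioo (0 : ℝ) 1, 0 < u r
  value_zero : u 0 = mu
  deriv_zero : derivWithin u (Icc 0 1) 0 = 0
  value_one : u 1 = 0

/-- The `C^m` norm of `g` on the compact interval `[s, t]`, with values in `[0, ∞]` (derivatives
at the endpoints are one-sided). -/
def cNorm (m : ℕ) (s t : ℝ) (g : ℝ → ℝ) : ℝ≥0∞ :=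
  ∑ j ∈ Finset.range (m + 1), ⨆ x ∈ Icc s t, ‖iteratedDerivWithin j g (Icc s t) x‖ₑ

/-- The rescaling `x ↦ p m^{p-1} (u(γ x) - m)`. -/
def rescaled (p m γ : ℝ) (u : ℝ → ℝ) (x : ℝ) : ℝ := p * m ^ (p - 1) * (u (γ * x) - m)

/-- The energy `p mu^{p-1} ∫_s^t lam f(u) r dr`. -/
def energy (p : ℝ) (h : ℝ → ℝ) (lam mu : ℝ) (u : ℝ → ℝ) (s t : ℝ) : ℝ :=
  p * mu ^ (p - 1) * ∫ r in s..t, lam * nonlin p h (u r) * r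

/-- The weighted energy `p ∫_s^t lam u^{p-1} f(u) r dr`. -/
def weightedEnergy (p : ℝ) (h : ℝ → ℝ) (lam : ℝ) (u : ℝ → ℝ) (s t : ℝ) : ℝ :=
  p * ∫ r in s..t, lam * u r ^ (p - 1) * nonlin p h (u r) * r

/-- The recurrence for the numbers `a_k` and `δ_k`: `a_0 = 2`, `δ_0 = 1` and, for every `k`,
`δ_{k+1} ∈ (0, δ_k)` and `a_{k+1} ∈ (0, 2)` are given by `delta_eq` and `a_eq`. -/
structure IsBubbleRecurrence (p : ℝ) (a δ : ℕ → ℝ) : Prop where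
  a_zero : a 0 = 2
  delta_zero : δ 0 = 1
  delta_mem : ∀ k, δ (k + 1) ∈ Ioo 0 (δ k)
  a_mem : ∀ k, a (k + 1) ∈ Ioo (0 : ℝ) 2
  delta_eq : ∀ k,
    2 * p / (2 + a k) * (1 - δ (k + 1) / δ k) - 1 + (δ (k + 1) / δ k) ^ p = 0
  a_eq : ∀ k, a (k + 1) = 2 - (δ (k + 1) / δ k) ^ (p - 1) * (2 + a k)

/-- The regular Liouville profile `z_0(r) = log (64 / (8 + r²)²)`. -/
def regularProfile (r : ℝ) : ℝ := Real.log (64 / (8 + r ^ 2) ^ 2)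

/-- The singular Liouville profile `log (2 a² b / (r^{2-a} (1 + b r^a)²))`, `b = (√2 / a)^a`. -/
def singularProfile (a r : ℝ) : ℝ :=
  Real.log (2 * a ^ 2 * (√2 / a) ^ a / (r ^ (2 - a) * (1 + (√2 / a) ^ a * r ^ a) ^ 2))

/-- `z` is a classical solution on `(0, ∞)` of `-z'' - z'/r = e^z`, `z(a/√2) = 0`,
`-(a/√2) z'(a/√2) = 2`, whose energy `∫_0^∞ e^z r dr` is `2a`. -/
structure IsSingularLiouville (a : ℝ) (z : ℝ → ℝ) : Prop where
  contDiffOn : ContDiffOn ℝ 2 z (Ioi 0)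
  equation : ∀ r : ℝ, 0 < r → -deriv (deriv z) r - 1 / r * deriv z r = Real.exp (z r)
  value : z (a / √2) = 0
  slope : -(a / √2) * deriv z (a / √2) = 2
  integrable : IntegrableOn (fun r : ℝ => Real.exp (z r) * r) (Ioi 0)
  mass : ∫ r in Ioi (0 : ℝ), Real.exp (z r) * r = 2 * a

/-- `(γ₀, ρ₀)` describes the first bubble, around the maximum point: `γ₀` is the scale and
`ρ₀ n ∈ (0, 1)` bounds a region in which the rescaled solution converges in `C¹` to the regular
profile and which carries exactly its energy `4` in the limit. -/
structure IsFirstBubble (p : ℝ) (h : ℝ → ℝ) (lam mu : ℕ → ℝ) (u : ℕ → ℝ → ℝ)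
    (γ₀ ρ₀ : ℕ → ℝ) : Prop where
  scale_pos : ∀ n, 0 < γ₀ n
  scale_eq : ∀ n, p * lam n * mu n ^ (p - 1) * nonlin p h (mu n) * γ₀ n ^ 2 = 1
  rho_mem : ∀ n, ρ₀ n ∈ Ioo (0 : ℝ) 1
  scale_tendsto : Tendsto γ₀ atTop (𝓝 0)
  rho_tendsto : Tendsto ρ₀ atTop (𝓝 0)
  ratio_tendsto : Tendsto (fun n => ρ₀ n / γ₀ n) atTop atTop
  value_tendsto : Tendsto (fun n => u n (ρ₀ n) / mu n) atTop (𝓝 1)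
  profile_tendsto : Tendsto (fun n => cNorm 1 0 (ρ₀ n / γ₀ n)
    (fun x => rescaled p (mu n) (γ₀ n) (u n) x - regularProfile x)) atTop (𝓝 0)
  energy_tendsto : Tendsto (fun n => energy p h (lam n) (mu n) (u n) 0 (ρ₀ n)) atTop (𝓝 4)

/-- The sequence `(u n)` has a bubble with parameters `a` and `d`, centred at the points `r n`,
with scale `γ n` and concentration region `[ρbar n, ρ n]`, and adjacent to the previous
concentration region, which ends at `ρprev n`. -/
structure IsBubble (p : ℝ) (h : ℝ → ℝ) (lam mu : ℕ → ℝ) (u : ℕ → ℝ → ℝ) (a d : ℝ)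
    (ρprev r ρbar ρ γ : ℕ → ℝ) : Prop where
  r_mem : ∀ n, r n ∈ Ioo (0 : ℝ) 1
  rhobar_mem : ∀ n, ρbar n ∈ Ioo (0 : ℝ) 1
  rho_mem : ∀ n, ρ n ∈ Ioo (0 : ℝ) 1
  value_r : Tendsto (fun n => u n (r n) / mu n) atTop (𝓝 d)
  center : Tendsto
    (fun n => p * lam n * r n ^ 2 * u n (r n) ^ (p - 1) * nonlin p h (u n (r n)))
    atTop (𝓝 (a ^ 2 / 2))
  value_rho : Tendsto (fun n => u n (ρ n) / mu n) atTop (𝓝 d)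
  value_rhobar : Tendsto (fun n => u n (ρbar n) / mu n) atTop (𝓝 d)
  rhoprev_rhobar : Tendsto (fun n => ρprev n / ρbar n) atTop (𝓝 0)
  rhobar_r : Tendsto (fun n => ρbar n / r n) atTop (𝓝 0)
  r_rho : Tendsto (fun n => r n / ρ n) atTop (𝓝 0)
  scale_pos : ∀ n, 0 < γ n
  scale_eq : ∀ n,
    γ n ^ 2 * (p * lam n * u n (r n) ^ (p - 1) * nonlin p h (u n (r n))) = 1
  scale_tendsto : Tendsto γ atTop (𝓝 0)
  profile_tendsto : Tendsto (fun n => cNorm 2 (ρbar n / γ n) (ρ n / γ n)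
    (fun x => rescaled p (u n (r n)) (γ n) (u n) x - singularProfile a x)) atTop (𝓝 0)
  energy_neck : Tendsto
    (fun n => energy p h (lam n) (mu n) (u n) (ρprev n) (ρbar n)) atTop (𝓝 0)
  energy_bubble : Tendsto
    (fun n => energy p h (lam n) (mu n) (u n) (ρbar n) (ρ n)) atTop (𝓝 (2 * a / d ^ (p - 1)))
  weighted_neck : Tendsto
    (fun n => weightedEnergy p h (lam n) (u n) (ρprev n) (ρbar n)) atTop (𝓝 0)
  weighted_bubble : Tendsto
    (fun n => weightedEnergy p h (lam n) (u n) (ρbar n) (ρ n)) atTop (𝓝 (2 * a))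

end

/-!
In logarithmic radius a radial solution is governed by a planar system. With the flux
`w = -r u'(r) = ∫_0^r λ f(u) s ds`, put `q = p u^{p-1} w` and `X = p λ r² u^{p-1} f(u)`. Then, up to
errors that vanish as `u → ∞`,

  `r X' = (2 - q) X`,  `r q' = X`,

which is the Liouville equation and conserves `H = (2 - q)² / 2 + X`. The bubble with parameter `a`
is the orbit with `H = a² / 2`: it runs from `q = 2 - a` to `q = 2 + a`, and its centre is the point
with `q = 2` and `X = a² / 2`. For the full system `H` is an adiabatic invariant: its variation is
bounded by the *relative* variation of `u`, whatever the number of logarithmic scales involved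
(`exists_adiabatic`). The first bubble starts at the origin, where `H = 2`, that is `a = 2`.

After a bubble (`IsNeckState`) the density `X` is small and `q` is close to `2 + a`. In the neck that
follows, `w` is constant up to a negligible amount, because convexity of `t ↦ t^p` makes `X` decay
like a power of the radius (`neck_decay`). So `u` is linear in `log r`, and
`log X / μ^p` is a strictly convex function of `y = u / μ`, which returns to `0` exactly at the level
`δ_{k+1}` given by the recurrence. There `q = 2 - a_{k+1}` (`IsNeckState.exists_next`). As `H` is now
close to `a_{k+1}² / 2`, the quantity `log X + q` grows at a definite rate until `q = 2`; since
`log X = o(μ^p)` at the start, this happens before `u / μ` has changed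
(`IsNeckState.exists_center`). The rescaled solution agrees with the singular profile at that centre
to first order, so an energy estimate gives convergence on every fixed window `[r/R, rR]`
(`IsNeckState.eventually_close`), and a diagonal argument lets `R → ∞` slowly
(`IsNeckState.exists_window`). All energies are differences of the flux `w`, hence can be read off
from the limits of `q` at the end points, and the end of the window is again a neck state
(`IsNeckState.exists_bubble`).

For the existence of the first bubble, `f` attains its maximum on `[0, μ]` at `μ` when `μ` is large,
which gives quadratic bounds on the drop of `u`; the same energy estimate, started at the origin,
yields convergence to the regular profile (`exists_isFirstBubble`).
-/

/-! ### Calculus and filter preliminaries -/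

/-- A function that is continuous on `[a, b]` and has nonnegative derivative inside satisfies
`f a ≤ f b`. -/
theorem le_of_hasDerivAt_nonneg {f f' : ℝ → ℝ} {a b : ℝ} (hab : a ≤ b)
    (hc : ContinuousOn f (Icc a b)) (hd : ∀ x ∈ Ioo a b, HasDerivAt f (f' x) x)
    (hn : ∀ x ∈ Ioo a b, 0 ≤ f' x) : f a ≤ f b := by
  have hm : MonotoneOn f (Icc a b) := by
    apply monotoneOn_of_deriv_nonneg (convex_Icc a b) hc
    · intro x hx
      rw [interior_Icc] at hx
      exact (hd x hx).differentiableAt.differentiableWithinAt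
    · intro x hx
      rw [interior_Icc] at hx
      rw [(hd x hx).deriv]
      exact hn x hx
  exact hm (left_mem_Icc.2 hab) (right_mem_Icc.2 hab) hab

/-- If a property `P ε n` holds eventually in `n` for each fixed `ε > 0`, then it holds eventually
along some sequence `ε n → 0`; moreover witnesses can be chosen for all `n` at once, subject to a
side condition `D` that is satisfiable for every `n`. -/
theorem exists_diagonal {α : Type*} {D : ℕ → α → Prop} {P : ℝ → ℕ → α → Prop}
    (hD : ∀ n, ∃ x, D n x) (hP : ∀ ε > 0, ∀ᶠ n in atTop, ∃ x, D n x ∧ P ε n x) :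
    ∃ (x : ℕ → α) (e : ℕ → ℝ), (∀ n, D n (x n)) ∧ (∀ n, 0 < e n) ∧ Tendsto e atTop (𝓝 0) ∧
      ∀ᶠ n in atTop, P (e n) n (x n) := by
  classical
  have hpos : ∀ m : ℕ, (0 : ℝ) < 1 / ((m : ℝ) + 1) := fun m => by positivity
  choose N hN using fun m : ℕ => eventually_atTop.1 (hP _ (hpos m))
  -- `k n` is the largest `m ≤ n` for which the property with tolerance `1 / (m + 1)` holds at `n`
  let Q : ℕ → ℕ → Prop := fun n m => ∃ x, D n x ∧ P (1 / ((m : ℝ) + 1)) n x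
  let k : ℕ → ℕ := fun n => Nat.findGreatest (Q n) n
  have hk : Tendsto k atTop atTop := by
    refine tendsto_atTop.2 fun m => ?_
    filter_upwards [eventually_ge_atTop (max (N m) m)] with n hn
    exact Nat.le_findGreatest (le_trans (le_max_right _ _) hn)
      (hN m n (le_trans (le_max_left _ _) hn))
  have hQ : ∀ᶠ n in atTop, Q n (k n) := by
    filter_upwards [eventually_ge_atTop (N 0)] with n hn
    exact Nat.findGreatest_spec (P := Q n) (Nat.zero_le n) (hN 0 n hn)
  have hx : ∀ n, ∃ x, D n x ∧ (Q n (k n) → P (1 / ((k n : ℝ) + 1)) n x) := by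
    intro n
    by_cases hq : Q n (k n)
    · obtain ⟨x, hx1, hx2⟩ := hq
      exact ⟨x, hx1, fun _ => hx2⟩
    · obtain ⟨x, hx1⟩ := hD n
      exact ⟨x, hx1, fun h => absurd h hq⟩
  choose x hx1 hx2 using hx
  refine ⟨x, fun n => 1 / ((k n : ℝ) + 1), hx1, fun n => hpos _,
    tendsto_one_div_add_atTop_nhds_zero_nat.comp hk, ?_⟩
  filter_upwards [hQ] with n hn using hx2 n hn

theorem tendsto_of_abs_sub_le {f e : ℕ → ℝ} {l : ℝ} (he : Tendsto e atTop (𝓝 0))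
    (h : ∀ᶠ n in atTop, |f n - l| ≤ e n) : Tendsto f atTop (𝓝 l) := by
  rw [tendsto_iff_norm_sub_tendsto_zero]
  exact squeeze_zero' (Eventually.of_forall fun n => norm_nonneg _) h he

theorem eventually_abs_sub_le {f : ℕ → ℝ} {l ε : ℝ} (hf : Tendsto f atTop (𝓝 l)) (hε : 0 < ε) :
    ∀ᶠ n in atTop, |f n - l| ≤ ε := by
  filter_upwards [(Metric.tendsto_nhds.1 hf) ε hε] with n hn
  exact (Real.dist_eq _ _ ▸ hn).le

/-! ### The recurrence -/

/-- Strict convexity of `x ↦ 2p/(2+c) (1-x) - 1 + x^p`, which vanishes at `1`: it is negative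
between any other zero and `1`. -/
theorem ratio_neg {p c x y : ℝ} (hp : 2 < p) (hx : 0 ≤ x) (hxy : x < y) (hy : y < 1)
    (h0 : 2 * p / (2 + c) * (1 - x) - 1 + x ^ p = 0) :
    2 * p / (2 + c) * (1 - y) - 1 + y ^ p < 0 := by
  have hconv := (strictConvexOn_rpow (p := p) (by linarith)).2 (mem_Ici.2 hx)
    (mem_Ici.2 zero_le_one) (by linarith : x ≠ 1)
    (div_pos (by linarith) (by linarith) : 0 < (1 - y) / (1 - x))
    (div_pos (by linarith) (by linarith) : 0 < (y - x) / (1 - x))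
    (by rw [← add_div]; rw [div_eq_one_iff_eq (by linarith)]; ring)
  have h1x : 1 - x ≠ 0 := by linarith
  have e1 : ((1 - y) / (1 - x)) • x + ((y - x) / (1 - x)) • (1 : ℝ) = y := by
    simp only [smul_eq_mul]; field_simp; ring
  rw [e1] at hconv
  simp only [smul_eq_mul, Real.one_rpow] at hconv
  have e2 : x ^ p = 1 - 2 * p / (2 + c) * (1 - x) := by linarith
  rw [e2] at hconv
  have e3 : (1 - y) / (1 - x) * (1 - 2 * p / (2 + c) * (1 - x)) + (y - x) / (1 - x) * 1
      = 1 - 2 * p / (2 + c) * (1 - y) := by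
    generalize 2 * p / (2 + c) = K
    field_simp; ring
  rw [e3] at hconv
  linarith

theorem ratio_slope_lt {p c x : ℝ} (hp : 2 < p) (hc : 0 < c) (hx : x ∈ Ioo (0 : ℝ) 1)
    (h0 : 2 * p / (2 + c) * (1 - x) - 1 + x ^ p = 0) : x ^ (p - 1) * (2 + c) < 2 := by
  obtain ⟨hx0, hx1⟩ := hx
  have hb := one_add_mul_self_lt_rpow_one_add (s := 1 / x - 1) (p := p)
    (by have : 0 < 1 / x := by positivity
        linarith)
    (by have : 1 < 1 / x := by rw [lt_div_iff₀ hx0]; linarith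
        linarith) (by linarith)
  have hxp : 0 < x ^ p := by positivity
  have e1 : (1 + (1 / x - 1)) ^ p = (x ^ p)⁻¹ := by
    rw [show 1 + (1 / x - 1) = x⁻¹ by ring, Real.inv_rpow hx0.le]
  rw [e1] at hb
  have e2 : x ^ p = x ^ (p - 1) * x := by
    rw [Real.rpow_sub hx0, Real.rpow_one]; field_simp
  have h3 : x ^ p + p * x ^ (p - 1) * (1 - x) < 1 := by
    have := mul_lt_mul_of_pos_left hb hxp
    rw [mul_inv_cancel₀ hxp.ne'] at this
    have e3 : x ^ p * (1 + p * (1 / x - 1)) = x ^ p + p * x ^ (p - 1) * (1 - x) := by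
      rw [e2]; field_simp
    linarith
  have h4 : p * x ^ (p - 1) * (1 - x) < 2 * p / (2 + c) * (1 - x) := by linarith
  have h5 := lt_of_mul_lt_mul_right h4 (by linarith)
  rw [lt_div_iff₀ (by linarith)] at h5
  nlinarith

theorem exists_ratio {p c : ℝ} (hp : 2 < p) (hc : 0 < c) (hc2 : c ≤ 2) :
    ∃ x ∈ Ioo (0 : ℝ) 1, 2 * p / (2 + c) * (1 - x) - 1 + x ^ p = 0 := by
  set g : ℝ → ℝ := fun x => 2 * p / (2 + c) * (1 - x) - 1 + x ^ p with hg
  have hd : HasDerivAt g (2 * p / (2 + c) * (0 - 1) + p * (1 : ℝ) ^ (p - 1)) 1 := by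
    have h1 := (((hasDerivAt_const (1 : ℝ) (1 : ℝ)).sub (hasDerivAt_id 1)).const_mul
      (2 * p / (2 + c))).sub_const 1
    exact h1.add (Real.hasDerivAt_rpow_const (Or.inl one_ne_zero))
  have hpos : 0 < 2 * p / (2 + c) * (0 - 1) + p * (1 : ℝ) ^ (p - 1) := by
    rw [Real.one_rpow]
    have : 2 * p / (2 + c) < p := by rw [div_lt_iff₀ (by linarith)]; nlinarith
    linarith
  have hg1 : g 1 = 0 := by simp [hg]
  have hs := (hasDerivAt_iff_tendsto_slope.1 hd).eventually (lt_mem_nhds hpos)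
  have hs' : ∀ᶠ y in 𝓝[<] (1 : ℝ), 0 < slope g 1 y :=
    hs.filter_mono (nhdsWithin_mono _ fun y hy => ne_of_lt hy)
  have hs2 : ∀ᶠ y in 𝓝[<] (1 : ℝ), y ∈ Ioo (0 : ℝ) 1 := Ioo_mem_nhdsLT one_pos
  obtain ⟨y, hy, hy0, hy1⟩ := (hs'.and hs2).exists
  have hgy : g y < 0 := by
    rw [slope_def_field, hg1, sub_zero] at hy
    by_contra hcon
    have := div_nonpos_of_nonneg_of_nonpos (not_lt.1 hcon) (by linarith : y - 1 ≤ 0)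
    linarith
  have hg0 : 0 < g 0 := by
    simp only [hg, sub_zero, mul_one, Real.zero_rpow (by linarith : p ≠ 0), add_zero]
    have : 1 < 2 * p / (2 + c) := by rw [lt_div_iff₀ (by linarith)]; linarith
    linarith
  have hcont : ContinuousOn g (Icc 0 y) := by
    apply Continuous.continuousOn
    have := Real.continuous_rpow_const (q := p) (by linarith)
    fun_prop
  obtain ⟨x, hx, hx0⟩ := intermediate_value_Ioo' hy0.le hcont ⟨hgy, hg0⟩
  exact ⟨x, ⟨hx.1, hx.2.trans hy1⟩, hx0⟩

theorem ratio_unique {p c x y : ℝ} (hp : 2 < p) (hx : x ∈ Ioo (0 : ℝ) 1) (hy : y ∈ Ioo (0 : ℝ) 1)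
    (hx0 : 2 * p / (2 + c) * (1 - x) - 1 + x ^ p = 0)
    (hy0 : 2 * p / (2 + c) * (1 - y) - 1 + y ^ p = 0) : x = y := by
  rcases lt_trichotomy x y with h | h | h
  · exact absurd hy0 (ratio_neg hp hx.1.le h hy.2 hx0).ne
  · exact h
  · exact absurd hx0 (ratio_neg hp hy.1.le h hx.2 hy0).ne

theorem IsBubbleRecurrence.delta_pos {p : ℝ} {a δ : ℕ → ℝ} (h : IsBubbleRecurrence p a δ) (k : ℕ) :
    0 < δ k := by
  cases k with
  | zero => rw [h.delta_zero]; exact one_pos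
  | succ k => exact (h.delta_mem k).1

theorem IsBubbleRecurrence.a_bounds {p : ℝ} {a δ : ℕ → ℝ} (h : IsBubbleRecurrence p a δ) (k : ℕ) :
    0 < a k ∧ a k ≤ 2 := by
  cases k with
  | zero => rw [h.a_zero]; norm_num
  | succ k => exact ⟨(h.a_mem k).1, (h.a_mem k).2.le⟩

theorem IsBubbleRecurrence.ratio_mem {p : ℝ} {a δ : ℕ → ℝ} (h : IsBubbleRecurrence p a δ) (k : ℕ) :
    δ (k + 1) / δ k ∈ Ioo (0 : ℝ) 1 :=
  ⟨div_pos (h.delta_pos _) (h.delta_pos _), (div_lt_one (h.delta_pos _)).2 (h.delta_mem k).2⟩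

theorem existsUnique_bubbleRecurrence {p : ℝ} (hp : 2 < p) :
    ∃! s : (ℕ → ℝ) × (ℕ → ℝ), IsBubbleRecurrence p s.1 s.2 := by
  choose! x hx hx0 using fun (c : ℝ) (hc : 0 < c ∧ c ≤ 2) => exists_ratio hp hc.1 hc.2
  let s : ℕ → ℝ × ℝ := fun n => Nat.rec (2, 1)
    (fun _ t => (2 - x t.1 ^ (p - 1) * (2 + t.1), x t.1 * t.2)) n
  have hs1 : ∀ k, (s (k + 1)).1 = 2 - x (s k).1 ^ (p - 1) * (2 + (s k).1) := fun k => rfl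
  have hs2 : ∀ k, (s (k + 1)).2 = x (s k).1 * (s k).2 := fun k => rfl
  have hb : ∀ k, (0 < (s k).1 ∧ (s k).1 ≤ 2) ∧ 0 < (s k).2 := by
    intro k
    induction k with
    | zero => exact ⟨⟨by simp [s], by simp [s]⟩, by simp [s]⟩
    | succ k ih =>
      rw [hs1, hs2]
      have h1 := ratio_slope_lt hp ih.1.1 (hx _ ih.1) (hx0 _ ih.1)
      have h2 : 0 < x (s k).1 ^ (p - 1) * (2 + (s k).1) :=
        mul_pos (Real.rpow_pos_of_pos (hx _ ih.1).1 _) (by linarith [ih.1.1])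
      exact ⟨⟨by linarith, by linarith⟩, mul_pos (hx _ ih.1).1 ih.2⟩
  have hr : ∀ k, (s (k + 1)).2 / (s k).2 = x (s k).1 := fun k => by
    rw [hs2, mul_div_assoc, div_self (hb k).2.ne', mul_one]
  refine ⟨(fun k => (s k).1, fun k => (s k).2), ?_, ?_⟩
  · refine ⟨rfl, rfl, fun k => ⟨(hb (k + 1)).2, ?_⟩, fun k => ⟨(hb (k + 1)).1.1, ?_⟩,
      fun k => ?_, fun k => ?_⟩
    · simp only [hs2]
      have := (hx _ (hb k).1).2
      have := (hb k).2
      nlinarith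
    · simp only [hs1]
      have h2 : 0 < x (s k).1 ^ (p - 1) * (2 + (s k).1) :=
        mul_pos (Real.rpow_pos_of_pos (hx _ (hb k).1).1 _) (by linarith [(hb k).1.1])
      linarith
    · simp only [hr]; exact hx0 _ (hb k).1
    · simp only [hr]; exact hs1 k
  · rintro ⟨a, δ⟩ h
    have key : ∀ k, a k = (s k).1 ∧ δ k = (s k).2 := by
      intro k
      induction k with
      | zero => exact ⟨h.a_zero, h.delta_zero⟩
      | succ k ih =>
        have e : δ (k + 1) / δ k = x (s k).1 := by
          apply ratio_unique hp (h.ratio_mem k) (hx _ (hb k).1) (h.delta_eq k)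
          rw [show (a, δ).1 k = (s k).1 from ih.1]
          exact hx0 _ (hb k).1
        constructor
        · have := h.a_eq k
          simp only at this e
          rw [this, hs1, e, ih.1]
        · rw [hs2, ← e, ← ih.2, div_mul_cancel₀ _ (h.delta_pos k).ne']
    ext k
    · exact (key k).1
    · exact (key k).2

/-! ### The singular profile -/

/-- The quantity `y = b x^a`, `b = (√2 / a)^a`, in terms of which the singular profile and its
derivatives are rational. It solves `x y' = a y`. -/
noncomputable def profileVar (a x : ℝ) : ℝ := (√2 / a) ^ a * x ^ a

/-- The flux `-x z'(x)` of the singular profile. -/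
noncomputable def profileFlux (a x : ℝ) : ℝ :=
  2 - a + 2 * a * profileVar a x / (1 + profileVar a x)

section profile

variable {a x : ℝ}

theorem profileVar_pos (ha : 0 < a) (hx : 0 < x) : 0 < profileVar a x := by
  unfold profileVar; positivity

theorem profileVar_center (ha : 0 < a) : profileVar a (a / √2) = 1 := by
  unfold profileVar
  rw [← Real.mul_rpow (by positivity) (by positivity)]
  have : √2 / a * (a / √2) = 1 := by field_simp
  rw [this, Real.one_rpow]

theorem hasDerivAt_profileVar (hx : 0 < x) :
    HasDerivAt (profileVar a) (a * profileVar a x / x) x := by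
  have h := (Real.hasDerivAt_rpow_const (p := a) (Or.inl hx.ne')).const_mul ((√2 / a) ^ a)
  refine h.congr_deriv ?_
  unfold profileVar
  rw [Real.rpow_sub hx, Real.rpow_one]
  ring

theorem singularProfile_eq (ha : 0 < a) (hx : 0 < x) :
    singularProfile a x =
      Real.log (2 * a ^ 2) + Real.log (profileVar a x) - 2 * Real.log x
        - 2 * Real.log (1 + profileVar a x) := by
  have hy := profileVar_pos ha hx
  have e : 2 * a ^ 2 * (√2 / a) ^ a / (x ^ (2 - a) * (1 + (√2 / a) ^ a * x ^ a) ^ 2) =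
      2 * a ^ 2 * profileVar a x / (x ^ 2 * (1 + profileVar a x) ^ 2) := by
    unfold profileVar
    rw [Real.rpow_sub hx, Real.rpow_two]
    have : x ^ a ≠ 0 := by positivity
    field_simp
  unfold singularProfile
  rw [e, Real.log_div (by positivity) (by positivity), Real.log_mul (by positivity) hy.ne',
    Real.log_mul (x := x ^ 2) (by positivity) (by positivity), Real.log_pow x,
    Real.log_pow (1 + profileVar a x)]
  push_cast
  ring

theorem exp_singularProfile (ha : 0 < a) (hx : 0 < x) :
    Real.exp (singularProfile a x) =
      2 * a ^ 2 * profileVar a x / (x ^ 2 * (1 + profileVar a x) ^ 2) := by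
  have hy := profileVar_pos ha hx
  rw [singularProfile_eq ha hx]
  have : Real.log (2 * a ^ 2) + Real.log (profileVar a x) - 2 * Real.log x
        - 2 * Real.log (1 + profileVar a x) =
      Real.log (2 * a ^ 2 * profileVar a x / (x ^ 2 * (1 + profileVar a x) ^ 2)) := by
    rw [Real.log_div (by positivity) (by positivity), Real.log_mul (by positivity) hy.ne',
      Real.log_mul (x := x ^ 2) (by positivity) (by positivity), Real.log_pow x,
    Real.log_pow (1 + profileVar a x)]
    push_cast
    ring
  rw [this, Real.exp_log (by positivity)]

theorem hasDerivAt_singularProfile (ha : 0 < a) (hx : 0 < x) :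
    HasDerivAt (singularProfile a) (-profileFlux a x / x) x := by
  have hy := profileVar_pos ha hx
  have hd := hasDerivAt_profileVar (a := a) hx
  have h1 := ((((hd.log hy.ne').const_add (Real.log (2 * a ^ 2))).sub
    ((Real.hasDerivAt_log hx.ne').const_mul 2)).sub
      (((hd.const_add 1).log (by positivity)).const_mul 2))
  refine (h1.congr_of_eventuallyEq ?_).congr_deriv ?_
  · filter_upwards [lt_mem_nhds hx] with t ht
    exact singularProfile_eq ha ht
  · unfold profileFlux
    field_simp
    ring

theorem hasDerivAt_profileFlux (ha : 0 < a) (hx : 0 < x) :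
    HasDerivAt (profileFlux a) (Real.exp (singularProfile a x) * x) x := by
  have hy := profileVar_pos ha hx
  have hd := hasDerivAt_profileVar (a := a) hx
  have h1 := ((hd.const_mul (2 * a)).div (hd.const_add 1) (by positivity)).const_add (2 - a)
  have h2 : HasDerivAt (profileFlux a) _ x := h1
  refine h2.congr_deriv ?_
  rw [exp_singularProfile ha hx]
  field_simp
  ring

theorem hasDerivAt_deriv_singularProfile (ha : 0 < a) (hx : 0 < x) :
    HasDerivAt (fun t => -profileFlux a t / t)
      (profileFlux a x / x ^ 2 - Real.exp (singularProfile a x)) x := by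
  refine ((hasDerivAt_profileFlux ha hx).neg.div (hasDerivAt_id x) hx.ne').congr_deriv ?_
  simp only [id]
  field_simp
  simp only [Pi.neg_apply]
  ring

theorem profileFlux_center (ha : 0 < a) : profileFlux a (a / √2) = 2 := by
  unfold profileFlux
  rw [profileVar_center ha]
  ring

theorem singularProfile_center (ha : 0 < a) : singularProfile a (a / √2) = 0 := by
  have hx : 0 < a / √2 := by positivity
  apply Real.exp_injective
  rw [exp_singularProfile ha hx, profileVar_center ha, Real.exp_zero, div_pow, Real.sq_sqrt
    (by norm_num)]
  field_simp
  norm_num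

theorem tendsto_profileVar (ha : 0 < a) : Tendsto (profileVar a) atTop atTop :=
  (tendsto_rpow_atTop ha).const_mul_atTop (by positivity)

theorem tendsto_profileFlux (ha : 0 < a) : Tendsto (profileFlux a) atTop (𝓝 (2 + a)) := by
  have h1 : Tendsto (fun x => 2 + a - 2 * a / (1 + profileVar a x)) atTop (𝓝 (2 + a - 0)) :=
    tendsto_const_nhds.sub (tendsto_const_nhds.div_atTop
      (tendsto_atTop_add_const_left _ _ (tendsto_profileVar ha)))
  rw [sub_zero] at h1
  refine h1.congr' ?_
  filter_upwards [eventually_gt_atTop 0] with x hx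
  have hy := profileVar_pos ha hx
  unfold profileFlux
  field_simp
  ring

theorem profileVar_zero (ha : 0 < a) : profileVar a 0 = 0 := by
  simp [profileVar, Real.zero_rpow ha.ne']

theorem continuousAt_profileFlux_zero (ha : 0 < a) : ContinuousAt (profileFlux a) 0 := by
  have h1 : ContinuousAt (profileVar a) 0 :=
    (Real.continuous_rpow_const ha.le).continuousAt.const_mul _
  have h2 : 1 + profileVar a 0 ≠ 0 := by simp [profileVar_zero ha]
  unfold profileFlux
  exact continuousAt_const.add ((continuousAt_const.mul h1).div (continuousAt_const.add h1) h2)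

theorem profileFlux_zero (ha : 0 < a) : profileFlux a 0 = 2 - a := by
  simp [profileFlux, profileVar_zero ha]

theorem isSingularLiouville_singularProfile (ha : 0 < a) :
    IsSingularLiouville a (singularProfile a) := by
  have hd : ∀ x : ℝ, 0 < x → deriv (singularProfile a) x = -profileFlux a x / x :=
    fun x hx => (hasDerivAt_singularProfile ha hx).deriv
  have hnn : ∀ x ∈ Ioi (0 : ℝ), 0 ≤ Real.exp (singularProfile a x) * x :=
    fun x hx => mul_nonneg (Real.exp_pos _).le (le_of_lt hx)
  have hF : ∀ x ∈ Ioi (0 : ℝ),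
      HasDerivAt (profileFlux a) (Real.exp (singularProfile a x) * x) x :=
    fun x hx => hasDerivAt_profileFlux ha hx
  refine ⟨?_, ?_, singularProfile_center ha, ?_, ?_, ?_⟩
  · have hv : ContDiffOn ℝ 2 (profileVar a) (Ioi 0) := fun x hx =>
      (contDiffAt_const.mul
        (Real.contDiffAt_rpow_const_of_ne (ne_of_gt hx))).contDiffWithinAt
    have hid : ContDiffOn ℝ 2 (fun x : ℝ => x) (Ioi 0) := contDiffOn_id
    refine ContDiffOn.congr ?_ fun x hx => singularProfile_eq ha hx
    have hl1 := hv.log fun x hx => (profileVar_pos ha hx).ne'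
    have hl2 := hid.log fun x hx => ne_of_gt hx
    have hl3 := (contDiffOn_const (c := (1 : ℝ)).add hv).log fun x hx => by
      have := profileVar_pos ha hx
      positivity
    exact ((contDiffOn_const.add hl1).sub (contDiffOn_const.mul hl2)).sub
      (contDiffOn_const.mul hl3)
  · intro x hx
    have e : deriv (singularProfile a) =ᶠ[𝓝 x] fun t => -profileFlux a t / t := by
      filter_upwards [lt_mem_nhds hx] with t ht using hd t ht
    rw [e.deriv_eq, (hasDerivAt_deriv_singularProfile ha hx).deriv, hd x hx]
    field_simp
    ring
  · have hx : 0 < a / √2 := by positivity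
    rw [hd _ hx, profileFlux_center ha]
    field_simp
  · exact integrableOn_Ioi_deriv_of_nonneg (continuousAt_profileFlux_zero ha).continuousWithinAt
      hF hnn (tendsto_profileFlux ha)
  · rw [integral_Ioi_of_hasDerivAt_of_nonneg
      (continuousAt_profileFlux_zero ha).continuousWithinAt hF hnn (tendsto_profileFlux ha),
      profileFlux_zero ha]
    ring

end profile

/-! ### Elementary properties of radial solutions -/

/-- The flux `-r u'(r) = ∫_0^r λ f(u) s ds` of a radial function. -/
noncomputable def flux (u : ℝ → ℝ) (r : ℝ) : ℝ := -(r * derivWithin u (Icc 0 1) r)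

/-- The normalized flux `q(r) = -p u^{p-1} r u'(r)`; in a bubble with parameter `a` it increases
from `2 - a` to `2 + a`. -/
noncomputable def scaledFlux (p : ℝ) (u : ℝ → ℝ) (r : ℝ) : ℝ := p * u r ^ (p - 1) * flux u r

/-- The normalized energy density `X(r) = p λ r² u^{p-1} f(u)` in logarithmic radius. -/
noncomputable def density (p : ℝ) (h : ℝ → ℝ) (lam : ℝ) (u : ℝ → ℝ) (r : ℝ) : ℝ :=
  p * lam * r ^ 2 * u r ^ (p - 1) * nonlin p h (u r)

/-- The quantity `(2 - q)² / 2 + X`, which is conserved in logarithmic radius by the limiting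
Liouville system `X' = (2 - q) X`, `q' = X`. -/
noncomputable def hamiltonian (p : ℝ) (h : ℝ → ℝ) (lam : ℝ) (u : ℝ → ℝ) (r : ℝ) : ℝ :=
  (2 - scaledFlux p u r) ^ 2 / 2 + density p h lam u r

theorem IsGrowthFactor.hasDerivAt {h : ℝ → ℝ} (hh : IsGrowthFactor h) {t : ℝ} (ht : 0 < t) :
    HasDerivAt h (deriv h t) t :=
  ((hh.contDiffOn.contDiffAt (Ici_mem_nhds ht)).differentiableAt (by norm_num)).hasDerivAt

theorem nonlin_nonneg {p : ℝ} {h : ℝ → ℝ} (hh : IsGrowthFactor h) {t : ℝ} (ht : 0 ≤ t) :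
    0 ≤ nonlin p h t :=
  mul_nonneg (hh.nonneg t ht) (Real.exp_pos _).le

theorem continuousOn_nonlin {p : ℝ} (hp : 2 < p) {h : ℝ → ℝ} (hh : IsGrowthFactor h) :
    ContinuousOn (nonlin p h) (Ici 0) :=
  hh.contDiffOn.continuousOn.mul
    (Real.continuous_exp.comp (Real.continuous_rpow_const (by linarith))).continuousOn

namespace IsRadialSolution

variable {p : ℝ} {h : ℝ → ℝ} {lam mu : ℝ} {u : ℝ → ℝ}

theorem continuousOn (hu : IsRadialSolution p h lam mu u) : ContinuousOn u (Icc 0 1) :=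
  hu.contDiffOn.continuousOn

theorem contDiffOn_derivWithin (hu : IsRadialSolution p h lam mu u) :
    ContDiffOn ℝ 1 (derivWithin u (Icc 0 1)) (Icc 0 1) :=
  hu.contDiffOn.derivWithin (uniqueDiffOn_Icc one_pos) (by norm_num)

theorem nonneg (hu : IsRadialSolution p h lam mu u) {r : ℝ} (hr : r ∈ Icc (0 : ℝ) 1) :
    0 ≤ u r := by
  refine ContinuousWithinAt.closure_le (s := Ioo (0 : ℝ) 1) (f := fun _ => (0 : ℝ)) ?_
    continuousWithinAt_const ((hu.continuousOn r hr).mono Ioo_subset_Icc_self) fun y hy =>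
    (hu.pos y hy).le
  rwa [closure_Ioo zero_ne_one]

theorem hasDerivAt (hu : IsRadialSolution p h lam mu u) {r : ℝ} (hr : r ∈ Ioo (0 : ℝ) 1) :
    HasDerivAt u (derivWithin u (Icc 0 1) r) r :=
  ((hu.contDiffOn.differentiableOn (by norm_num)) r
    (Ioo_subset_Icc_self hr)).hasDerivWithinAt.hasDerivAt (Icc_mem_nhds hr.1 hr.2)

theorem hasDerivAt' (hu : IsRadialSolution p h lam mu u) {r : ℝ} (hr : r ∈ Ioo (0 : ℝ) 1) :
    HasDerivAt u (-(flux u r / r)) r := by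
  refine (hu.hasDerivAt hr).congr_deriv ?_
  have := hr.1.ne'
  unfold flux
  field_simp

theorem hasDerivAt_derivWithin (hu : IsRadialSolution p h lam mu u) {r : ℝ}
    (hr : r ∈ Ioo (0 : ℝ) 1) :
    HasDerivAt (derivWithin u (Icc 0 1))
      (-(derivWithin u (Icc 0 1) r / r) - lam * nonlin p h (u r)) r := by
  have h1 := ((hu.contDiffOn_derivWithin.differentiableOn (by norm_num)) r
    (Ioo_subset_Icc_self hr)).hasDerivWithinAt.hasDerivAt (Icc_mem_nhds hr.1 hr.2)
  have e : deriv u =ᶠ[𝓝 r] derivWithin u (Icc 0 1) := by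
    filter_upwards [Ioo_mem_nhds hr.1 hr.2] with t ht using (hu.hasDerivAt ht).deriv
  have h2 : deriv (deriv u) r = deriv (derivWithin u (Icc 0 1)) r := e.deriv_eq
  have h3 := hu.equation r hr
  rw [(hu.hasDerivAt hr).deriv, h2] at h3
  refine h1.differentiableAt.hasDerivAt.congr_deriv ?_
  rw [← h3]
  ring

theorem hasDerivAt_flux (hu : IsRadialSolution p h lam mu u) {r : ℝ} (hr : r ∈ Ioo (0 : ℝ) 1) :
    HasDerivAt (flux u) (lam * nonlin p h (u r) * r) r := by
  refine ((hasDerivAt_id r).mul (hu.hasDerivAt_derivWithin hr)).neg.congr_deriv ?_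
  have := hr.1.ne'
  simp only [id]
  field_simp
  ring

theorem continuousOn_flux (hu : IsRadialSolution p h lam mu u) :
    ContinuousOn (flux u) (Icc 0 1) :=
  (continuousOn_id.mul hu.contDiffOn_derivWithin.continuousOn).neg

theorem flux_le (hu : IsRadialSolution p h lam mu u) (hh : IsGrowthFactor h) {r s : ℝ}
    (hr : 0 ≤ r) (hrs : r ≤ s) (hs : s ≤ 1) : flux u r ≤ flux u s := by
  refine le_of_hasDerivAt_nonneg hrs (hu.continuousOn_flux.mono (Icc_subset_Icc hr hs))
    (fun x hx => hu.hasDerivAt_flux ⟨hr.trans_lt hx.1, hx.2.trans_le hs⟩) fun x hx => ?_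
  have hx' : x ∈ Ioo (0 : ℝ) 1 := ⟨hr.trans_lt hx.1, hx.2.trans_le hs⟩
  exact mul_nonneg (mul_nonneg hu.lam_pos.le (nonlin_nonneg hh (hu.pos x hx').le)) hx'.1.le

theorem flux_zero : flux u 0 = 0 := by simp [flux]

theorem flux_nonneg (hu : IsRadialSolution p h lam mu u) (hh : IsGrowthFactor h) {r : ℝ}
    (hr : r ∈ Icc (0 : ℝ) 1) : 0 ≤ flux u r := by
  rw [← flux_zero (u := u)]
  exact hu.flux_le hh le_rfl hr.1 hr.2

theorem le_of_le (hu : IsRadialSolution p h lam mu u) (hh : IsGrowthFactor h) {r s : ℝ}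
    (hr : 0 ≤ r) (hrs : r ≤ s) (hs : s ≤ 1) : u s ≤ u r := by
  have := le_of_hasDerivAt_nonneg (f := fun x => -u x) hrs
    (hu.continuousOn.mono (Icc_subset_Icc hr hs)).neg
    (fun x hx => (hu.hasDerivAt' ⟨hr.trans_lt hx.1, hx.2.trans_le hs⟩).neg) fun x hx => by
      have hx' : x ∈ Ioo (0 : ℝ) 1 := ⟨hr.trans_lt hx.1, hx.2.trans_le hs⟩
      rw [neg_neg]
      exact div_nonneg (hu.flux_nonneg hh (Ioo_subset_Icc_self hx')) hx'.1.le
  linarith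

theorem le_mu (hu : IsRadialSolution p h lam mu u) (hh : IsGrowthFactor h) {r : ℝ}
    (hr : r ∈ Icc (0 : ℝ) 1) : u r ≤ mu :=
  hu.value_zero ▸ hu.le_of_le hh le_rfl hr.1 hr.2

theorem mu_pos (hu : IsRadialSolution p h lam mu u) (hh : IsGrowthFactor h) : 0 < mu :=
  lt_of_lt_of_le (hu.pos (1 / 2) (by norm_num)) (hu.le_mu hh (by norm_num))

/-- A positive level below `u s` is attained beyond `s`. -/
theorem exists_eq (hu : IsRadialSolution p h lam mu u) {s y : ℝ} (hs : 0 ≤ s) (hs1 : s ≤ 1)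
    (hy : 0 < y) (hys : y < u s) : ∃ r ∈ Ioo s 1, u r = y := by
  have := intermediate_value_Ioo' hs1 (hu.continuousOn.mono (Icc_subset_Icc_left hs))
  rw [hu.value_one] at this
  obtain ⟨r, hr, he⟩ := this ⟨hy, hys⟩
  exact ⟨r, hr, he⟩

theorem continuousOn_comp_nonlin (hp : 2 < p) (hu : IsRadialSolution p h lam mu u)
    (hh : IsGrowthFactor h) : ContinuousOn (fun r => nonlin p h (u r)) (Icc 0 1) :=
  (continuousOn_nonlin hp hh).comp hu.continuousOn fun _ hr => hu.nonneg hr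

theorem continuousOn_rpow (hp : 2 < p) (hu : IsRadialSolution p h lam mu u) :
    ContinuousOn (fun r => u r ^ (p - 1)) (Icc 0 1) :=
  hu.continuousOn.rpow_const fun _ _ => Or.inr (by linarith)

theorem integral_eq (hp : 2 < p) (hu : IsRadialSolution p h lam mu u) (hh : IsGrowthFactor h)
    {s t : ℝ} (hs : 0 ≤ s) (hst : s ≤ t) (ht : t ≤ 1) :
    ∫ r in s..t, lam * nonlin p h (u r) * r = flux u t - flux u s := by
  refine intervalIntegral.integral_eq_sub_of_hasDerivAt_of_le hst
    (hu.continuousOn_flux.mono (Icc_subset_Icc hs ht))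
    (fun x hx => hu.hasDerivAt_flux ⟨hs.trans_lt hx.1, hx.2.trans_le ht⟩) ?_
  apply ContinuousOn.intervalIntegrable
  rw [uIcc_of_le hst]
  exact ((continuousOn_const.mul (hu.continuousOn_comp_nonlin hp hh)).mul continuousOn_id).mono
    (Icc_subset_Icc hs ht)

theorem energy_eq (hp : 2 < p) (hu : IsRadialSolution p h lam mu u) (hh : IsGrowthFactor h)
    {s t : ℝ} (hs : 0 ≤ s) (hst : s ≤ t) (ht : t ≤ 1) (m : ℝ) :
    energy p h lam m u s t = p * m ^ (p - 1) * (flux u t - flux u s) := by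
  rw [energy, hu.integral_eq hp hh hs hst ht]

/-- The weighted energy lies between multiples of the energy, `u` being decreasing. -/
theorem weightedEnergy_bounds (hp : 2 < p) (hu : IsRadialSolution p h lam mu u)
    (hh : IsGrowthFactor h) {s t : ℝ} (hs : 0 ≤ s) (hst : s ≤ t) (ht : t ≤ 1) :
    p * u t ^ (p - 1) * (flux u t - flux u s) ≤ weightedEnergy p h lam u s t ∧
      weightedEnergy p h lam u s t ≤ p * u s ^ (p - 1) * (flux u t - flux u s) := by
  have hsub : Icc s t ⊆ Icc (0 : ℝ) 1 := Icc_subset_Icc hs ht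
  have hf := (hu.continuousOn_comp_nonlin hp hh).mono hsub
  have hr := (hu.continuousOn_rpow hp).mono hsub
  have hb : ContinuousOn (fun r => lam * nonlin p h (u r) * r) (Icc s t) :=
    (continuousOn_const.mul hf).mul continuousOn_id
  have hi0 : IntervalIntegrable (fun r => lam * nonlin p h (u r) * r) volume s t :=
    ContinuousOn.intervalIntegrable (by rwa [uIcc_of_le hst])
  have hi1 : IntervalIntegrable (fun r => lam * u r ^ (p - 1) * nonlin p h (u r) * r)
      volume s t :=
    ContinuousOn.intervalIntegrable (by
      rw [uIcc_of_le hst]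
      exact ((continuousOn_const.mul hr).mul hf).mul continuousOn_id)
  have hp0 : 0 ≤ p := by linarith
  have hp1 : 0 ≤ p - 1 := by linarith
  have key : ∀ x ∈ Icc s t,
      u t ^ (p - 1) * (lam * nonlin p h (u x) * x) ≤ lam * u x ^ (p - 1) * nonlin p h (u x) * x ∧
      lam * u x ^ (p - 1) * nonlin p h (u x) * x ≤
        u s ^ (p - 1) * (lam * nonlin p h (u x) * x) := by
    intro x hx
    have hx0 := hu.nonneg (hsub hx)
    have hn : 0 ≤ lam * nonlin p h (u x) * x :=
      mul_nonneg (mul_nonneg hu.lam_pos.le (nonlin_nonneg hh hx0)) (hs.trans hx.1)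
    have e : lam * u x ^ (p - 1) * nonlin p h (u x) * x =
      u x ^ (p - 1) * (lam * nonlin p h (u x) * x) := by ring
    rw [e]
    exact ⟨mul_le_mul_of_nonneg_right (Real.rpow_le_rpow
        (hu.nonneg (hsub (right_mem_Icc.2 hst)))
        (hu.le_of_le hh (hs.trans hx.1) hx.2 ht) hp1) hn,
      mul_le_mul_of_nonneg_right (Real.rpow_le_rpow hx0
        (hu.le_of_le hh hs hx.1 (hx.2.trans ht)) hp1) hn⟩
  rw [weightedEnergy, ← hu.integral_eq hp hh hs hst ht, mul_assoc, mul_assoc]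
  constructor
  · refine mul_le_mul_of_nonneg_left ?_ hp0
    rw [← intervalIntegral.integral_const_mul]
    exact intervalIntegral.integral_mono_on hst (hi0.const_mul _) hi1 fun x hx => (key x hx).1
  · refine mul_le_mul_of_nonneg_left ?_ hp0
    rw [← intervalIntegral.integral_const_mul]
    exact intervalIntegral.integral_mono_on hst hi1 (hi0.const_mul _) fun x hx => (key x hx).2

/-! ### Positivity of the nonlinearity at the maximum -/

/-- `f(μ) > 0`: otherwise `u ≡ μ` by uniqueness for the initial value problem, `f` being
Lipschitz near `μ`. -/
theorem nonlin_mu_pos (hu : IsRadialSolution p h lam mu u) (hh : IsGrowthFactor h) :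
    0 < nonlin p h mu := by
  have hmu := hu.mu_pos hh
  by_contra hcon
  have hf0 : nonlin p h mu = 0 := le_antisymm (not_lt.1 hcon) (nonlin_nonneg hh hmu.le)
  -- Lipschitz bound on `[μ/2, μ]`
  have hcd : ContDiffOn ℝ 1 (nonlin p h) (Icc (mu / 2) mu) := by
    refine (hh.contDiffOn.mono fun x hx => (by linarith [hx.1] : (0 : ℝ) ≤ x)).mul ?_
    refine Real.contDiff_exp.comp_contDiffOn ?_
    exact contDiffOn_id.rpow_const_of_ne fun x hx => by
      have := hx.1
      simp only [id]
      linarith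
  obtain ⟨L, hL⟩ := hcd.exists_lipschitzOnWith (by norm_num) (convex_Icc _ _) isCompact_Icc
  obtain ⟨b, hb, hbu⟩ := hu.exists_eq (s := 0) le_rfl zero_le_one (half_pos hmu)
    (by rw [hu.value_zero]; linarith)
  set K : ℝ := lam * L with hK
  have hK0 : 0 ≤ K := mul_nonneg hu.lam_pos.le L.2
  have hmem : ∀ x ∈ Icc 0 b, u x ∈ Icc (mu / 2) mu := fun x hx =>
    ⟨hbu ▸ hu.le_of_le hh hx.1 hx.2 hb.2.le, hu.le_mu hh ⟨hx.1, hx.2.trans hb.2.le⟩⟩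
  have hlip : ∀ x ∈ Icc 0 b, lam * nonlin p h (u x) ≤ K * (mu - u x) := by
    intro x hx
    have h1 := hL.dist_le_mul (u x) (hmem x hx) mu ⟨by linarith, le_rfl⟩
    rw [Real.dist_eq, Real.dist_eq, hf0, sub_zero, abs_sub_comm,
      abs_of_nonneg (sub_nonneg.2 (hmem x hx).2)] at h1
    have := mul_le_mul_of_nonneg_left ((le_abs_self _).trans h1) hu.lam_pos.le
    rw [hK, mul_assoc]
    exact this
  have hsub : ∀ x ∈ Ioo 0 b, x ∈ Ioo (0 : ℝ) 1 := fun x hx => ⟨hx.1, hx.2.trans hb.2⟩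
  have hflux : ∀ x ∈ Icc 0 b, flux u x ≤ K * (mu - u x) * x ^ 2 / 2 := by
    intro x hx
    have := le_of_hasDerivAt_nonneg (f := fun x => K * (mu - u x) * x ^ 2 / 2 - flux u x)
      (f' := fun x => (K * (flux u x / x) * x ^ 2 + K * (mu - u x) * (2 * x)) / 2
        - lam * nonlin p h (u x) * x) hx.1 ?_ ?_ ?_
    · simp only [flux_zero] at this
      norm_num at this
      linarith
    · have hs : Icc 0 x ⊆ Icc (0 : ℝ) 1 := Icc_subset_Icc_right (hx.2.trans hb.2.le)
      have h1 := hu.continuousOn.mono hs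
      have h2 := hu.continuousOn_flux.mono hs
      fun_prop
    · intro y hy
      have hy' := hsub y ⟨hy.1, hy.2.trans_le hx.2⟩
      have h1 := ((((hasDerivAt_const y mu).sub (hu.hasDerivAt' hy')).const_mul K).mul
        (hasDerivAt_pow 2 y)).div_const 2
      refine (h1.sub (hu.hasDerivAt_flux hy')).congr_deriv ?_
      simp
    · intro y hy
      have hy' := hsub y ⟨hy.1, hy.2.trans_le hx.2⟩
      have h1 := hlip y ⟨hy.1.le, hy.2.le.trans hx.2⟩
      have h2 := hu.flux_nonneg hh (Ioo_subset_Icc_self hy')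
      have h3 : 0 ≤ K * (flux u y / y) * y ^ 2 :=
        mul_nonneg (mul_nonneg hK0 (div_nonneg h2 hy.1.le)) (sq_nonneg _)
      have h4 := mul_le_mul_of_nonneg_right h1 hy.1.le
      nlinarith
  have hend := le_of_hasDerivAt_nonneg
    (f := fun x => (u x - mu) * Real.exp (-(K * x ^ 2 / 4)))
    (f' := fun x => -(flux u x / x) * Real.exp (-(K * x ^ 2 / 4)) +
      (u x - mu) * (Real.exp (-(K * x ^ 2 / 4)) * -(K * (2 * x) / 4))) hb.1.le ?_ ?_ ?_
  · simp only [hu.value_zero, sub_self, zero_mul] at hend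
    have := nonneg_of_mul_nonneg_left hend (Real.exp_pos _)
    linarith
  · have h1 := hu.continuousOn.mono (Icc_subset_Icc_right hb.2.le : Icc 0 b ⊆ Icc (0 : ℝ) 1)
    fun_prop
  · intro x hx
    have h1 := ((((hasDerivAt_pow 2 x).const_mul K).div_const 4).neg).exp
    refine (((hu.hasDerivAt' (hsub x hx)).sub_const mu).mul h1).congr_deriv ?_
    simp
  · intro x hx
    have h1 := hflux x ⟨hx.1.le, hx.2.le⟩
    have h2 : flux u x / x ≤ K * (mu - u x) * x / 2 := by
      rw [div_le_iff₀ hx.1]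
      linarith
    have h3 := (Real.exp_pos (-(K * x ^ 2 / 4))).le
    have : -(flux u x / x) * Real.exp (-(K * x ^ 2 / 4)) +
      (u x - mu) * (Real.exp (-(K * x ^ 2 / 4)) * -(K * (2 * x) / 4)) =
      (K * (mu - u x) * x / 2 - flux u x / x) * Real.exp (-(K * x ^ 2 / 4)) := by ring
    rw [this]
    exact mul_nonneg (by linarith) h3

/-- There are points of `(0, 1)` at which the nonlinearity does not vanish. -/
theorem exists_nonlin_pos (hp : 2 < p) (hu : IsRadialSolution p h lam mu u)
    (hh : IsGrowthFactor h) : ∃ r ∈ Ioo (0 : ℝ) 1, 0 < nonlin p h (u r) := by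
  have h1 := (hu.continuousOn_comp_nonlin hp hh) 0 (by simp)
  have h2 : ∀ᶠ r in 𝓝[Icc 0 1] (0 : ℝ), 0 < nonlin p h (u r) :=
    h1.eventually (lt_mem_nhds (by
      simp only [hu.value_zero]
      exact hu.nonlin_mu_pos hh))
  have h3 : ∀ᶠ r in 𝓝[>] (0 : ℝ), 0 < nonlin p h (u r) := by
    have : 𝓝[Ioo 0 1] (0 : ℝ) ≤ 𝓝[Icc 0 1] (0 : ℝ) := nhdsWithin_mono _ Ioo_subset_Icc_self
    rw [← nhdsWithin_Ioo_eq_nhdsGT (one_pos : (0 : ℝ) < 1)]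
    exact h2.filter_mono this
  obtain ⟨r, hr, hr'⟩ := (h3.and (Ioo_mem_nhdsGT one_pos)).exists
  exact ⟨r, hr', hr⟩

end IsRadialSolution

/-! ### The nonlinearity at large arguments -/

/-- Beyond `T`, the factor `h` is positive and the logarithmic derivatives of `h` and `t^{p-1}`
are at most `ε t^{p-1}`. -/
def TailBound (p : ℝ) (h : ℝ → ℝ) (ε T : ℝ) : Prop :=
  ∀ t, T ≤ t → 1 ≤ t ∧ 0 < h t ∧ |deriv h t| ≤ ε * (t ^ (p - 1) * h t) ∧ p - 1 ≤ ε * t ^ p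

theorem eventually_tailBound {p : ℝ} (hp : 2 < p) {h : ℝ → ℝ} (hh : IsGrowthFactor h)
    (hsub : SubordinateGrowth p h) {ε : ℝ} (hε : 0 < ε) :
    ∀ᶠ T in atTop, TailBound p h ε T := by
  obtain ⟨t₀, ht₀, hpos⟩ := hh.eventually_pos
  have h1 := (Metric.tendsto_nhds.1 hsub) ε hε
  have h2 : ∀ᶠ t : ℝ in atTop, p - 1 ≤ ε * t ^ p :=
    ((tendsto_rpow_atTop (by linarith : 0 < p)).const_mul_atTop hε).eventually_ge_atTop _
  have h3 : ∀ᶠ t : ℝ in atTop,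
      1 ≤ t ∧ 0 < h t ∧ |deriv h t| ≤ ε * (t ^ (p - 1) * h t) ∧ p - 1 ≤ ε * t ^ p := by
    filter_upwards [h1, h2, eventually_ge_atTop t₀, eventually_ge_atTop 1] with t h1 h2 h3 h4
    have ht := hpos t h3
    have hden : 0 < t ^ (p - 1) * h t := mul_pos (Real.rpow_pos_of_pos (by linarith) _) ht
    refine ⟨h4, ht, ?_, h2⟩
    rw [dist_zero_right, norm_div, Real.norm_eq_abs, Real.norm_eq_abs, abs_of_pos hden,
      div_lt_iff₀ hden] at h1
    exact h1.le
  obtain ⟨T, hT⟩ := eventually_atTop.1 h3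
  filter_upwards [eventually_ge_atTop T] with S hS t ht using hT t (hS.trans ht)

theorem TailBound.nonlin_pos {p : ℝ} {h : ℝ → ℝ} {ε T : ℝ} (hT : TailBound p h ε T) {t : ℝ}
    (ht : T ≤ t) : 0 < nonlin p h t :=
  mul_pos (hT t ht).2.1 (Real.exp_pos _)

theorem hasDerivAt_log_nonlin {p : ℝ} {h : ℝ → ℝ} (hh : IsGrowthFactor h) {t : ℝ} (ht : 0 < t)
    (hpos : 0 < h t) :
    HasDerivAt (fun t => Real.log (nonlin p h t)) (deriv h t / h t + p * t ^ (p - 1)) t := by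
  have h1 := (hh.hasDerivAt ht).mul
    (Real.hasDerivAt_rpow_const (p := p) (Or.inl ht.ne')).exp
  have h2 := h1.log (mul_pos hpos (Real.exp_pos _)).ne'
  refine h2.congr_deriv ?_
  simp only [Pi.mul_apply]
  have := (Real.exp_pos (t ^ p)).ne'
  field_simp

theorem TailBound.abs_div_le {p : ℝ} {h : ℝ → ℝ} {ε T : ℝ} (hT : TailBound p h ε T) {t : ℝ}
    (ht : T ≤ t) : |deriv h t / h t| ≤ ε * t ^ (p - 1) := by
  obtain ⟨h1, h2, h3, -⟩ := hT t ht
  rw [abs_div, abs_of_pos h2, div_le_iff₀ h2]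
  linarith

/-- `log f(t) - t^p` varies by at most `ε` times the variation of `t^p`. -/
theorem TailBound.abs_log_nonlin_sub_le {p : ℝ} (hp : 2 < p) {h : ℝ → ℝ} (hh : IsGrowthFactor h)
    {ε T : ℝ} (hT : TailBound p h ε T) (hε : 0 ≤ ε) {s t : ℝ} (hs : T ≤ s) (hst : s ≤ t) :
    |Real.log (nonlin p h t) - Real.log (nonlin p h s) - (t ^ p - s ^ p)| ≤
      ε * (t ^ p - s ^ p) := by
  have hpos : ∀ x ∈ Icc s t, 0 < x := fun x hx => by linarith [(hT x (hs.trans hx.1)).1]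
  have hd : ∀ x ∈ Icc s t, HasDerivAt (fun t => Real.log (nonlin p h t))
      (deriv h x / h x + p * x ^ (p - 1)) x := fun x hx =>
    hasDerivAt_log_nonlin hh (hpos x hx) (hT x (hs.trans hx.1)).2.1
  have hd2 : ∀ x ∈ Icc s t, HasDerivAt (fun t : ℝ => t ^ p) (p * x ^ (p - 1)) x := fun x hx =>
    Real.hasDerivAt_rpow_const (Or.inl (hpos x hx).ne')
  have hb : ∀ x ∈ Icc s t, |deriv h x / h x| ≤ ε * (p * x ^ (p - 1)) := by
    intro x hx
    refine (hT.abs_div_le (hs.trans hx.1)).trans (mul_le_mul_of_nonneg_left ?_ hε)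
    have : 0 < x ^ (p - 1) := Real.rpow_pos_of_pos (hpos x hx) _
    nlinarith
  have hu := le_of_hasDerivAt_nonneg
    (f := fun x => ε * x ^ p - (Real.log (nonlin p h x) - x ^ p)) hst
    (fun x hx => (((hd2 x hx).const_mul ε).sub
      ((hd x hx).sub (hd2 x hx))).continuousAt.continuousWithinAt)
    (fun x hx => (((hd2 x (Ioo_subset_Icc_self hx)).const_mul ε).sub
      ((hd x (Ioo_subset_Icc_self hx)).sub (hd2 x (Ioo_subset_Icc_self hx))))) (fun x hx => by
        have := (abs_le.1 (hb x (Ioo_subset_Icc_self hx))).2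
        linarith)
  have hl := le_of_hasDerivAt_nonneg
    (f := fun x => ε * x ^ p + (Real.log (nonlin p h x) - x ^ p)) hst
    (fun x hx => (((hd2 x hx).const_mul ε).add
      ((hd x hx).sub (hd2 x hx))).continuousAt.continuousWithinAt)
    (fun x hx => (((hd2 x (Ioo_subset_Icc_self hx)).const_mul ε).add
      ((hd x (Ioo_subset_Icc_self hx)).sub (hd2 x (Ioo_subset_Icc_self hx))))) (fun x hx => by
        have := (abs_le.1 (hb x (Ioo_subset_Icc_self hx))).1
        linarith)
  rw [abs_le]
  constructor <;> linarith

theorem TailBound.nonlin_le {p : ℝ} (hp : 2 < p) {h : ℝ → ℝ} (hh : IsGrowthFactor h)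
    {ε T : ℝ} (hT : TailBound p h ε T) (hε : 0 ≤ ε) (hε1 : ε ≤ 1) {s t : ℝ} (hs : T ≤ s)
    (hst : s ≤ t) : nonlin p h s ≤ nonlin p h t := by
  have h1 := (abs_le.1 (hT.abs_log_nonlin_sub_le hp hh hε hs hst)).1
  have h2 : s ^ p ≤ t ^ p := Real.rpow_le_rpow (by linarith [(hT s hs).1]) hst (by linarith)
  rw [← Real.log_le_log_iff (hT.nonlin_pos hs) (hT.nonlin_pos (hs.trans hst))]
  nlinarith

theorem tendsto_log_nonlin_div {p : ℝ} (hp : 2 < p) {h : ℝ → ℝ} (hh : IsGrowthFactor h)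
    (hsub : SubordinateGrowth p h) :
    Tendsto (fun t => Real.log (nonlin p h t) / t ^ p) atTop (𝓝 1) := by
  rw [Metric.tendsto_nhds]
  intro ε hε
  obtain ⟨T, hT⟩ := (eventually_tailBound hp hh hsub (half_pos (half_pos hε))).exists
  have hlim : Tendsto (fun t : ℝ => t ^ p) atTop atTop := tendsto_rpow_atTop (by linarith)
  have h1 : ∀ᶠ t : ℝ in atTop,
      |Real.log (nonlin p h T) - T ^ p| / (ε / 2) < t ^ p := hlim.eventually_gt_atTop _
  filter_upwards [h1, eventually_ge_atTop T] with t h1 h2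
  have hT0 : 0 ≤ T ^ p := Real.rpow_nonneg (by linarith [(hT T le_rfl).1]) _
  have ht0 : 0 < t ^ p := Real.rpow_pos_of_pos (by linarith [(hT t h2).1]) _
  have h3 := hT.abs_log_nonlin_sub_le hp hh (by positivity) le_rfl h2
  rw [div_lt_iff₀ (by positivity)] at h1
  rw [Real.dist_eq, div_sub_one ht0.ne', abs_div, abs_of_pos ht0, div_lt_iff₀ ht0]
  have h4 : Real.log (nonlin p h t) - t ^ p =
    (Real.log (nonlin p h t) - Real.log (nonlin p h T) - (t ^ p - T ^ p)) +
      (Real.log (nonlin p h T) - T ^ p) := by ring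
  rw [h4]
  refine (abs_add_le _ _).trans_lt ?_
  nlinarith

/-- For large `m` the maximum of `f` on `[0, m]` is attained at `m`. -/
theorem eventually_nonlin_le {p : ℝ} (hp : 2 < p) {h : ℝ → ℝ} (hh : IsGrowthFactor h)
    (hsub : SubordinateGrowth p h) :
    ∀ᶠ m in atTop, ∀ t, 0 ≤ t → t ≤ m → nonlin p h t ≤ nonlin p h m := by
  obtain ⟨T, hT⟩ := (eventually_tailBound hp hh hsub one_half_pos).exists
  have hT1 := (hT T le_rfl).1
  obtain ⟨C, hC⟩ := (isCompact_Icc.image_of_continuousOn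
    ((continuousOn_nonlin hp hh).mono (Icc_subset_Ici_self : Icc 0 T ⊆ Ici 0))).bddAbove
  have hlim : Tendsto (fun t => Real.log (nonlin p h t)) atTop atTop := by
    have h1 : Tendsto (fun t : ℝ => t ^ p) atTop atTop := tendsto_rpow_atTop (by linarith)
    have h2 := (tendsto_log_nonlin_div hp hh hsub).pos_mul_atTop one_pos h1
    refine h2.congr' ?_
    filter_upwards [eventually_gt_atTop 0] with t ht
    have : 0 < t ^ p := Real.rpow_pos_of_pos ht _
    field_simp
  filter_upwards [hlim.eventually_ge_atTop (Real.log (max C 1)), eventually_ge_atTop T]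
    with m hm1 hm2 t ht0 htm
  rcases le_or_gt T t with h1 | h1
  · exact hT.nonlin_le hp hh (by norm_num) (by norm_num) h1 htm
  · have h2 := hC (mem_image_of_mem _ ⟨ht0, h1.le⟩)
    have h3 : max C 1 ≤ nonlin p h m :=
      (Real.log_le_log_iff (by positivity) (hT.nonlin_pos hm2)).1 hm1
    exact h2.trans ((le_max_left _ _).trans h3)

/-! ### The planar system for the normalized flux and density -/

namespace IsRadialSolution

variable {p : ℝ} {h : ℝ → ℝ} {lam mu : ℝ} {u : ℝ → ℝ}

theorem scaledFlux_nonneg (hp : 2 < p) (hu : IsRadialSolution p h lam mu u)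
    (hh : IsGrowthFactor h) {r : ℝ} (hr : r ∈ Icc (0 : ℝ) 1) : 0 ≤ scaledFlux p u r :=
  mul_nonneg (mul_nonneg (by linarith) (Real.rpow_nonneg (hu.nonneg hr) _))
    (hu.flux_nonneg hh hr)

theorem density_nonneg (hp : 2 < p) (hu : IsRadialSolution p h lam mu u)
    (hh : IsGrowthFactor h) {r : ℝ} (hr : r ∈ Icc (0 : ℝ) 1) : 0 ≤ density p h lam u r := by
  have h1 := Real.rpow_nonneg (hu.nonneg hr) (p - 1)
  have h2 := nonlin_nonneg (p := p) hh (hu.nonneg hr)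
  have h3 := hu.lam_pos
  have h4 : 0 < p := by linarith
  unfold density
  positivity

theorem density_pos (hp : 2 < p) (hu : IsRadialSolution p h lam mu u) {r : ℝ}
    (hr : r ∈ Ioo (0 : ℝ) 1) (hf : 0 < nonlin p h (u r)) : 0 < density p h lam u r := by
  have h1 := Real.rpow_pos_of_pos (hu.pos r hr) (p - 1)
  have h3 := hu.lam_pos
  have h4 : 0 < p := by linarith
  have h5 := hr.1
  unfold density
  positivity

theorem continuousOn_scaledFlux (hp : 2 < p) (hu : IsRadialSolution p h lam mu u) :
    ContinuousOn (scaledFlux p u) (Icc 0 1) :=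
  (continuousOn_const.mul (hu.continuousOn_rpow hp)).mul hu.continuousOn_flux

theorem continuousOn_density (hp : 2 < p) (hu : IsRadialSolution p h lam mu u)
    (hh : IsGrowthFactor h) : ContinuousOn (density p h lam u) (Icc 0 1) :=
  ((continuousOn_const.mul (continuousOn_id.pow 2)).mul (hu.continuousOn_rpow hp)).mul
    (hu.continuousOn_comp_nonlin hp hh)

theorem continuousOn_hamiltonian (hp : 2 < p) (hu : IsRadialSolution p h lam mu u)
    (hh : IsGrowthFactor h) : ContinuousOn (hamiltonian p h lam u) (Icc 0 1) :=
  (((continuousOn_const.sub (hu.continuousOn_scaledFlux hp)).pow 2).div_const 2).add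
    (hu.continuousOn_density hp hh)

theorem hasDerivAt_rpow (hu : IsRadialSolution p h lam mu u) {r : ℝ}
    (hr : r ∈ Ioo (0 : ℝ) 1) :
    HasDerivAt (fun r => u r ^ (p - 1))
      (-(p - 1) * (flux u r / u r) * u r ^ (p - 1) / r) r := by
  refine ((hu.hasDerivAt' hr).rpow_const (Or.inl (hu.pos r hr).ne')).congr_deriv ?_
  have := (hu.pos r hr).ne'
  rw [Real.rpow_sub_one this (p - 1)]
  field_simp

theorem hasDerivAt_log (hu : IsRadialSolution p h lam mu u) {r : ℝ}
    (hr : r ∈ Ioo (0 : ℝ) 1) :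
    HasDerivAt (fun r => Real.log (u r)) (-(flux u r / u r) / r) r := by
  refine ((hu.hasDerivAt' hr).log (hu.pos r hr).ne').congr_deriv ?_
  have := (hu.pos r hr).ne'
  field_simp

theorem hasDerivAt_scaledFlux (hu : IsRadialSolution p h lam mu u) {r : ℝ}
    (hr : r ∈ Ioo (0 : ℝ) 1) :
    HasDerivAt (scaledFlux p u)
      ((density p h lam u r - (p - 1) * scaledFlux p u r * (flux u r / u r)) / r) r := by
  refine ((hu.hasDerivAt_rpow hr).const_mul p |>.mul (hu.hasDerivAt_flux hr)).congr_deriv ?_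
  have := hr.1.ne'
  have := (hu.pos r hr).ne'
  unfold density scaledFlux
  field_simp
  ring

/-- The equation `r X' = (2 - q) X` of the limiting system, up to the relative deviation caused by
the factors `u^{p-1}` and `h(u)`. -/
theorem hasDerivAt_log_density (hp : 2 < p) (hu : IsRadialSolution p h lam mu u)
    (hh : IsGrowthFactor h) {r : ℝ} (hr : r ∈ Ioo (0 : ℝ) 1) (hpos : 0 < h (u r)) :
    HasDerivAt (fun r => Real.log (density p h lam u r))
      ((2 - scaledFlux p u r -
        flux u r * ((p - 1) / u r + deriv h (u r) / h (u r))) / r) r := by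
  have hl := hu.lam_pos
  have hd := (((Real.hasDerivAt_log hr.1.ne').const_mul 2).const_add (Real.log (p * lam))).add
    (((hu.hasDerivAt_log hr).const_mul (p - 1)).add
      ((hasDerivAt_log_nonlin (p := p) hh (hu.pos r hr) hpos).comp r (hu.hasDerivAt' hr)))
  have hev : ∀ᶠ t in 𝓝 r, 0 < h (u t) :=
    ((hh.hasDerivAt (hu.pos r hr)).continuousAt.comp
      (hu.hasDerivAt' hr).continuousAt).eventually (lt_mem_nhds hpos)
  refine (hd.congr_of_eventuallyEq ?_).congr_deriv ?_
  · filter_upwards [hev, Ioo_mem_nhds hr.1 hr.2] with t ht ht1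
    have h1 := hu.pos t ht1
    have h2 := ht1.1
    have h3 : 0 < nonlin p h (u t) := mul_pos ht (Real.exp_pos _)
    have h4 : 0 < u t ^ (p - 1) := Real.rpow_pos_of_pos h1 _
    have h5 : p * lam ≠ 0 := by
      have : 0 < p := by linarith
      positivity
    simp only [density, Pi.add_apply, Function.comp]
    rw [Real.log_mul (by positivity) h3.ne', Real.log_mul (by positivity) h4.ne',
      Real.log_mul h5 (by positivity), Real.log_pow, Real.log_rpow h1]
    push_cast
    ring
  · have := hr.1.ne'
    have := (hu.pos r hr).ne'
    unfold scaledFlux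
    field_simp
    ring

theorem hasDerivAt_density (hp : 2 < p) (hu : IsRadialSolution p h lam mu u)
    (hh : IsGrowthFactor h) {r : ℝ} (hr : r ∈ Ioo (0 : ℝ) 1) (hpos : 0 < h (u r)) :
    HasDerivAt (density p h lam u)
      (density p h lam u r * (2 - scaledFlux p u r -
        flux u r * ((p - 1) / u r + deriv h (u r) / h (u r))) / r) r := by
  have hev : ∀ᶠ t in 𝓝 r, 0 < h (u t) :=
    ((hh.hasDerivAt (hu.pos r hr)).continuousAt.comp
      (hu.hasDerivAt' hr).continuousAt).eventually (lt_mem_nhds hpos)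
  have hX : 0 < density p h lam u r := hu.density_pos hp hr (mul_pos hpos (Real.exp_pos _))
  have h1 := (hu.hasDerivAt_log_density hp hh hr hpos).exp
  refine (h1.congr_of_eventuallyEq ?_).congr_deriv ?_
  · filter_upwards [hev, Ioo_mem_nhds hr.1 hr.2] with t ht ht1
    rw [Real.exp_log (hu.density_pos hp ht1 (mul_pos ht (Real.exp_pos _)))]
  · rw [Real.exp_log hX]
    ring

theorem hasDerivAt_hamiltonian (hp : 2 < p) (hu : IsRadialSolution p h lam mu u)
    (hh : IsGrowthFactor h) {r : ℝ} (hr : r ∈ Ioo (0 : ℝ) 1) (hpos : 0 < h (u r)) :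
    HasDerivAt (hamiltonian p h lam u)
      (((2 - scaledFlux p u r) * (p - 1) * scaledFlux p u r * (flux u r / u r) -
        density p h lam u r * (flux u r * ((p - 1) / u r + deriv h (u r) / h (u r)))) / r) r := by
  have h1 := ((((hu.hasDerivAt_scaledFlux hr).const_sub 2).pow 2).div_const 2).add
    (hu.hasDerivAt_density hp hh hr hpos)
  refine (h1.congr_of_eventuallyEq (Eventually.of_forall fun t => rfl)).congr_deriv ?_
  have := hr.1.ne'
  field_simp
  push_cast
  ring

/-- `(p-1) w / u ≤ ε q`, where `w` is the flux. -/
theorem flux_div_le (hp : 2 < p) (hu : IsRadialSolution p h lam mu u) (hh : IsGrowthFactor h)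
    {ε T : ℝ} (hT : TailBound p h ε T) {r : ℝ} (hr : r ∈ Icc (0 : ℝ) 1) (hur : T ≤ u r) :
    (p - 1) * (flux u r / u r) ≤ ε / 2 * scaledFlux p u r := by
  obtain ⟨h1, -, -, h4⟩ := hT _ hur
  have hw := hu.flux_nonneg hh hr
  have h0 : 0 < u r := by linarith
  have h5 : u r ^ p = u r ^ (p - 1) * u r := by
    rw [Real.rpow_sub_one h0.ne']; field_simp
  have h6 : (p - 1) / u r ≤ ε * u r ^ (p - 1) := by
    rw [div_le_iff₀ h0, mul_assoc, ← h5]; exact h4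
  have h7 : 0 ≤ ε * u r ^ (p - 1) := le_trans (div_nonneg (by linarith) h0.le) h6
  calc (p - 1) * (flux u r / u r) = (p - 1) / u r * flux u r := by ring
    _ ≤ ε * u r ^ (p - 1) * flux u r := mul_le_mul_of_nonneg_right h6 hw
    _ ≤ p / 2 * (ε * u r ^ (p - 1) * flux u r) := by
        have := mul_nonneg h7 hw
        nlinarith
    _ = ε / 2 * scaledFlux p u r := by unfold scaledFlux; ring

theorem abs_deviation_le (hp : 2 < p) (hu : IsRadialSolution p h lam mu u) (hh : IsGrowthFactor h)
    {ε T : ℝ} (hT : TailBound p h ε T) {r : ℝ} (hr : r ∈ Icc (0 : ℝ) 1) (hur : T ≤ u r) :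
    |flux u r * ((p - 1) / u r + deriv h (u r) / h (u r))| ≤ ε * scaledFlux p u r := by
  have hw := hu.flux_nonneg hh hr
  have h0 : 0 < u r := by linarith [(hT _ hur).1]
  have h1 := hu.flux_div_le hp hh hT hr hur
  have h2 := hT.abs_div_le hur
  have h3 : 0 ≤ ε * u r ^ (p - 1) := (abs_nonneg _).trans h2
  have h4 : flux u r * |deriv h (u r) / h (u r)| ≤ ε / 2 * scaledFlux p u r :=
    calc flux u r * |deriv h (u r) / h (u r)| ≤ flux u r * (ε * u r ^ (p - 1)) :=
          mul_le_mul_of_nonneg_left h2 hw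
      _ ≤ p / 2 * (flux u r * (ε * u r ^ (p - 1))) := by
          have := mul_nonneg hw h3
          nlinarith
      _ = ε / 2 * scaledFlux p u r := by unfold scaledFlux; ring
  have h5 : 0 ≤ (p - 1) * (flux u r / u r) := mul_nonneg (by linarith) (div_nonneg hw h0.le)
  calc |flux u r * ((p - 1) / u r + deriv h (u r) / h (u r))|
      = |(p - 1) * (flux u r / u r) + flux u r * (deriv h (u r) / h (u r))| := by
        congr 1; ring
    _ ≤ |(p - 1) * (flux u r / u r)| + |flux u r * (deriv h (u r) / h (u r))| := abs_add_le _ _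
    _ = (p - 1) * (flux u r / u r) + flux u r * |deriv h (u r) / h (u r)| := by
        rw [abs_of_nonneg h5, abs_mul, abs_of_nonneg hw]
    _ ≤ ε * scaledFlux p u r := by linarith

/-! ### Adiabatic invariance of the Hamiltonian -/

/-- The variation of the Hamiltonian is controlled by the relative variation of `u`, however long
the interval of radii is. -/
theorem abs_hamiltonian_sub_le (hp : 2 < p) (hu : IsRadialSolution p h lam mu u)
    (hh : IsGrowthFactor h) {ε T M r₁ r₂ : ℝ} (hT : TailBound p h ε T) (hε : 0 ≤ ε) (hε1 : ε ≤ 1)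
    (h1 : 0 ≤ r₁) (h12 : r₁ ≤ r₂) (h2 : r₂ ≤ 1) (hur : T ≤ u r₂)
    (hM : ∀ r ∈ Icc r₁ r₂, scaledFlux p u r ≤ M) :
    |hamiltonian p h lam u r₂ - hamiltonian p h lam u r₁| ≤
      2 * (p - 1) * (M + M ^ 2) * (Real.log (u r₁) - Real.log (u r₂)) + ε * M ^ 2 := by
  have hM0 : 0 ≤ M := (hu.scaledFlux_nonneg hp hh ⟨h1, h12.trans h2⟩).trans
    (hM r₁ (left_mem_Icc.2 h12))
  have hsub : Icc r₁ r₂ ⊆ Icc (0 : ℝ) 1 := Icc_subset_Icc h1 h2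
  have hsub' : ∀ x ∈ Ioo r₁ r₂, x ∈ Ioo (0 : ℝ) 1 := fun x hx =>
    ⟨h1.trans_lt hx.1, hx.2.trans_le h2⟩
  have huT : ∀ x ∈ Icc r₁ r₂, T ≤ u x := fun x hx =>
    hur.trans (hu.le_of_le hh (h1.trans hx.1) hx.2 h2)
  have hupos : ∀ x ∈ Icc r₁ r₂, 0 < u x := fun x hx => by linarith [(hT _ (huT x hx)).1]
  set A : ℝ := 2 * (p - 1) * (M + M ^ 2) with hA
  set q := scaledFlux p u with hq
  set X := density p h lam u with hX
  let Y' : ℝ → ℝ := fun r => (A * (flux u r / u r) +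
    ε * M * (X r - (p - 1) * q r * (flux u r / u r))) / r
  have hY : ∀ x ∈ Ioo r₁ r₂, HasDerivAt (fun r => ε * M * q r - A * Real.log (u r)) (Y' x) x := by
    intro x hx
    refine (((hu.hasDerivAt_scaledFlux (hsub' x hx)).const_mul (ε * M)).sub
      ((hu.hasDerivAt_log (hsub' x hx)).const_mul A)).congr_deriv ?_
    simp only [Y']
    ring
  have hcY : ContinuousOn (fun r => ε * M * q r - A * Real.log (u r)) (Icc r₁ r₂) :=
    (continuousOn_const.mul ((hu.continuousOn_scaledFlux hp).mono hsub)).sub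
      (continuousOn_const.mul ((hu.continuousOn.mono hsub).log fun x hx => (hupos x hx).ne'))
  have hcH := (hu.continuousOn_hamiltonian hp hh).mono hsub
  have hH : ∀ x ∈ Ioo r₁ r₂, HasDerivAt (hamiltonian p h lam u) _ x := fun x hx =>
    hu.hasDerivAt_hamiltonian hp hh (hsub' x hx)
      (hT _ (huT x (Ioo_subset_Icc_self hx))).2.1
  have hbound : ∀ x ∈ Ioo r₁ r₂, |((2 - q x) * (p - 1) * q x * (flux u x / u x) -
      X x * (flux u x * ((p - 1) / u x + deriv h (u x) / h (u x)))) / x| ≤ Y' x := by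
    intro x hx
    have hxI := Ioo_subset_Icc_self hx
    have hx0 := (hsub' x hx).1
    have hq0 : 0 ≤ q x := hu.scaledFlux_nonneg hp hh (hsub hxI)
    have hX0 : 0 ≤ X x := hu.density_nonneg hp hh (hsub hxI)
    have hqM := hM x hxI
    have hdev := hu.abs_deviation_le hp hh hT (hsub hxI) (huT x hxI)
    have hk0 : 0 ≤ flux u x / u x :=
      div_nonneg (hu.flux_nonneg hh (hsub hxI)) (hupos x hxI).le
    rw [abs_div, abs_of_pos hx0]
    refine div_le_div_of_nonneg_right ?_ hx0.le
    have e1 : |(2 - q x) * (p - 1) * q x * (flux u x / u x)| ≤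
        (2 + M) * (p - 1) * M * (flux u x / u x) := by
      rw [abs_mul, abs_mul, abs_mul, abs_of_nonneg hk0, abs_of_nonneg hq0,
        abs_of_nonneg (by linarith : 0 ≤ p - 1)]
      have : |2 - q x| ≤ 2 + M := abs_le.2 ⟨by linarith, by linarith⟩
      have hp1 : 0 ≤ p - 1 := by linarith
      gcongr
    have e2 : |X x * (flux u x * ((p - 1) / u x + deriv h (u x) / h (u x)))| ≤
        ε * M * X x := by
      rw [abs_mul, abs_of_nonneg hX0]
      have : ε * q x ≤ ε * M := mul_le_mul_of_nonneg_left hqM hε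
      nlinarith [mul_le_mul_of_nonneg_left (hdev.trans this) hX0]
    have e3 : ε * M * ((p - 1) * q x * (flux u x / u x)) ≤
        (p - 1) * M ^ 2 * (flux u x / u x) := by
      have h5 : q x * (flux u x / u x) ≤ M * (flux u x / u x) :=
        mul_le_mul_of_nonneg_right hqM hk0
      have h6 : 0 ≤ M * (flux u x / u x) := mul_nonneg hM0 hk0
      have h7 : ε * (q x * (flux u x / u x)) ≤ 1 * (M * (flux u x / u x)) :=
        mul_le_mul hε1 h5 (mul_nonneg hq0 hk0) zero_le_one
      have h8 : 0 ≤ M * (p - 1) := mul_nonneg hM0 (by linarith)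
      nlinarith [mul_le_mul_of_nonneg_left h7 h8]
    refine (abs_sub _ _).trans ?_
    rw [hA]
    nlinarith
  have hup := le_of_hasDerivAt_nonneg h12 (hcY.sub hcH) (fun x hx => (hY x hx).sub (hH x hx))
    fun x hx => sub_nonneg.2 ((le_abs_self _).trans (hbound x hx))
  have hlo := le_of_hasDerivAt_nonneg h12 (hcY.add hcH) (fun x hx => (hY x hx).add (hH x hx))
    fun x hx => by
      have := neg_le_of_abs_le (hbound x hx)
      linarith
  simp only [Pi.sub_apply, Pi.add_apply] at hup hlo
  have hq1 : 0 ≤ ε * M * q r₁ := mul_nonneg (mul_nonneg hε hM0)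
    (hu.scaledFlux_nonneg hp hh ⟨h1, h12.trans h2⟩)
  have hq2 : ε * M * q r₂ ≤ ε * M ^ 2 := by
    have := mul_le_mul_of_nonneg_left (hM r₂ (right_mem_Icc.2 h12)) (mul_nonneg hε hM0)
    nlinarith
  rw [abs_le]
  constructor <;> nlinarith

end IsRadialSolution

/-- Uniform form of the adiabatic invariance: as long as `u` is large and has lost only a small
fraction of its value, the Hamiltonian is almost constant. The bound `q ≤ 6` is part of the
conclusion; it comes from `(2 - q)² / 2 ≤ H` at the point where `q` is largest. -/
theorem exists_adiabatic {p : ℝ} (hp : 2 < p) {h : ℝ → ℝ} (hh : IsGrowthFactor h)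
    (hsub : SubordinateGrowth p h) {η : ℝ} (hη : 0 < η) :
    ∃ κ ∈ Ioo (0 : ℝ) 1, ∃ T : ℝ, 1 ≤ T ∧ ∀ {lam mu : ℝ} {u : ℝ → ℝ},
      IsRadialSolution p h lam mu u → ∀ {r₁ r₂ : ℝ}, 0 ≤ r₁ → r₂ ≤ 1 → T ≤ u r₂ →
        κ * u r₁ ≤ u r₂ → hamiltonian p h lam u r₁ ≤ 3 → ∀ r ∈ Icc r₁ r₂,
          scaledFlux p u r ≤ 6 ∧ |hamiltonian p h lam u r - hamiltonian p h lam u r₁| ≤ η := by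
  set ε : ℝ := min (1 / 20) (η / 72) with hεdef
  have hε : 0 < ε := lt_min (by norm_num) (by positivity)
  have hε1 : ε ≤ 1 / 20 := min_le_left _ _
  have hε2 : ε ≤ η / 72 := min_le_right _ _
  set L : ℝ := min (1 / (40 * (p - 1))) (η / (168 * (p - 1))) with hLdef
  have hp1 : 0 < p - 1 := by linarith
  have hL : 0 < L := lt_min (by positivity) (by positivity)
  have hL1 : 2 * (p - 1) * L ≤ 1 / 20 := by
    have := min_le_left (1 / (40 * (p - 1))) (η / (168 * (p - 1)))
    rw [← hLdef, le_div_iff₀ (by positivity)] at this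
    linarith
  have hL2 : 84 * (p - 1) * L ≤ η / 2 := by
    have := min_le_right (1 / (40 * (p - 1))) (η / (168 * (p - 1)))
    rw [← hLdef, le_div_iff₀ (by positivity)] at this
    linarith
  obtain ⟨T, hT, hT1⟩ := ((eventually_tailBound hp hh hsub hε).and (eventually_ge_atTop 1)).exists
  refine ⟨Real.exp (-L), ⟨Real.exp_pos _, by simpa using Real.exp_lt_exp.2 (neg_lt_zero.2 hL)⟩, T, hT1, ?_⟩
  intro lam mu u hu r₁ r₂ h1 h2 hur hκ hH r hr
  have h12 : r₁ ≤ r₂ := hr.1.trans hr.2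
  have hlog : ∀ x ∈ Icc r₁ r₂, Real.log (u r₁) - Real.log (u x) ≤ L := by
    intro x hx
    have hx2 := hu.le_of_le hh (h1.trans hx.1) hx.2 h2
    have hx1 := hu.le_of_le hh h1 hx.1 (hx.2.trans h2)
    have hx0 : 0 < u x := by linarith
    have h3 := Real.log_le_log (mul_pos (Real.exp_pos _) (by linarith)) (hκ.trans hx2)
    rw [Real.log_mul (Real.exp_pos _).ne' (by linarith), Real.log_exp] at h3
    linarith
  have hlog0 : ∀ x ∈ Icc r₁ r₂, 0 ≤ Real.log (u r₁) - Real.log (u x) := by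
    intro x hx
    have hx2 := hu.le_of_le hh (h1.trans hx.1) hx.2 h2
    have hx1 := hu.le_of_le hh h1 hx.1 (hx.2.trans h2)
    have hx0 : 0 < u x := by linarith
    have := Real.log_le_log hx0 hx1
    linarith
  obtain ⟨s, hs, hmax⟩ := isCompact_Icc.exists_isMaxOn (nonempty_Icc.2 h12)
    ((hu.continuousOn_scaledFlux hp).mono (Icc_subset_Icc h1 h2))
  have hq6 : scaledFlux p u s ≤ 6 := by
    have h3 := hu.abs_hamiltonian_sub_le hp hh hT hε.le (by linarith) h1 hs.1 (hs.2.trans h2)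
      (hur.trans (hu.le_of_le hh (h1.trans hs.1) hs.2 h2))
      (fun x hx => hmax ⟨hx.1, hx.2.trans hs.2⟩)
    have h4 := (le_abs_self _).trans h3
    have hX := hu.density_nonneg hp hh ⟨h1.trans hs.1, hs.2.trans h2⟩
    set q := scaledFlux p u s
    have hq0 : 0 ≤ q := hu.scaledFlux_nonneg hp hh ⟨h1.trans hs.1, hs.2.trans h2⟩
    have h5 : (2 - q) ^ 2 / 2 ≤ hamiltonian p h lam u s := by
      unfold hamiltonian
      linarith
    have h6 : 2 * (p - 1) * (Real.log (u r₁) - Real.log (u s)) ≤ 1 / 20 :=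
      (mul_le_mul_of_nonneg_left (hlog s hs) (by linarith)).trans hL1
    have h7 : 2 * (p - 1) * (q + q ^ 2) * (Real.log (u r₁) - Real.log (u s)) ≤
        (q + q ^ 2) * (1 / 20) := by
      have := mul_le_mul_of_nonneg_left h6 (by positivity : 0 ≤ q + q ^ 2)
      linarith
    have h8 : ε * q ^ 2 ≤ 1 / 20 * q ^ 2 := mul_le_mul_of_nonneg_right hε1 (sq_nonneg _)
    by_contra hcon
    nlinarith
  have hq : ∀ x ∈ Icc r₁ r₂, scaledFlux p u x ≤ 6 := fun x hx => (hmax hx).trans hq6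
  refine ⟨hq r hr, ?_⟩
  have h3 := hu.abs_hamiltonian_sub_le hp hh hT hε.le (by linarith) h1 hr.1 (hr.2.trans h2)
      (hur.trans (hu.le_of_le hh (h1.trans hr.1) hr.2 h2))
      (fun x hx => hq x ⟨hx.1, hx.2.trans hr.2⟩)
  refine h3.trans ?_
  have h4 := mul_le_mul_of_nonneg_left (hlog r hr) (by linarith : 0 ≤ 84 * (p - 1))
  linarith

/-- The state between two bubbles, recorded along radii `s n`: the value is `d μ`, the normalized
flux tends to `Q`, and the density is small but not exponentially small in `μ^p`. -/
structure IsNeckState (p : ℝ) (h : ℝ → ℝ) (lam mu : ℕ → ℝ) (u : ℕ → ℝ → ℝ) (d Q : ℝ)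
    (s : ℕ → ℝ) : Prop where
  mem : ∀ n, s n ∈ Ioo (0 : ℝ) 1
  value_tendsto : Tendsto (fun n => u n (s n) / mu n) atTop (𝓝 d)
  flux_tendsto : Tendsto (fun n => scaledFlux p (u n) (s n)) atTop (𝓝 Q)
  density_tendsto : Tendsto (fun n => density p h (lam n) (u n) (s n)) atTop (𝓝 0)
  log_density_tendsto : Tendsto (fun n => Real.log (density p h (lam n) (u n) (s n)) / mu n ^ p)
    atTop (𝓝 0)

/-- Sequences of radial solutions that blow up at the origin. -/
structure IsBlowup (p : ℝ) (h : ℝ → ℝ) (lam mu : ℕ → ℝ) (u : ℕ → ℝ → ℝ) : Prop where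
  exponent : 2 < p
  growth : IsGrowthFactor h
  sub : SubordinateGrowth p h
  sol : ∀ n, IsRadialSolution p h (lam n) (mu n) (u n)
  mu_tendsto : Tendsto mu atTop atTop

namespace IsBlowup

variable {p : ℝ} {h : ℝ → ℝ} {lam mu : ℕ → ℝ} {u : ℕ → ℝ → ℝ}

theorem mu_pos (hb : IsBlowup p h lam mu u) (n : ℕ) : 0 < mu n := (hb.sol n).mu_pos hb.growth

theorem rpow_tendsto (hb : IsBlowup p h lam mu u) {q : ℝ} (hq : 0 < q) :
    Tendsto (fun n => mu n ^ q) atTop atTop := (tendsto_rpow_atTop hq).comp hb.mu_tendsto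

theorem value_atTop (hb : IsBlowup p h lam mu u) {v : ℕ → ℝ} {d : ℝ} (hd : 0 < d)
    (hv : Tendsto (fun n => v n / mu n) atTop (𝓝 d)) : Tendsto v atTop atTop := by
  refine (hv.pos_mul_atTop hd hb.mu_tendsto).congr fun n => ?_
  have := hb.mu_pos n
  field_simp

theorem tendsto_rpow_div (hb : IsBlowup p h lam mu u) {v : ℕ → ℝ} {d q : ℝ} (hd : 0 < d)
    (hv : Tendsto (fun n => v n / mu n) atTop (𝓝 d)) :
    Tendsto (fun n => v n ^ q / mu n ^ q) atTop (𝓝 (d ^ q)) := by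
  refine (hv.rpow_const (p := q) (Or.inl hd.ne')).congr' ?_
  filter_upwards [(hb.value_atTop hd hv).eventually_ge_atTop 0] with n hn
  rw [Real.div_rpow hn (hb.mu_pos n).le]

theorem tendsto_log_nonlin_div (hb : IsBlowup p h lam mu u) {v : ℕ → ℝ} {d : ℝ} (hd : 0 < d)
    (hv : Tendsto (fun n => v n / mu n) atTop (𝓝 d)) :
    Tendsto (fun n => Real.log (nonlin p h (v n)) / mu n ^ p) atTop (𝓝 (d ^ p)) := by
  have h1 := (_root_.tendsto_log_nonlin_div hb.exponent hb.growth hb.sub).comp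
    (hb.value_atTop hd hv)
  have h2 := h1.mul (hb.tendsto_rpow_div (q := p) hd hv)
  rw [one_mul] at h2
  refine h2.congr' ?_
  filter_upwards [(hb.value_atTop hd hv).eventually_gt_atTop 0] with n hn
  have : v n ^ p ≠ 0 := (Real.rpow_pos_of_pos hn _).ne'
  simp only [Function.comp]
  field_simp

/-- The flux at a point, rescaled by `p μ^{p-1}`, in terms of the normalized flux there. -/
theorem tendsto_mul_flux (hb : IsBlowup p h lam mu u) {s : ℕ → ℝ} {d Q : ℝ} (hd : 0 < d)
    (hv : Tendsto (fun n => u n (s n) / mu n) atTop (𝓝 d))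
    (hq : Tendsto (fun n => scaledFlux p (u n) (s n)) atTop (𝓝 Q)) :
    Tendsto (fun n => p * mu n ^ (p - 1) * flux (u n) (s n)) atTop (𝓝 (Q / d ^ (p - 1))) := by
  refine (hq.div (hb.tendsto_rpow_div (q := p - 1) hd hv)
    (Real.rpow_pos_of_pos hd _).ne').congr' ?_
  filter_upwards [(hb.value_atTop hd hv).eventually_gt_atTop 0] with n hn
  have h1 : u n (s n) ^ (p - 1) ≠ 0 := (Real.rpow_pos_of_pos hn _).ne'
  have h2 : mu n ^ (p - 1) ≠ 0 := (Real.rpow_pos_of_pos (hb.mu_pos n) _).ne'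
  simp only [Pi.div_apply, scaledFlux]
  field_simp

theorem tendsto_scaledFlux (hb : IsBlowup p h lam mu u) {s : ℕ → ℝ} {d E : ℝ} (hd : 0 < d)
    (hv : Tendsto (fun n => u n (s n) / mu n) atTop (𝓝 d))
    (hE : Tendsto (fun n => p * mu n ^ (p - 1) * flux (u n) (s n)) atTop (𝓝 E)) :
    Tendsto (fun n => scaledFlux p (u n) (s n)) atTop (𝓝 (d ^ (p - 1) * E)) := by
  refine ((hb.tendsto_rpow_div (q := p - 1) hd hv).mul hE).congr fun n => ?_
  have h2 : mu n ^ (p - 1) ≠ 0 := (Real.rpow_pos_of_pos (hb.mu_pos n) _).ne'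
  simp only [scaledFlux]
  field_simp

/-- Adiabatic invariance along sequences. -/
theorem tendsto_hamiltonian (hb : IsBlowup p h lam mu u) {s t : ℕ → ℝ} {d H : ℝ} (hd : 0 < d)
    (hs : ∀ n, 0 ≤ s n) (hst : ∀ᶠ n in atTop, s n ≤ t n) (ht : ∀ᶠ n in atTop, t n ≤ 1)
    (hvs : Tendsto (fun n => u n (s n) / mu n) atTop (𝓝 d))
    (hvt : Tendsto (fun n => u n (t n) / mu n) atTop (𝓝 d))
    (hH : Tendsto (fun n => hamiltonian p h (lam n) (u n) (s n)) atTop (𝓝 H)) (hH2 : H ≤ 2) :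
    Tendsto (fun n => hamiltonian p h (lam n) (u n) (t n)) atTop (𝓝 H) := by
  have hdiff : Tendsto (fun n => hamiltonian p h (lam n) (u n) (t n) -
      hamiltonian p h (lam n) (u n) (s n)) atTop (𝓝 0) := by
    rw [Metric.tendsto_nhds]
    intro η hη
    obtain ⟨κ, hκ, T, -, hA⟩ := exists_adiabatic hb.exponent hb.growth hb.sub (half_pos hη)
    have h1 : ∀ᶠ n in atTop, κ < u n (t n) / mu n / (u n (s n) / mu n) := by
      have := hvt.div hvs hd.ne'
      rw [div_self hd.ne'] at this
      exact this.eventually (lt_mem_nhds hκ.2)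
    filter_upwards [h1, hst, ht, (hb.value_atTop hd hvt).eventually_ge_atTop T,
      (hb.value_atTop hd hvs).eventually_gt_atTop 0,
      hH.eventually (gt_mem_nhds (by linarith : H < 3))] with n h1 h2 h3 h4 h5 h6
    rw [div_div_div_cancel_right₀ (hb.mu_pos n).ne', lt_div_iff₀ h5] at h1
    have := (hA (hb.sol n) (hs n) h3 h4 h1.le h6.le (t n) ⟨h2, le_rfl⟩).2
    rw [dist_zero_right, Real.norm_eq_abs]
    linarith
  simpa using hdiff.add hH

end IsBlowup

/-- If `f` is largest at `μ`, then the flux and the drop of `u` are at most quadratic. -/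
theorem IsRadialSolution.flux_le_sq {p : ℝ} {h : ℝ → ℝ} {lam mu : ℝ} {u : ℝ → ℝ}
    (hu : IsRadialSolution p h lam mu u) (hh : IsGrowthFactor h)
    (hmax : ∀ t, 0 ≤ t → t ≤ mu → nonlin p h t ≤ nonlin p h mu) {r : ℝ} (hr : r ∈ Icc (0 : ℝ) 1) :
    flux u r ≤ lam * nonlin p h mu * r ^ 2 / 2 ∧ mu - u r ≤ lam * nonlin p h mu * r ^ 2 / 4 := by
  have hflux : ∀ y ∈ Icc (0 : ℝ) 1, flux u y ≤ lam * nonlin p h mu * y ^ 2 / 2 := by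
    intro y hy
    have := le_of_hasDerivAt_nonneg
      (f := fun x => lam * nonlin p h mu * x ^ 2 / 2 - flux u x) hy.1
      (ContinuousOn.sub (by fun_prop) (hu.continuousOn_flux.mono (Icc_subset_Icc_right hy.2)))
      (fun x hx => (((hasDerivAt_pow 2 x).const_mul (lam * nonlin p h mu)).div_const
        2).sub (hu.hasDerivAt_flux ⟨hx.1, hx.2.trans_le hy.2⟩))
      (fun x hx => by
        have hx' : x ∈ Icc (0 : ℝ) 1 := ⟨hx.1.le, hx.2.le.trans hy.2⟩
        have h5 := mul_le_mul_of_nonneg_right (mul_le_mul_of_nonneg_left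
          (hmax _ (hu.nonneg hx') (hu.le_mu hh hx')) hu.lam_pos.le) hx.1.le
        norm_num
        linarith)
    simp only [flux_zero] at this
    norm_num at this
    linarith
  refine ⟨hflux r hr, ?_⟩
  have := le_of_hasDerivAt_nonneg
    (f := fun x => lam * nonlin p h mu * x ^ 2 / 4 + u x) hr.1
    (ContinuousOn.add (by fun_prop) (hu.continuousOn.mono (Icc_subset_Icc_right hr.2)))
    (fun x hx => (((hasDerivAt_pow 2 x).const_mul (lam * nonlin p h mu)).div_const
      4).add (hu.hasDerivAt' ⟨hx.1, hx.2.trans_le hr.2⟩))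
    (fun x hx => by
      have h5 := hflux x ⟨hx.1.le, hx.2.le.trans hr.2⟩
      have h6 : flux u x / x ≤ lam * nonlin p h mu * x / 2 := by
        rw [div_le_iff₀ hx.1]
        linarith
      norm_num
      linarith)
  simp only [hu.value_zero] at this
  norm_num at this
  linarith

/-- The region carrying the first bubble ends in a neck state. -/
theorem IsFirstBubble.isNeckState {p : ℝ} {h : ℝ → ℝ} {lam mu : ℕ → ℝ} {u : ℕ → ℝ → ℝ}
    {γ₀ ρ₀ : ℕ → ℝ} (hf : IsFirstBubble p h lam mu u γ₀ ρ₀) (hb : IsBlowup p h lam mu u) :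
    IsNeckState p h lam mu u 1 4 ρ₀ := by
  have hp := hb.exponent
  have hv := hf.value_tendsto
  have hE : Tendsto (fun n => p * mu n ^ (p - 1) * flux (u n) (ρ₀ n)) atTop (𝓝 4) := by
    refine hf.energy_tendsto.congr fun n => ?_
    rw [(hb.sol n).energy_eq hp hb.growth le_rfl (hf.rho_mem n).1.le (hf.rho_mem n).2.le,
      IsRadialSolution.flux_zero, sub_zero]
  have hq : Tendsto (fun n => scaledFlux p (u n) (ρ₀ n)) atTop (𝓝 4) := by
    have := hb.tendsto_scaledFlux one_pos hv hE
    rwa [Real.one_rpow, one_mul] at this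
  have hH0 : ∀ n, hamiltonian p h (lam n) (u n) 0 = 2 := fun n => by
    simp [hamiltonian, scaledFlux, density, IsRadialSolution.flux_zero]
    norm_num
  have hH := hb.tendsto_hamiltonian (s := fun _ => 0) (t := ρ₀) one_pos (fun _ => le_rfl)
    (Eventually.of_forall fun n => (hf.rho_mem n).1.le)
    (Eventually.of_forall fun n => (hf.rho_mem n).2.le)
    (tendsto_const_nhds.congr fun n => by
      rw [(hb.sol n).value_zero, div_self (hb.mu_pos n).ne']) hv
    (tendsto_const_nhds.congr fun n => (hH0 n).symm) le_rfl
  have hX : Tendsto (fun n => density p h (lam n) (u n) (ρ₀ n)) atTop (𝓝 0) := by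
    have := hH.sub (((hq.const_sub 2).pow 2).div_const 2)
    norm_num at this
    refine this.congr fun n => ?_
    unfold hamiltonian
    ring
  refine ⟨hf.rho_mem, hv, hq, hX, ?_⟩
  -- lower bound: `w ≤ λ f(μ) r² / 2` gives `X ≥ 2 q f(u) / f(μ)`
  have hone : Tendsto (fun n => mu n / mu n) atTop (𝓝 1) :=
    tendsto_const_nhds.congr fun n => (div_self (hb.mu_pos n).ne').symm
  have hlow : Tendsto (fun n => Real.log (nonlin p h (u n (ρ₀ n))) / mu n ^ p -
      Real.log (nonlin p h (mu n)) / mu n ^ p) atTop (𝓝 0) := by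
    have := (hb.tendsto_log_nonlin_div one_pos hv).sub (hb.tendsto_log_nonlin_div one_pos hone)
    simpa using this
  obtain ⟨T, hT⟩ := (eventually_tailBound hp hb.growth hb.sub one_pos).exists
  refine tendsto_of_tendsto_of_tendsto_of_le_of_le' hlow tendsto_const_nhds ?_ ?_
  · filter_upwards [hq.eventually (lt_mem_nhds (by norm_num : (1 : ℝ) < 4)),
      (hb.value_atTop one_pos hv).eventually_ge_atTop T, hb.mu_tendsto.eventually_ge_atTop T,
      hb.mu_tendsto.eventually (eventually_nonlin_le hp hb.growth hb.sub)] with n h1 h2 h3 h4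
    have hu := hb.sol n
    have hf1 := hT.nonlin_pos h2
    have hf2 := hT.nonlin_pos h3
    have hr0 := (hf.rho_mem n).1
    have hw := (hu.flux_le_sq hb.growth h4 (Ioo_subset_Icc_self (hf.rho_mem n))).1
    have hup : 0 < u n (ρ₀ n) ^ (p - 1) := Real.rpow_pos_of_pos (hu.pos _ (hf.rho_mem n)) _
    have hXlow : nonlin p h (u n (ρ₀ n)) / nonlin p h (mu n) ≤
        density p h (lam n) (u n) (ρ₀ n) := by
      rw [div_le_iff₀ hf2]
      have h6 : scaledFlux p (u n) (ρ₀ n) ≤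
          p * u n (ρ₀ n) ^ (p - 1) * (lam n * nonlin p h (mu n) * ρ₀ n ^ 2 / 2) :=
        mul_le_mul_of_nonneg_left hw (by have : 0 < p := by linarith
                                         positivity)
      have h7 : (1 : ℝ) ≤ p * lam n * ρ₀ n ^ 2 * u n (ρ₀ n) ^ (p - 1) * nonlin p h (mu n) := by
        linarith
      unfold density
      nlinarith [mul_le_mul_of_nonneg_left h7 hf1.le]
    have := Real.log_le_log (div_pos hf1 hf2) hXlow
    rw [Real.log_div hf1.ne' hf2.ne'] at this
    rw [← sub_div]
    exact div_le_div_of_nonneg_right this (Real.rpow_pos_of_pos (hb.mu_pos n) _).le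
  · filter_upwards [hX.eventually (gt_mem_nhds one_pos)] with n h1
    exact div_nonpos_of_nonpos_of_nonneg (Real.log_nonpos
      ((hb.sol n).density_nonneg hp hb.growth (Ioo_subset_Icc_self (hf.rho_mem n))) h1.le)
      (Real.rpow_pos_of_pos (hb.mu_pos n) _).le

/-! ### The neck between two bubbles -/

namespace IsRadialSolution

variable {p : ℝ} {h : ℝ → ℝ} {lam mu : ℝ} {u : ℝ → ℝ}

theorem log_density_eq (hp : 2 < p) (hu : IsRadialSolution p h lam mu u) {r : ℝ}
    (hr : r ∈ Ioo (0 : ℝ) 1) (hf : 0 < nonlin p h (u r)) :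
    Real.log (density p h lam u r) = Real.log (p * lam) + 2 * Real.log r +
      (p - 1) * Real.log (u r) + Real.log (nonlin p h (u r)) := by
  have h1 := hu.pos r hr
  have h2 := hr.1
  have h4 : 0 < u r ^ (p - 1) := Real.rpow_pos_of_pos h1 _
  have h5 : p * lam ≠ 0 := by
    have := hu.lam_pos
    have : 0 < p := by linarith
    positivity
  rw [density, Real.log_mul (by positivity) hf.ne', Real.log_mul (by positivity) h4.ne',
    Real.log_mul h5 (by positivity), Real.log_pow, Real.log_rpow h1]
  push_cast
  ring

/-- As the flux increases, `u` drops on `[s, r]` at least by `w(s) log (r/s)` and at most by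
`w(r) log (r/s)`. -/
theorem drop_bounds (hu : IsRadialSolution p h lam mu u) (hh : IsGrowthFactor h) {s r : ℝ}
    (hs : 0 < s) (hsr : s ≤ r) (hr : r ≤ 1) :
    flux u s * (Real.log r - Real.log s) ≤ u s - u r ∧
      u s - u r ≤ flux u r * (Real.log r - Real.log s) := by
  have hc : ContinuousOn u (Icc s r) := hu.continuousOn.mono (Icc_subset_Icc hs.le hr)
  have hcl : ContinuousOn Real.log (Icc s r) :=
    Real.continuousOn_log.mono fun x hx => ne_of_gt (hs.trans_le hx.1)
  have hsub : ∀ x ∈ Ioo s r, x ∈ Ioo (0 : ℝ) 1 := fun x hx => ⟨hs.trans hx.1, hx.2.trans_le hr⟩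
  have h1 := le_of_hasDerivAt_nonneg (f := fun x => -u x - flux u s * Real.log x)
    (f' := fun x => -(-(flux u x / x)) - flux u s * x⁻¹) hsr
    (hc.neg.sub (continuousOn_const.mul hcl))
    (fun x hx => (hu.hasDerivAt' (hsub x hx)).neg.sub
      ((Real.hasDerivAt_log (hsub x hx).1.ne').const_mul _)) fun x hx => by
        have := hu.flux_le hh hs.le hx.1.le (hx.2.le.trans hr)
        have h2 := div_le_div_of_nonneg_right this (hsub x hx).1.le
        rw [← div_eq_mul_inv]
        linarith
  have h2 := le_of_hasDerivAt_nonneg (f := fun x => u x + flux u r * Real.log x)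
    (f' := fun x => -(flux u x / x) + flux u r * x⁻¹) hsr
    (hc.add (continuousOn_const.mul hcl))
    (fun x hx => (hu.hasDerivAt' (hsub x hx)).add
      ((Real.hasDerivAt_log (hsub x hx).1.ne').const_mul _)) fun x hx => by
        have := hu.flux_le hh (hsub x hx).1.le hx.2.le hr
        have h2 := div_le_div_of_nonneg_right this (hsub x hx).1.le
        rw [← div_eq_mul_inv]
        linarith
  constructor <;> linarith

/-- In the neck the density decays like a power of the radius, by convexity of `t ↦ t^p`; hence
almost no flux is added. -/
theorem neck_decay (hp : 2 < p) (hu : IsRadialSolution p h lam mu u) (hh : IsGrowthFactor h)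
    {ε T c s r : ℝ} (hT : TailBound p h ε T) (hε : 0 ≤ ε) (hε1 : ε ≤ 1) (hc : 0 < c)
    (hs : 0 < s) (hsr : s ≤ r) (hr : r < 1) (hur : T ≤ u r) (hlt : u r < u s)
    (hslope : c ≤ (1 - ε) * ((u s ^ p - u r ^ p) / (u s - u r) * flux u s) - 2) :
    (∀ x ∈ Icc s r, density p h lam u x ≤
      density p h lam u s * Real.exp (-c * (Real.log x - Real.log s))) ∧
    p * u r ^ (p - 1) * (flux u r - flux u s) ≤ density p h lam u s / c := by
  have hsub : ∀ x ∈ Icc s r, x ∈ Ioo (0 : ℝ) 1 := fun x hx =>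
    ⟨hs.trans_le hx.1, hx.2.trans_lt hr⟩
  have huT : ∀ x ∈ Icc s r, T ≤ u x := fun x hx =>
    hur.trans (hu.le_of_le hh (hsub x hx).1.le hx.2 hr.le)
  have hdec : ∀ x ∈ Icc s r, density p h lam u x ≤
      density p h lam u s * Real.exp (-c * (Real.log x - Real.log s)) := by
    intro x hx
    have hsI : s ∈ Icc s r := left_mem_Icc.2 hsr
    have hfx := hT.nonlin_pos (huT x hx)
    have hfs := hT.nonlin_pos (huT s hsI)
    have hXx := hu.density_pos hp (hsub x hx) hfx
    have hXs := hu.density_pos hp (hsub s hsI) hfs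
    have hxs := hu.le_of_le hh hs.le hx.1 (hsub x hx).2.le
    have hrx := hu.le_of_le hh (hsub x hx).1.le hx.2 hr.le
    have hx0 := hu.pos x (hsub x hx)
    have hr0 := hu.pos r (hsub r (right_mem_Icc.2 hsr))
    have h1 := (abs_le.1 (hT.abs_log_nonlin_sub_le hp hh hε (huT x hx) hxs)).1
    have h2 := (hu.drop_bounds hh hs hx.1 (hsub x hx).2.le).1
    have h3 := Real.log_le_log hx0 hxs
    set S := (u s ^ p - u r ^ p) / (u s - u r) with hS
    have hS0 : 0 ≤ S := div_nonneg (sub_nonneg.2 (Real.rpow_le_rpow hr0.le hlt.le (by linarith)))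
      (by linarith)
    have h4 : S * (u s - u x) ≤ u s ^ p - u x ^ p := by
      rcases hxs.eq_or_lt with heq | hlt'
      · rw [heq]; simp
      · have := (convexOn_rpow (p := p) (by linarith)).secant_mono
          (mem_Ici.2 (hx0.le.trans hxs)) (mem_Ici.2 hr0.le) (mem_Ici.2 hx0.le) hlt.ne hlt'.ne hrx
        rw [← neg_div_neg_eq, neg_sub, neg_sub, ← neg_div_neg_eq (u x ^ p - u s ^ p), neg_sub,
          neg_sub, le_div_iff₀ (by linarith)] at this
        exact this
    have hl0 : 0 ≤ Real.log x - Real.log s := sub_nonneg.2 (Real.log_le_log hs hx.1)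
    have h5 : (1 - ε) * (S * (flux u s * (Real.log x - Real.log s))) ≤
        (1 - ε) * (u s ^ p - u x ^ p) :=
      mul_le_mul_of_nonneg_left ((mul_le_mul_of_nonneg_left h2 hS0).trans h4) (by linarith)
    have h6 := mul_le_mul_of_nonneg_right hslope hl0
    have h7 : (p - 1) * (Real.log (u x) - Real.log (u s)) ≤ 0 :=
      mul_nonpos_of_nonneg_of_nonpos (by linarith) (by linarith)
    have h8 : Real.log (density p h lam u x) ≤
        Real.log (density p h lam u s) + -c * (Real.log x - Real.log s) := by
      rw [hu.log_density_eq hp (hsub x hx) hfx, hu.log_density_eq hp (hsub s hsI) hfs]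
      nlinarith
    calc density p h lam u x = Real.exp (Real.log (density p h lam u x)) :=
          (Real.exp_log hXx).symm
      _ ≤ _ := Real.exp_le_exp.2 h8
      _ = _ := by rw [Real.exp_add, Real.exp_log hXs]
  refine ⟨hdec, ?_⟩
  have hr0 := hu.pos r (hsub r (right_mem_Icc.2 hsr))
  have hmono := le_of_hasDerivAt_nonneg
    (f := fun x => -(density p h lam u s / c * Real.exp (-c * (Real.log x - Real.log s)))
      - p * u r ^ (p - 1) * flux u x)
    (f' := fun x => -(density p h lam u s / c * (Real.exp (-c * (Real.log x - Real.log s)) *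
      (-c * x⁻¹))) - p * u r ^ (p - 1) * (lam * nonlin p h (u x) * x)) hsr ?_ ?_ ?_
  · simp only [sub_self, mul_zero, Real.exp_zero, mul_one] at hmono
    have : 0 ≤ density p h lam u s / c * Real.exp (-c * (Real.log r - Real.log s)) := by
      have := hu.density_nonneg hp hh (Ioo_subset_Icc_self (hsub s (left_mem_Icc.2 hsr)))
      positivity
    linarith
  · have hcl : ContinuousOn Real.log (Icc s r) :=
      Real.continuousOn_log.mono fun x hx => ne_of_gt (hs.trans_le hx.1)
    have := hu.continuousOn_flux.mono (Icc_subset_Icc hs.le hr.le)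
    fun_prop
  · intro x hx
    have hx' := hsub x (Ioo_subset_Icc_self hx)
    exact ((((((Real.hasDerivAt_log hx'.1.ne').sub_const _).const_mul (-c)).exp).const_mul
      _).neg).sub ((hu.hasDerivAt_flux hx').const_mul _)
  · intro x hx
    have hxI := Ioo_subset_Icc_self hx
    have hx' := hsub x hxI
    have h1 := hdec x hxI
    have h2 : u r ^ (p - 1) ≤ u x ^ (p - 1) := Real.rpow_le_rpow hr0.le
      (hu.le_of_le hh hx'.1.le hx.2.le hr.le) (by linarith)
    have h3 : 0 ≤ p * lam * x ^ 2 * nonlin p h (u x) := by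
      have := nonlin_nonneg (p := p) hh (hu.pos x hx').le
      have := hu.lam_pos
      have : 0 < p := by linarith
      positivity
    have h4 : p * u r ^ (p - 1) * (lam * nonlin p h (u x) * x) * x ≤ density p h lam u x := by
      unfold density
      nlinarith [mul_le_mul_of_nonneg_left h2 h3]
    have h5 : p * u r ^ (p - 1) * (lam * nonlin p h (u x) * x) ≤
        density p h lam u s * Real.exp (-c * (Real.log x - Real.log s)) / x := by
      rw [le_div_iff₀ hx'.1]
      exact h4.trans h1
    have h6 : density p h lam u s / c * (Real.exp (-c * (Real.log x - Real.log s)) *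
      (-c * x⁻¹)) = -(density p h lam u s * Real.exp (-c * (Real.log x - Real.log s)) / x) := by
      field_simp
    rw [h6]
    linarith

end IsRadialSolution

/-- The neck at a fixed level `y μ` above the next bubble. The function of `y` bounding
`log X / μ^p` from below vanishes at the level of the next bubble. -/
theorem IsNeckState.exists_level {p : ℝ} {h : ℝ → ℝ} {lam mu : ℕ → ℝ} {u : ℕ → ℝ → ℝ}
    (hb : IsBlowup p h lam mu u) {d a y : ℝ} {s : ℕ → ℝ} (hd : 0 < d) (ha : 0 < a)
    (hs : IsNeckState p h lam mu u d (2 + a) s) (hy : y ∈ Ioo 0 d)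
    (hneg : 2 * p / (2 + a) * (1 - y / d) - 1 + (y / d) ^ p < 0) :
    ∃ r b : ℕ → ℝ, (∀ᶠ n in atTop, r n ∈ Ioo (s n) 1 ∧ u n (r n) = y * mu n) ∧
      Tendsto (fun n => scaledFlux p (u n) (r n)) atTop
        (𝓝 (y ^ (p - 1) * ((2 + a) / d ^ (p - 1)))) ∧
      Tendsto (fun n => density p h (lam n) (u n) (r n)) atTop (𝓝 0) ∧
      Tendsto b atTop (𝓝 (2 * p * (d - y) / ((2 + a) / d ^ (p - 1)) + (y ^ p - d ^ p))) ∧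
      ∀ᶠ n in atTop, b n ≤ Real.log (density p h (lam n) (u n) (r n)) / mu n ^ p := by
  have hp := hb.exponent
  have hh := hb.growth
  obtain ⟨hy0, hyd⟩ := hy
  have hp0 : 0 < p := by linarith
  set E := (2 + a) / d ^ (p - 1) with hE
  have hdp : 0 < d ^ (p - 1) := Real.rpow_pos_of_pos hd _
  have hE0 : 0 < E := by positivity
  have hlev : ∀ᶠ n in atTop, ∃ r, r ∈ Ioo (s n) 1 ∧ u n r = y * mu n := by
    filter_upwards [hs.value_tendsto.eventually (lt_mem_nhds hyd)] with n hn
    rw [lt_div_iff₀ (hb.mu_pos n)] at hn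
    exact (hb.sol n).exists_eq (hs.mem n).1.le (hs.mem n).2.le (mul_pos hy0 (hb.mu_pos n)) hn
  obtain ⟨r, hr⟩ := hlev.choice
  have hvr : Tendsto (fun n => u n (r n) / mu n) atTop (𝓝 y) := by
    refine tendsto_const_nhds.congr' ?_
    filter_upwards [hr] with n hn
    rw [hn.2, mul_div_assoc, div_self (hb.mu_pos n).ne', mul_one]
  have hflux : Tendsto (fun n => p * mu n ^ (p - 1) * flux (u n) (s n)) atTop (𝓝 E) :=
    hb.tendsto_mul_flux hd hs.value_tendsto hs.flux_tendsto
  have hmup : ∀ n, 0 < mu n ^ (p - 1) := fun n => Real.rpow_pos_of_pos (hb.mu_pos n) _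
  have hmupp : ∀ n, mu n ^ p = mu n ^ (p - 1) * mu n := fun n => by
    rw [Real.rpow_sub_one (hb.mu_pos n).ne']
    have := (hb.mu_pos n).ne'
    field_simp
  -- the limit of the slope appearing in the decay estimate exceeds `2`
  set K := (d ^ p - y ^ p) / (d - y) * (E / p) with hK
  have hK2 : 2 < K := by
    have e1 : (y / d) ^ p = y ^ p / d ^ p := Real.div_rpow hy0.le hd.le _
    have e2 : d ^ p = d ^ (p - 1) * d := by
      rw [Real.rpow_sub_one hd.ne']; field_simp
    have hdy : 0 < d - y := by linarith
    have h2a : 0 < 2 + a := by linarith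
    rw [e1, e2] at hneg
    have e3 : K = (d ^ (p - 1) * d - y ^ p) * (2 + a) / ((d - y) * (d ^ (p - 1) * p)) := by
      rw [hK, hE, e2]; field_simp
    rw [e3, lt_div_iff₀ (by positivity)]
    have h5 : 2 * p / (2 + a) * (1 - y / d) - 1 + y ^ p / (d ^ (p - 1) * d) =
      (2 * ((d - y) * (d ^ (p - 1) * p)) - (d ^ (p - 1) * d - y ^ p) * (2 + a)) /
        ((2 + a) * (d ^ (p - 1) * d)) := by field_simp; ring
    rw [h5] at hneg
    have := (div_neg_iff.1 hneg).resolve_left (fun h => absurd h.2 (not_lt.2 (by positivity)))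
    linarith [this.1]
  have hslope : Tendsto (fun n => (u n (s n) ^ p - u n (r n) ^ p) / (u n (s n) - u n (r n)) *
      flux (u n) (s n)) atTop (𝓝 K) := by
    have h1 := (hb.tendsto_rpow_div (q := p) hd hs.value_tendsto).sub
      (hb.tendsto_rpow_div (q := p) hy0 hvr)
    have h2 := hs.value_tendsto.sub hvr
    have h3 := (h1.div h2 (by linarith : d - y ≠ 0)).mul (hflux.div_const p)
    refine h3.congr fun n => ?_
    have h4 := (hb.mu_pos n).ne'
    have h5 := (hmup n).ne'
    simp only [Pi.div_apply]
    rw [← sub_div, ← sub_div, hmupp n]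
    by_cases hz : u n (s n) - u n (r n) = 0
    · rw [hz]; simp
    · field_simp
  set ε := (K - 2) / (4 * K) with hε
  have hε0 : 0 < ε := div_pos (by linarith) (by linarith)
  have hε1 : ε ≤ 1 := by rw [hε, div_le_one (by linarith)]; linarith
  obtain ⟨T, hT⟩ := (eventually_tailBound hp hh hb.sub hε0).exists
  set c := (K - 2) / 2 with hc
  have hc0 : 0 < c := by rw [hc]; linarith
  have hslope2 : ∀ᶠ n in atTop, c ≤ (1 - ε) * ((u n (s n) ^ p - u n (r n) ^ p) /
      (u n (s n) - u n (r n)) * flux (u n) (s n)) - 2 := by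
    have h1 := (hslope.const_mul (1 - ε)).sub_const 2
    have h2 : c < (1 - ε) * K - 2 := by
      have : ε * K = (K - 2) / 4 := by rw [hε]; field_simp
      nlinarith
    filter_upwards [h1.eventually (lt_mem_nhds h2)] with n hn using hn.le
  have hdecay : ∀ᶠ n in atTop,
      density p h (lam n) (u n) (r n) ≤ density p h (lam n) (u n) (s n) ∧
      p * u n (r n) ^ (p - 1) * (flux (u n) (r n) - flux (u n) (s n)) ≤
        density p h (lam n) (u n) (s n) / c := by
    filter_upwards [hr, hslope2, (hb.value_atTop hy0 hvr).eventually_ge_atTop T,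
      hs.value_tendsto.eventually (lt_mem_nhds hyd)] with n h1 h2 h3 h4
    rw [lt_div_iff₀ (hb.mu_pos n), ← h1.2] at h4
    have h5 := (hb.sol n).neck_decay hp hh hT hε0.le hε1 hc0 (hs.mem n).1 h1.1.1.le h1.1.2 h3 h4 h2
    refine ⟨(h5.1 (r n) (right_mem_Icc.2 h1.1.1.le)).trans ?_, h5.2⟩
    refine mul_le_of_le_one_right ((hb.sol n).density_nonneg hp hh
      (Ioo_subset_Icc_self (hs.mem n))) (Real.exp_le_one_iff.2 ?_)
    have := Real.log_le_log (hs.mem n).1 h1.1.1.le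
    nlinarith
  have hq : Tendsto (fun n => scaledFlux p (u n) (r n)) atTop (𝓝 (y ^ (p - 1) * E)) := by
    have h1 : Tendsto (fun n => p * u n (r n) ^ (p - 1) * (flux (u n) (r n) - flux (u n) (s n)))
        atTop (𝓝 0) := by
      have h2 := hs.density_tendsto.div_const c
      rw [zero_div] at h2
      refine tendsto_of_tendsto_of_tendsto_of_le_of_le' tendsto_const_nhds h2 ?_
        (hdecay.mono fun n hn => hn.2)
      filter_upwards [hr] with n hn
      have h3 := (hb.sol n).flux_le hh (hs.mem n).1.le hn.1.1.le hn.1.2.le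
      have h4 : 0 ≤ u n (r n) ^ (p - 1) := Real.rpow_nonneg
        ((hb.sol n).nonneg ⟨(hs.mem n).1.le.trans hn.1.1.le, hn.1.2.le⟩) _
      have h5 := sub_nonneg.2 h3
      positivity
    have h2 := h1.add ((hb.tendsto_rpow_div (q := p - 1) hy0 hvr).mul hflux)
    rw [zero_add] at h2
    refine h2.congr fun n => ?_
    have := (hmup n).ne'
    unfold scaledFlux
    field_simp
    ring
  refine ⟨r, fun n => Real.log (density p h (lam n) (u n) (s n)) / mu n ^ p +
    (2 * p * (u n (s n) / mu n - u n (r n) / mu n) / (p * mu n ^ (p - 1) * flux (u n) (r n)) +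
    (p - 1) * (Real.log (u n (r n) / mu n / (u n (s n) / mu n)) / mu n ^ p) +
    (Real.log (nonlin p h (u n (r n))) / mu n ^ p -
      Real.log (nonlin p h (u n (s n))) / mu n ^ p)), hr, hq, ?_, ?_, ?_⟩
  · refine tendsto_of_tendsto_of_tendsto_of_le_of_le' tendsto_const_nhds hs.density_tendsto ?_
        (hdecay.mono fun n hn => hn.1)
    filter_upwards [hr] with n hn
    exact (hb.sol n).density_nonneg hp hh ⟨(hs.mem n).1.le.trans hn.1.1.le, hn.1.2.le⟩
  · have hE' : Tendsto (fun n => p * mu n ^ (p - 1) * flux (u n) (r n)) atTop (𝓝 E) := by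
      have := hb.tendsto_mul_flux hy0 hvr hq
      rwa [mul_div_cancel_left₀ _ (Real.rpow_pos_of_pos hy0 _).ne'] at this
    have h1 := ((hs.value_tendsto.sub hvr).const_mul (2 * p)).div hE' hE0.ne'
    have h2 : Tendsto (fun n => Real.log (u n (r n) / mu n / (u n (s n) / mu n)) / mu n ^ p)
        atTop (𝓝 0) :=
      ((hvr.div hs.value_tendsto hd.ne').log (div_pos hy0 hd).ne').div_atTop (hb.rpow_tendsto hp0)
    have h3 := (hb.tendsto_log_nonlin_div hy0 hvr).sub (hb.tendsto_log_nonlin_div hd hs.value_tendsto)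
    have h4 := hs.log_density_tendsto.add ((h1.add (h2.const_mul (p - 1))).add h3)
    simpa using h4
  · filter_upwards [hr, (hb.value_atTop hy0 hvr).eventually_ge_atTop T,
      hq.eventually (lt_mem_nhds (mul_pos (Real.rpow_pos_of_pos hy0 (p - 1)) hE0))]
      with n h1 h2 h3
    have hu := hb.sol n
    have hrI : r n ∈ Ioo (0 : ℝ) 1 := ⟨(hs.mem n).1.trans h1.1.1, h1.1.2⟩
    have hsr := hu.le_of_le hh (hs.mem n).1.le h1.1.1.le h1.1.2.le
    have hr0 := hu.pos _ hrI
    have hs0 := hu.pos _ (hs.mem n)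
    have hw : 0 < flux (u n) (r n) := by
      unfold scaledFlux at h3
      exact pos_of_mul_pos_right h3 (mul_nonneg hp0.le (Real.rpow_nonneg hr0.le _))
    have hd2 := (hu.drop_bounds hh (hs.mem n).1 h1.1.1.le h1.1.2.le).2
    rw [hu.log_density_eq hp hrI (hT.nonlin_pos h2),
      hu.log_density_eq hp (hs.mem n) (hT.nonlin_pos (h2.trans hsr)),
      div_div_div_cancel_right₀ (hb.mu_pos n).ne', Real.log_div hr0.ne' hs0.ne']
    have h6 : (u n (s n) - u n (r n)) / flux (u n) (r n) ≤ Real.log (r n) - Real.log (s n) := by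
      rw [div_le_iff₀ hw]; linarith
    have hm := (hb.mu_pos n)
    have hm1 := hmup n
    have e : 2 * p * (u n (s n) / mu n - u n (r n) / mu n) /
        (p * mu n ^ (p - 1) * flux (u n) (r n)) =
        2 * ((u n (s n) - u n (r n)) / flux (u n) (r n)) / mu n ^ p := by
      rw [hmupp n]
      field_simp
    rw [e, ← sub_div, ← mul_div_assoc (p - 1), ← add_div, ← add_div, ← add_div]
    refine div_le_div_of_nonneg_right ?_ (Real.rpow_pos_of_pos hm _).le
    linarith

/-- A neck state after a bubble with parameter `a` at level `d` leads to a neck state just before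
the level `d'` of the next bubble. -/
theorem IsNeckState.exists_next {p : ℝ} {h : ℝ → ℝ} {lam mu : ℕ → ℝ} {u : ℕ → ℝ → ℝ}
    (hb : IsBlowup p h lam mu u) {d a d' : ℝ} {s : ℕ → ℝ} (hd : 0 < d) (ha : 0 < a)
    (hs : IsNeckState p h lam mu u d (2 + a) s) (hd' : d' ∈ Ioo 0 d)
    (h0 : 2 * p / (2 + a) * (1 - d' / d) - 1 + (d' / d) ^ p = 0) :
    ∃ t : ℕ → ℝ, IsNeckState p h lam mu u d' ((d' / d) ^ (p - 1) * (2 + a)) t ∧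
      ∀ᶠ n in atTop, s n ≤ t n := by
  have hp := hb.exponent
  have hh := hb.growth
  obtain ⟨hd0, hdd⟩ := hd'
  set Q := (d' / d) ^ (p - 1) * (2 + a) with hQ
  set E := (2 + a) / d ^ (p - 1) with hE
  have hQE : d' ^ (p - 1) * E = Q := by
    rw [hQ, hE, Real.div_rpow hd0.le hd.le]; ring
  set G : ℝ → ℝ := fun y => 2 * p * (d - y) / E + (y ^ p - d ^ p) with hG
  have hG0 : G d' = 0 := by
    have e2 : d ^ p = d ^ (p - 1) * d := by
      rw [Real.rpow_sub_one hd.ne']; field_simp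
    have hdp : 0 < d ^ (p - 1) := Real.rpow_pos_of_pos hd _
    rw [Real.div_rpow hd0.le hd.le, e2] at h0
    have h2a : 0 < 2 + a := by linarith
    simp only [hG, hE, e2]
    have : 2 * p * (d - d') / ((2 + a) / d ^ (p - 1)) + (d' ^ p - d ^ (p - 1) * d) =
      (2 * p / (2 + a) * (1 - d' / d) - 1 + d' ^ p / (d ^ (p - 1) * d)) * (d ^ (p - 1) * d) := by
      field_simp
      ring
    rw [this, h0, zero_mul]
  have hGc : ContinuousAt G d' := by
    have : ContinuousAt (fun y : ℝ => y ^ p) d' :=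
      Real.continuousAt_rpow_const _ _ (Or.inl hd0.ne')
    exact ((continuousAt_const.mul (continuousAt_const.sub continuousAt_id)).div_const E).add
      (this.sub continuousAt_const)
  have hqc : ContinuousAt (fun y : ℝ => y ^ (p - 1) * E) d' :=
    (Real.continuousAt_rpow_const _ _ (Or.inl hd0.ne')).mul continuousAt_const
  obtain ⟨t, e, hD, he0, he, hP⟩ := exists_diagonal (α := ℝ) (D := fun _ t => t ∈ Ioo (0 : ℝ) 1)
    (P := fun ε n t => s n ≤ t ∧ |u n t / mu n - d'| ≤ ε ∧ |scaledFlux p (u n) t - Q| ≤ ε ∧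
      |density p h (lam n) (u n) t - 0| ≤ ε ∧
      |Real.log (density p h (lam n) (u n) t) / mu n ^ p - 0| ≤ ε)
    (fun _ => ⟨1 / 2, by norm_num⟩) (by
      intro ε hε
      -- a level `y > d'` close enough to `d'`
      have h1 : ∀ᶠ y in 𝓝[>] d', |y - d'| < ε ∧ |y ^ (p - 1) * E - Q| < ε / 2 ∧ -ε < G y - ε / 2 ∧
          y ∈ Ioo d' d := by
        have h2 : ∀ᶠ y in 𝓝 d', |y - d'| < ε := Metric.ball_mem_nhds d' hε
        have h3 : ∀ᶠ y in 𝓝 d', |y ^ (p - 1) * E - Q| < ε / 2 := by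
          have := Metric.tendsto_nhds.1 hqc (ε / 2) (half_pos hε)
          simp only [Real.dist_eq, hQE] at this
          exact this
        have h4 : ∀ᶠ y in 𝓝 d', -(ε / 2) < G y :=
          hGc.eventually (lt_mem_nhds (by rw [hG0]; linarith))
        filter_upwards [nhdsWithin_le_nhds h2, nhdsWithin_le_nhds h3, nhdsWithin_le_nhds h4,
          Ioo_mem_nhdsGT hdd] with y h2 h3 h4 h5
        exact ⟨h2, h3, by linarith, h5⟩
      obtain ⟨y, hy1, hy2, hy3, hy4⟩ := h1.exists
      have hneg := ratio_neg (c := a) hp (div_pos hd0 hd).le (div_lt_div_of_pos_right hy4.1 hd)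
        ((div_lt_one hd).2 hy4.2) h0
      obtain ⟨r, b, hr, hq, hX, hbl, hbX⟩ := hs.exists_level hb hd ha
        ⟨hd0.trans hy4.1, hy4.2⟩ hneg
      filter_upwards [hr, eventually_abs_sub_le hq (half_pos hε),
        eventually_abs_sub_le hX (lt_min hε one_pos), hbX,
        hbl.eventually (lt_mem_nhds (by linarith : G y - ε / 2 < G y))] with n h1 h2 h3 h4 h5
      have hu := hb.sol n
      have hrI : r n ∈ Ioo (0 : ℝ) 1 := ⟨(hs.mem n).1.trans h1.1.1, h1.1.2⟩
      refine ⟨r n, hrI, h1.1.1.le, ?_, ?_, h3.trans (min_le_left _ _), ?_⟩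
      · rw [h1.2, mul_div_assoc, div_self (hb.mu_pos n).ne', mul_one]
        exact hy1.le
      · have := abs_sub_le (scaledFlux p (u n) (r n)) (y ^ (p - 1) * E) Q
        linarith
      · have h6 : Real.log (density p h (lam n) (u n) (r n)) / mu n ^ p ≤ 0 := by
          refine div_nonpos_of_nonpos_of_nonneg (Real.log_nonpos
            (hu.density_nonneg hp hh (Ioo_subset_Icc_self hrI)) ?_)
            (Real.rpow_pos_of_pos (hb.mu_pos n) _).le
          rw [sub_zero] at h3
          exact (le_abs_self _).trans (h3.trans (min_le_right _ _))
        rw [sub_zero, abs_of_nonpos h6]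
        linarith)
  refine ⟨t, ⟨hD, ?_, ?_, ?_, ?_⟩, hP.mono fun n hn => hn.1⟩
  · exact tendsto_of_abs_sub_le he (hP.mono fun n hn => hn.2.1)
  · exact tendsto_of_abs_sub_le he (hP.mono fun n hn => hn.2.2.1)
  · exact tendsto_of_abs_sub_le he (hP.mono fun n hn => hn.2.2.2.1)
  · exact tendsto_of_abs_sub_le he (hP.mono fun n hn => hn.2.2.2.2)

/-! ### The centre of the next bubble -/

namespace IsRadialSolution

variable {p : ℝ} {h : ℝ → ℝ} {lam mu : ℝ} {u : ℝ → ℝ}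

/-- As long as `q ≤ 2` and the Hamiltonian stays away from `0`, the quantity `log X + q` increases
at a definite rate in logarithmic radius. -/
theorem log_time_le (hp : 2 < p) (hu : IsRadialSolution p h lam mu u) (hh : IsGrowthFactor h)
    {ε T c s t : ℝ} (hT : TailBound p h ε T) (hε : 0 ≤ ε) (hs : 0 < s) (hst : s ≤ t) (ht : t < 1)
    (hut : T ≤ u t)
    (hq : ∀ x ∈ Icc s t, scaledFlux p u x ≤ 2)
    (hc : ∀ x ∈ Icc s t, c + 4 * ε ≤ 2 - scaledFlux p u x + density p h lam u x) :
    c * (Real.log t - Real.log s) ≤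
      Real.log (density p h lam u t) - Real.log (density p h lam u s) + 2 := by
  have hsub : ∀ x ∈ Icc s t, x ∈ Ioo (0 : ℝ) 1 := fun x hx =>
    ⟨hs.trans_le hx.1, hx.2.trans_lt ht⟩
  have huT : ∀ x ∈ Icc s t, T ≤ u x := fun x hx =>
    hut.trans (hu.le_of_le hh (hsub x hx).1.le hx.2 ht.le)
  have hd : ∀ x ∈ Icc s t, HasDerivAt
      (fun x => Real.log (density p h lam u x) + scaledFlux p u x - c * Real.log x) _ x :=
    fun x hx => ((hu.hasDerivAt_log_density hp hh (hsub x hx) (hT _ (huT x hx)).2.1).add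
      (hu.hasDerivAt_scaledFlux (hsub x hx))).sub
      ((Real.hasDerivAt_log (hsub x hx).1.ne').const_mul c)
  have hmono := le_of_hasDerivAt_nonneg hst
    (fun x hx => (hd x hx).continuousAt.continuousWithinAt)
    (fun x hx => hd x (Ioo_subset_Icc_self hx)) (fun x hx => by
      have hxI := Ioo_subset_Icc_self hx
      have hx01 := Ioo_subset_Icc_self (hsub x hxI)
      have h1 := (abs_le.1 (hu.abs_deviation_le hp hh hT hx01 (huT x hxI))).2
      have h2 := hu.flux_div_le hp hh hT hx01 (huT x hxI)
      have h3 := hq x hxI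
      have h4 := hc x hxI
      have h5 := hu.scaledFlux_nonneg hp hh hx01
      rw [← div_eq_mul_inv, ← add_div, ← sub_div]
      refine div_nonneg ?_ (hsub x hxI).1.le
      have h6 : (p - 1) * scaledFlux p u x * (flux u x / u x) ≤ 2 * ε := by
        have h7 := mul_le_mul_of_nonneg_left h2 h5
        have h8 : scaledFlux p u x * (ε / 2 * scaledFlux p u x) ≤ 2 * (ε / 2 * 2) := by
          gcongr
        linarith
      have h9 : ε * scaledFlux p u x ≤ ε * 2 := mul_le_mul_of_nonneg_left h3 hε
      linarith)
  have h1 := hu.scaledFlux_nonneg hp hh (Ioo_subset_Icc_self (hsub s (left_mem_Icc.2 hst)))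
  have h2 := hq t (right_mem_Icc.2 hst)
  linarith

end IsRadialSolution

/-- A neck state with `q → 2 - a` is followed by a point with `q = 2`, before `u / μ` has changed.
There the Hamiltonian, still close to `a² / 2`, reduces to the density. -/
theorem IsNeckState.exists_center {p : ℝ} {h : ℝ → ℝ} {lam mu : ℕ → ℝ} {u : ℕ → ℝ → ℝ}
    (hb : IsBlowup p h lam mu u) {d a : ℝ} {s : ℕ → ℝ} (hd : 0 < d) (ha : 0 < a) (ha2 : a < 2)
    (hs : IsNeckState p h lam mu u d (2 - a) s) :
    ∃ r : ℕ → ℝ, (∀ n, r n ∈ Ioo (0 : ℝ) 1 ∧ 0 < nonlin p h (u n (r n))) ∧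
      (∀ᶠ n in atTop, s n < r n ∧ scaledFlux p (u n) (r n) = 2) ∧
      Tendsto (fun n => u n (r n) / mu n) atTop (𝓝 d) ∧
      Tendsto (fun n => density p h (lam n) (u n) (r n)) atTop (𝓝 (a ^ 2 / 2)) ∧
      Tendsto (fun n => s n / r n) atTop (𝓝 0) := by
  have hp := hb.exponent
  have hh := hb.growth
  have hp0 : 0 < p := by linarith
  have hHs : Tendsto (fun n => hamiltonian p h (lam n) (u n) (s n)) atTop (𝓝 (a ^ 2 / 2)) := by
    have := (((hs.flux_tendsto.const_sub 2).pow 2).div_const 2).add hs.density_tendsto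
    simpa [hamiltonian] using this
  have hH2 : a ^ 2 / 2 < 2 := by nlinarith
  have ha2pos : 0 < a ^ 2 := by positivity
  have hus := hb.value_atTop hd hs.value_tendsto
  obtain ⟨r, e, hD, he0, he, hP⟩ := exists_diagonal (α := ℝ)
    (D := fun n r => r ∈ Ioo (0 : ℝ) 1 ∧ 0 < nonlin p h (u n r))
    (P := fun ε n r => (s n < r ∧ scaledFlux p (u n) r = 2) ∧ (1 - ε) * u n (s n) ≤ u n r)
    (fun n => (hb.sol n).exists_nonlin_pos hp hh) (by
      intro ε hε
      obtain ⟨κ, hκ, T₁, hT₁, hA⟩ := exists_adiabatic hp hh hb.sub (by positivity : 0 < a ^ 2 / 8)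
      set k := max κ (1 - ε) with hk
      have hk0 : 0 < k := hκ.1.trans_le (le_max_left _ _)
      have hk1 : k < 1 := max_lt hκ.2 (by linarith)
      obtain ⟨T, hT, hTT⟩ := ((eventually_tailBound hp hh hb.sub
        (by positivity : 0 < a ^ 2 / 64)).and (eventually_ge_atTop T₁)).exists
      -- over the drop from `u` to `k u`, the flux needs logarithmic time of order `μ^p`
      have hlim : ∀ᶠ n in atTop,
          0 < (1 - k) * k ^ (p - 1) * p * (a ^ 2 / 32) * (u n (s n) ^ p / mu n ^ p) -
            (4 / mu n ^ p - Real.log (density p h (lam n) (u n) (s n)) / mu n ^ p) := by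
        have h1 := ((hb.tendsto_rpow_div (q := p) hd hs.value_tendsto).const_mul
          ((1 - k) * k ^ (p - 1) * p * (a ^ 2 / 32))).sub
          ((tendsto_const_nhds.div_atTop (hb.rpow_tendsto hp0) :
            Tendsto (fun n => (4 : ℝ) / mu n ^ p) atTop (𝓝 0)).sub hs.log_density_tendsto)
        refine h1.eventually (lt_mem_nhds ?_)
        have h2 : 0 < k ^ (p - 1) := Real.rpow_pos_of_pos hk0 _
        have h3 : 0 < d ^ p := Real.rpow_pos_of_pos hd _
        have h4 : 0 < 1 - k := by linarith
        rw [sub_zero, sub_zero]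
        positivity
      filter_upwards [hlim, hHs.eventually (gt_mem_nhds (by linarith : a ^ 2 / 2 < 3)),
        hHs.eventually (lt_mem_nhds (by linarith : 3 * a ^ 2 / 8 < a ^ 2 / 2)),
        hHs.eventually (gt_mem_nhds (by linarith : a ^ 2 / 2 < 2)),
        hs.flux_tendsto.eventually (gt_mem_nhds (by linarith : 2 - a < 2)),
        hus.eventually_ge_atTop (T / k)] with n h1 h2 h3 h2' h4 h5
      have hu := hb.sol n
      obtain ⟨hs0, hs1⟩ := hs.mem n
      rw [div_le_iff₀ hk0, mul_comm] at h5
      have hus0 : 0 < u n (s n) := hu.pos _ (hs.mem n)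
      obtain ⟨t, ht, hut⟩ := hu.exists_eq hs0.le hs1.le (mul_pos hk0 hus0) (by nlinarith)
      have hadi := hA hu hs0.le ht.2.le (hTT.trans (hut ▸ h5))
        (by rw [hut]; exact mul_le_mul_of_nonneg_right (le_max_left _ _) hus0.le) h2.le
      have hsubI : Icc (s n) t ⊆ Icc (0 : ℝ) 1 := Icc_subset_Icc hs0.le ht.2.le
      by_cases hex : ∃ x ∈ Icc (s n) t, scaledFlux p (u n) x = 2
      · obtain ⟨x, hx, hx2⟩ := hex
        have hux : k * u n (s n) ≤ u n x := hut ▸ hu.le_of_le hh (hs0.le.trans hx.1) hx.2 ht.2.le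
        refine ⟨x, ⟨⟨hs0.trans_le hx.1, hx.2.trans_lt ht.2⟩, hT.nonlin_pos (h5.trans hux)⟩,
          ⟨lt_of_le_of_ne hx.1 fun hc => ?_, hx2⟩, ?_⟩
        · rw [hc, hx2] at h4
          exact lt_irrefl _ h4
        · exact (mul_le_mul_of_nonneg_right (le_max_right _ _) hus0.le).trans hux
      · exfalso
        have hq : ∀ x ∈ Icc (s n) t, scaledFlux p (u n) x < 2 := by
          intro x hx
          by_contra hc
          obtain ⟨y, hy, hy2⟩ := intermediate_value_Icc hx.1
            ((hu.continuousOn_scaledFlux hp).mono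
              ((Icc_subset_Icc_right hx.2).trans hsubI)) ⟨h4.le, not_lt.1 hc⟩
          exact hex ⟨y, ⟨hy.1, hy.2.trans hx.2⟩, hy2⟩
        have htime := hu.log_time_le (c := a ^ 2 / 16) hp hh hT (by positivity) hs0 ht.1.le ht.2
          (hut ▸ h5) (fun x hx => (hq x hx).le) (fun x hx => by
            have h6 := (abs_le.1 (hadi x hx).2).1
            have h7 := hq x hx
            have hX := hu.density_nonneg hp hh (hsubI hx)
            have h8 : a ^ 2 / 4 ≤ hamiltonian p h (lam n) (u n) x := by linarith
            unfold hamiltonian at h8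
            by_cases h9 : a / 2 ≤ 2 - scaledFlux p (u n) x
            · nlinarith
            · nlinarith)
        have hX3 : Real.log (density p h (lam n) (u n) t) ≤ 2 := by
          have htI : t ∈ Icc (s n) t := right_mem_Icc.2 ht.1.le
          have h6 := (abs_le.1 (hadi t htI).2).2
          have hXp := hu.density_pos hp ⟨hs0.trans ht.1, ht.2⟩ (hT.nonlin_pos (hut ▸ h5))
          have h7 := Real.log_le_sub_one_of_pos hXp
          have h8 : density p h (lam n) (u n) t ≤ hamiltonian p h (lam n) (u n) t := by
            unfold hamiltonian
            nlinarith [sq_nonneg (2 - scaledFlux p (u n) t)]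
          nlinarith
        have hdrop := (hu.drop_bounds hh hs0 ht.1.le ht.2.le).2
        have hlt : 0 < Real.log t - Real.log (s n) := sub_pos.2 (Real.log_lt_log hs0 ht.1)
        have hqt := (hq t (right_mem_Icc.2 ht.1.le)).le
        have hkp : 0 < p * (k * u n (s n)) ^ (p - 1) :=
          mul_pos hp0 (Real.rpow_pos_of_pos (mul_pos hk0 hus0) _)
        have h10 : p * (k * u n (s n)) ^ (p - 1) * ((1 - k) * u n (s n)) ≤
            2 * (Real.log t - Real.log (s n)) := by
          calc p * (k * u n (s n)) ^ (p - 1) * ((1 - k) * u n (s n))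
              = p * (k * u n (s n)) ^ (p - 1) * (u n (s n) - u n t) := by rw [hut]; ring
            _ ≤ p * (k * u n (s n)) ^ (p - 1) *
                (flux (u n) t * (Real.log t - Real.log (s n))) :=
                mul_le_mul_of_nonneg_left hdrop hkp.le
            _ = scaledFlux p (u n) t * (Real.log t - Real.log (s n)) := by
                rw [scaledFlux, hut]; ring
            _ ≤ _ := mul_le_mul_of_nonneg_right hqt hlt.le
        rw [Real.mul_rpow hk0.le hus0.le] at h10
        have h11 : u n (s n) ^ p = u n (s n) ^ (p - 1) * u n (s n) := by
          rw [Real.rpow_sub_one hus0.ne']; field_simp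
        have hmp : 0 < mu n ^ p := Real.rpow_pos_of_pos (hb.mu_pos n) _
        rw [← mul_div_assoc, ← sub_div, ← sub_div] at h1
        have h12 := (div_pos_iff_of_pos_right hmp).1 h1
        have h13 : (1 - k) * k ^ (p - 1) * p * (a ^ 2 / 32) * u n (s n) ^ p =
            a ^ 2 / 32 * (p * (k ^ (p - 1) * u n (s n) ^ (p - 1)) * ((1 - k) * u n (s n))) := by
          rw [h11]; ring
        rw [h13] at h12
        have h14 := mul_le_mul_of_nonneg_left h10 (by positivity : 0 ≤ a ^ 2 / 32)
        linarith)
  have hlt : ∀ᶠ n in atTop, s n < r n ∧ scaledFlux p (u n) (r n) = 2 := hP.mono fun n hn => hn.1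
  have hvr : Tendsto (fun n => u n (r n) / mu n) atTop (𝓝 d) := by
    have h1 := (he.const_sub 1).mul hs.value_tendsto
    rw [sub_zero, one_mul] at h1
    refine tendsto_of_tendsto_of_tendsto_of_le_of_le' h1 hs.value_tendsto ?_ ?_
    · filter_upwards [hP] with n hn
      rw [← mul_div_assoc]
      exact div_le_div_of_nonneg_right hn.2 (hb.mu_pos n).le
    · filter_upwards [hP] with n hn
      exact div_le_div_of_nonneg_right ((hb.sol n).le_of_le hh (hs.mem n).1.le hn.1.1.le
        (hD n).1.2.le) (hb.mu_pos n).le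
  have hHr := hb.tendsto_hamiltonian hd (fun n => (hs.mem n).1.le) (hlt.mono fun n hn => hn.1.le)
    (Eventually.of_forall fun n => (hD n).1.2.le) hs.value_tendsto hvr hHs hH2.le
  have hXr : Tendsto (fun n => density p h (lam n) (u n) (r n)) atTop (𝓝 (a ^ 2 / 2)) := by
    refine hHr.congr' ?_
    filter_upwards [hlt] with n hn
    simp [hamiltonian, hn.2]
  refine ⟨r, hD, hlt, hvr, hXr, ?_⟩
  -- `X / r²` is an increasing function of `u`, hence decreases with the radius
  obtain ⟨T, hT⟩ := (eventually_tailBound hp hh hb.sub one_pos).exists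
  have hsq : Tendsto (fun n => (s n / r n) ^ 2) atTop (𝓝 0) := by
    have h1 := hs.density_tendsto.div hXr (by positivity)
    rw [zero_div] at h1
    refine tendsto_of_tendsto_of_tendsto_of_le_of_le' tendsto_const_nhds h1
      (Eventually.of_forall fun n => sq_nonneg _) ?_
    filter_upwards [hlt, (hb.value_atTop hd hvr).eventually_ge_atTop T] with n h2 h3
    have hu := hb.sol n
    have hr0 := (hD n).1.1
    have hs0 := (hs.mem n).1
    have h4 := hu.le_of_le hh hs0.le h2.1.le (hD n).1.2.le
    have hur := hu.pos _ (hD n).1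
    have h5 := hT.nonlin_le hp hh zero_le_one le_rfl h3 h4
    have h6 : u n (r n) ^ (p - 1) ≤ u n (s n) ^ (p - 1) :=
      Real.rpow_le_rpow hur.le h4 (by linarith)
    have hXp := hu.density_pos hp (hD n).1 (hD n).2
    simp only [Pi.div_apply]
    rw [div_pow, div_le_div_iff₀ (by positivity) hXp]
    have h7 := hu.lam_pos
    have h8 : u n (r n) ^ (p - 1) * nonlin p h (u n (r n)) ≤
        u n (s n) ^ (p - 1) * nonlin p h (u n (s n)) :=
      mul_le_mul h6 h5 (hD n).2.le (Real.rpow_nonneg (hur.le.trans h4) _)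
    have h9 : 0 ≤ p * lam n * s n ^ 2 * r n ^ 2 := by positivity
    unfold density
    nlinarith [mul_le_mul_of_nonneg_left h8 h9]
  have h2 := hsq.sqrt
  rw [Real.sqrt_zero] at h2
  refine h2.congr fun n => ?_
  rw [Real.sqrt_sq (div_pos (hs.mem n).1 (hD n).1.1).le]

/-! ### Local expansion of the nonlinearity and stability of the rescaled equation -/

theorem abs_exp_sub_exp_le {x y B : ℝ} (hx : x ≤ B) (hy : y ≤ B) :
    |Real.exp x - Real.exp y| ≤ Real.exp B * |x - y| := by
  have := (convex_Iic B).norm_image_sub_le_of_norm_hasDerivWithin_le (f := Real.exp)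
    (f' := Real.exp) (C := Real.exp B) (fun t _ => (Real.hasDerivAt_exp t).hasDerivWithinAt)
    (fun t ht => by
      rw [Real.norm_eq_abs, abs_of_pos (Real.exp_pos _)]
      exact Real.exp_le_exp.2 ht) hy hx
  simpa [Real.norm_eq_abs] using this

/-- At arguments `v` with `p m^{p-1} (v - m)` bounded, `f(v) / f(m)` is close to
`exp (p m^{p-1} (v - m))` once `m` is large. -/
theorem exists_nonlin_ratio {p : ℝ} (hp : 2 < p) {h : ℝ → ℝ} (hh : IsGrowthFactor h)
    (hsub : SubordinateGrowth p h) {B η : ℝ} (hB : 0 < B) (hη : 0 < η) :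
    ∃ T : ℝ, ∀ m, T ≤ m → 0 < nonlin p h m ∧ ∀ v, p * m ^ (p - 1) * |v - m| ≤ B →
      0 < nonlin p h v ∧
      |nonlin p h v / nonlin p h m - Real.exp (p * m ^ (p - 1) * (v - m))| ≤ η := by
  have hp0 : 0 < p := by linarith
  set θ := min 1 (η / (2 * Real.exp B)) with hθ
  have hθ0 : 0 < θ := lt_min one_pos (by positivity)
  set ε := min 1 (θ / (2 * B)) with hε
  have hε0 : 0 < ε := lt_min one_pos (by positivity)
  have hε1 : ε ≤ 1 := min_le_left _ _
  obtain ⟨T₀, hT⟩ := (eventually_tailBound hp hh hsub hε0).exists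
  have hT01 := (hT T₀ le_rfl).1
  have hcont : ∀ᶠ x : ℝ in 𝓝 1, |x ^ (p - 1) - 1| < ε := by
    have := Metric.tendsto_nhds.1
      (Real.continuousAt_rpow_const (1 : ℝ) (p - 1) (Or.inl one_ne_zero)) ε hε0
    simpa [Real.dist_eq] using this
  obtain ⟨δ₀, hδ₀, hball⟩ := Metric.eventually_nhds_iff.1 hcont
  set δ := min (1 / 2) (δ₀ / 2) with hδ
  have hδ0 : 0 < δ := lt_min (by norm_num) (by positivity)
  have hδ1 : δ ≤ 1 / 2 := min_le_left _ _
  have hδ2 : δ < δ₀ := (min_le_right _ _).trans_lt (by linarith)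
  have hlim : ∀ᶠ m : ℝ in atTop, B / δ ≤ p * m ^ p :=
    ((tendsto_rpow_atTop hp0).const_mul_atTop hp0).eventually_ge_atTop _
  obtain ⟨T₁, hT₁⟩ := eventually_atTop.1 hlim
  refine ⟨max T₁ (2 * T₀), fun m hm => ?_⟩
  have hm1 := hT₁ m ((le_max_left _ _).trans hm)
  have hm2 : 2 * T₀ ≤ m := (le_max_right _ _).trans hm
  have hm0 : 0 < m := by linarith
  have hfm := hT.nonlin_pos (by linarith : T₀ ≤ m)
  refine ⟨hfm, fun v hv => ?_⟩
  set I := Icc ((1 - δ) * m) ((1 + δ) * m) with hI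
  have hIT : ∀ x ∈ I, T₀ ≤ x := fun x hx => by
    have := hx.1
    nlinarith
  have hmI : m ∈ I := ⟨by nlinarith, by nlinarith⟩
  have hmp : 0 < m ^ (p - 1) := Real.rpow_pos_of_pos hm0 _
  have hvI : v ∈ I := by
    have h1 : m ^ p = m ^ (p - 1) * m := by rw [Real.rpow_sub_one hm0.ne']; field_simp
    have h2 : B ≤ p * m ^ p * δ := (div_le_iff₀ hδ0).1 hm1
    have h3 : p * m ^ (p - 1) * |v - m| ≤ p * m ^ (p - 1) * (δ * m) := by
      rw [h1] at h2
      linarith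
    have h4 := abs_le.1 (le_of_mul_le_mul_left h3 (by positivity))
    exact ⟨by linarith, by linarith⟩
  have hfv := hT.nonlin_pos (hIT v hvI)
  refine ⟨hfv, ?_⟩
  have hbound := (convex_Icc ((1 - δ) * m) ((1 + δ) * m)).norm_image_sub_le_of_norm_hasDerivWithin_le
    (f := fun x => Real.log (nonlin p h x) - p * m ^ (p - 1) * x)
    (f' := fun x => deriv h x / h x + p * x ^ (p - 1) - p * m ^ (p - 1) * 1)
    (C := 2 * ε * (p * m ^ (p - 1)))
    (fun x hx => ((hasDerivAt_log_nonlin hh (by linarith [hIT x hx]) (hT x (hIT x hx)).2.1).sub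
      ((hasDerivAt_id x).const_mul _)).hasDerivWithinAt)
    (fun x hx => by
      have hx0 : 0 < x := by linarith [hIT x hx]
      have h1 := hT.abs_div_le (hIT x hx)
      have h2 : |(x / m) ^ (p - 1) - 1| < ε := by
        refine hball ?_
        rw [Real.dist_eq, div_sub_one hm0.ne', abs_div, abs_of_pos hm0, div_lt_iff₀ hm0]
        refine lt_of_le_of_lt (abs_le.2 ⟨?_, ?_⟩) (mul_lt_mul_of_pos_right hδ2 hm0)
        · linarith [hx.1]
        · linarith [hx.2]
      rw [Real.div_rpow hx0.le hm0.le, div_sub_one hmp.ne', abs_div, abs_of_pos hmp,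
        div_lt_iff₀ hmp] at h2
      have h3 := abs_le.1 h2.le
      have h4 := abs_le.1 h1
      have h5 : ε * x ^ (p - 1) ≤ 2 * (ε * m ^ (p - 1)) := by
        have h7 : ε * m ^ (p - 1) ≤ 1 * m ^ (p - 1) := mul_le_mul_of_nonneg_right hε1 hmp.le
        have h6 : x ^ (p - 1) ≤ 2 * m ^ (p - 1) := by linarith
        nlinarith [mul_le_mul_of_nonneg_left h6 hε0.le]
      have h6 : 2 * (ε * m ^ (p - 1)) ≤ p * (ε * m ^ (p - 1)) :=
        mul_le_mul_of_nonneg_right hp.le (by positivity)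
      have h8 := mul_le_mul_of_nonneg_left h3.1 hp0.le
      have h9 := mul_le_mul_of_nonneg_left h3.2 hp0.le
      rw [Real.norm_eq_abs]
      refine abs_le.2 ⟨?_, ?_⟩ <;> linarith) hmI hvI
  rw [Real.norm_eq_abs, Real.norm_eq_abs] at hbound
  set z := p * m ^ (p - 1) * (v - m) with hz
  set w := Real.log (nonlin p h v) - Real.log (nonlin p h m) - z with hw
  have hwθ : |w| ≤ θ := by
    have e : Real.log (nonlin p h v) - p * m ^ (p - 1) * v -
      (Real.log (nonlin p h m) - p * m ^ (p - 1) * m) = w := by rw [hw, hz]; ring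
    rw [e] at hbound
    refine hbound.trans ?_
    have h1 : ε * (2 * B) ≤ θ := (le_div_iff₀ (by positivity)).1 (min_le_right _ _)
    nlinarith [mul_le_mul_of_nonneg_left hv hε0.le]
  have hzB : z ≤ B := by
    rw [hz]
    exact (mul_le_mul_of_nonneg_left (le_abs_self _) (by positivity)).trans hv
  have e : nonlin p h v / nonlin p h m = Real.exp z * Real.exp w := by
    rw [← Real.exp_add, hw, add_sub_cancel, Real.exp_sub, Real.exp_log hfv, Real.exp_log hfm]
  have e2 : Real.exp z * Real.exp w - Real.exp z = Real.exp z * (Real.exp w - 1) := by ring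
  rw [e, e2, abs_mul, abs_of_pos (Real.exp_pos _)]
  have h1 := Real.abs_exp_sub_one_le (hwθ.trans (min_le_left _ _))
  have h2 : θ * (2 * Real.exp B) ≤ η := (le_div_iff₀ (by positivity)).1 (min_le_right _ _)
  calc Real.exp z * |Real.exp w - 1| ≤ Real.exp B * (2 * |w|) := by
        gcongr
    _ ≤ Real.exp B * (2 * θ) := by gcongr
    _ ≤ η := by linarith

/-- Energy estimate, outwards: the friction term `-D'/x` has the good sign, so that the interval
may start at the origin. -/
theorem stability_forward {D D₁ G : ℝ → ℝ} {C e s t : ℝ} (hC : 0 ≤ C) (hs : 0 ≤ s) (hst : s ≤ t)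
    (hcD : ContinuousOn D (Icc s t)) (hcD₁ : ContinuousOn D₁ (Icc s t))
    (hD : ∀ x ∈ Ioo s t, HasDerivAt D (D₁ x) x)
    (hD₁ : ∀ x ∈ Ioo s t, HasDerivAt D₁ (-(D₁ x / x) - G x) x)
    (hG : ∀ x ∈ Ioo s t, |G x| ≤ C * |D x| + e) :
    D t ^ 2 + D₁ t ^ 2 ≤ (D s ^ 2 + D₁ s ^ 2 + e ^ 2) * Real.exp ((2 + C) * (t - s)) := by
  have hmono := le_of_hasDerivAt_nonneg
    (f := fun x => -((D x ^ 2 + D₁ x ^ 2 + e ^ 2) * Real.exp (-((2 + C) * x))))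
    (f' := fun x => -((2 * D x * D₁ x + 2 * D₁ x * (-(D₁ x / x) - G x)) *
      Real.exp (-((2 + C) * x)) + (D x ^ 2 + D₁ x ^ 2 + e ^ 2) *
      (Real.exp (-((2 + C) * x)) * -((2 + C) * 1)))) hst (by fun_prop)
    (fun x hx => by
      refine (((((hD x hx).pow 2).add ((hD₁ x hx).pow 2)).add_const (e ^ 2)).mul
        (((hasDerivAt_id x).const_mul (2 + C)).neg.exp)).neg.congr_deriv ?_
      simp)
    (fun x hx => by
      have hx0 : 0 < x := hs.trans_lt hx.1
      have h1 := hG x hx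
      have h2 : 0 ≤ D₁ x * (D₁ x / x) := by
        rw [← mul_div_assoc, ← sq]
        positivity
      have h3 : 2 * D₁ x * -G x ≤ 2 * |D₁ x| * (C * |D x| + e) := by
        refine (le_abs_self _).trans ?_
        rw [abs_mul, abs_neg, abs_mul, abs_two]
        gcongr
      have h4 : 2 * D x * D₁ x ≤ D x ^ 2 + D₁ x ^ 2 := two_mul_le_add_sq _ _
      have h5 : 2 * |D₁ x| * |D x| ≤ D₁ x ^ 2 + D x ^ 2 := by
        have := two_mul_le_add_sq |D₁ x| |D x|
        rwa [sq_abs, sq_abs] at this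
      have h6 : 2 * |D₁ x| * e ≤ D₁ x ^ 2 + e ^ 2 := by
        have := two_mul_le_add_sq |D₁ x| e
        rwa [sq_abs] at this
      have h7 := mul_le_mul_of_nonneg_left h5 hC
      have h8 : 0 ≤ C * e ^ 2 := by positivity
      have h9 : 0 ≤ (2 + C) * (D x ^ 2 + D₁ x ^ 2 + e ^ 2) -
          (2 * D x * D₁ x + 2 * D₁ x * (-(D₁ x / x) - G x)) := by
        nlinarith [sq_nonneg (D x), sq_nonneg e]
      have h10 := mul_nonneg h9 (Real.exp_pos (-((2 + C) * x))).le
      linarith)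
  simp only [neg_le_neg_iff] at hmono
  have h1 : D t ^ 2 + D₁ t ^ 2 + e ^ 2 ≤
      (D s ^ 2 + D₁ s ^ 2 + e ^ 2) * Real.exp ((2 + C) * (t - s)) := by
    have := mul_le_mul_of_nonneg_right hmono (Real.exp_pos ((2 + C) * t)).le
    rw [mul_assoc, mul_assoc, ← Real.exp_add, ← Real.exp_add] at this
    rw [show -((2 + C) * t) + (2 + C) * t = 0 by ring, Real.exp_zero, mul_one,
      show -((2 + C) * s) + (2 + C) * t = (2 + C) * (t - s) by ring] at this
    exact this
  linarith [sq_nonneg e]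

/-- Energy estimate, inwards, at radii bounded away from the origin. -/
theorem stability_backward {D D₁ G : ℝ → ℝ} {C e α s t : ℝ} (hC : 0 ≤ C) (hα : 0 < α)
    (hs : α ≤ s) (hst : s ≤ t)
    (hcD : ContinuousOn D (Icc s t)) (hcD₁ : ContinuousOn D₁ (Icc s t))
    (hD : ∀ x ∈ Ioo s t, HasDerivAt D (D₁ x) x)
    (hD₁ : ∀ x ∈ Ioo s t, HasDerivAt D₁ (-(D₁ x / x) - G x) x)
    (hG : ∀ x ∈ Ioo s t, |G x| ≤ C * |D x| + e) :
    D s ^ 2 + D₁ s ^ 2 ≤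
      (D t ^ 2 + D₁ t ^ 2 + e ^ 2) * Real.exp ((2 + C + 2 / α) * (t - s)) := by
  set K := 2 + C + 2 / α with hK
  have hmono := le_of_hasDerivAt_nonneg
    (f := fun x => (D x ^ 2 + D₁ x ^ 2 + e ^ 2) * Real.exp (K * x))
    (f' := fun x => (2 * D x * D₁ x + 2 * D₁ x * (-(D₁ x / x) - G x)) *
      Real.exp (K * x) + (D x ^ 2 + D₁ x ^ 2 + e ^ 2) *
      (Real.exp (K * x) * (K * 1))) hst (by fun_prop)
    (fun x hx => by
      refine (((((hD x hx).pow 2).add ((hD₁ x hx).pow 2)).add_const (e ^ 2)).mul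
        (((hasDerivAt_id x).const_mul K).exp)).congr_deriv ?_
      simp)
    (fun x hx => by
      have hxα : α ≤ x := hs.trans hx.1.le
      have h1 := hG x hx
      have h2 : D₁ x * (D₁ x / x) ≤ D₁ x ^ 2 * (1 / α) := by
        rw [← mul_div_assoc, ← sq, div_eq_mul_one_div]
        exact mul_le_mul_of_nonneg_left (one_div_le_one_div_of_le hα hxα) (sq_nonneg _)
      have h3 : 2 * D₁ x * G x ≤ 2 * |D₁ x| * (C * |D x| + e) := by
        refine (le_abs_self _).trans ?_
        rw [abs_mul, abs_mul, abs_two]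
        gcongr
      have h4 : -(D x ^ 2 + D₁ x ^ 2) ≤ 2 * D x * D₁ x := by nlinarith [sq_nonneg (D x + D₁ x)]
      have h5 : 2 * |D₁ x| * |D x| ≤ D₁ x ^ 2 + D x ^ 2 := by
        have := two_mul_le_add_sq |D₁ x| |D x|
        rwa [sq_abs, sq_abs] at this
      have h6 : 2 * |D₁ x| * e ≤ D₁ x ^ 2 + e ^ 2 := by
        have := two_mul_le_add_sq |D₁ x| e
        rwa [sq_abs] at this
      have h7 := mul_le_mul_of_nonneg_left h5 hC
      have h8 : 0 ≤ C * e ^ 2 := by positivity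
      have h11 : 0 ≤ 1 / α := by positivity
      have h9 : 0 ≤ K * (D x ^ 2 + D₁ x ^ 2 + e ^ 2) +
          (2 * D x * D₁ x + 2 * D₁ x * (-(D₁ x / x) - G x)) := by
        have h12 : 0 ≤ 1 / α * (D x ^ 2 + e ^ 2) := by positivity
        have h13 : K = 2 + C + 2 * (1 / α) := by rw [hK]; ring
        rw [h13]
        nlinarith [sq_nonneg (D x), sq_nonneg e]
      have h10 := mul_nonneg h9 (Real.exp_pos (K * x)).le
      linarith)
  have h1 : D s ^ 2 + D₁ s ^ 2 + e ^ 2 ≤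
      (D t ^ 2 + D₁ t ^ 2 + e ^ 2) * Real.exp (K * (t - s)) := by
    have := mul_le_mul_of_nonneg_right hmono (Real.exp_pos (-(K * s))).le
    rw [mul_assoc, mul_assoc, ← Real.exp_add, ← Real.exp_add] at this
    rw [show K * s + -(K * s) = 0 by ring, Real.exp_zero, mul_one,
      show K * t + -(K * s) = K * (t - s) by ring] at this
    exact this
  linarith [sq_nonneg e]

/-! ### The norms -/

theorem cNorm_one_le {g g₁ : ℝ → ℝ} {s t e : ℝ} (hst : s < t)
    (h1 : ∀ x ∈ Icc s t, HasDerivWithinAt g (g₁ x) (Icc s t) x)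
    (b0 : ∀ x ∈ Icc s t, |g x| ≤ e) (b1 : ∀ x ∈ Icc s t, |g₁ x| ≤ e) :
    cNorm 1 s t g ≤ ENNReal.ofReal (2 * e) := by
  have he : 0 ≤ e := (abs_nonneg _).trans (b0 s (left_mem_Icc.2 hst.le))
  have key : ∀ {k : ℝ → ℝ}, (∀ x ∈ Icc s t, |k x| ≤ e) →
      ⨆ x ∈ Icc s t, ‖k x‖ₑ ≤ ENNReal.ofReal e := fun hk =>
    iSup₂_le fun x hx => by
      rw [Real.enorm_eq_ofReal_abs]
      exact ENNReal.ofReal_le_ofReal (hk x hx)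
  rw [cNorm, Finset.sum_range_succ, Finset.sum_range_one, two_mul, ENNReal.ofReal_add he he]
  refine add_le_add (key fun x hx => ?_) (key fun x hx => ?_)
  · rw [iteratedDerivWithin_zero]; exact b0 x hx
  · rw [iteratedDerivWithin_one, (h1 x hx).derivWithin (uniqueDiffOn_Icc hst x hx)]
    exact b1 x hx

theorem cNorm_two_le {g g₁ g₂ : ℝ → ℝ} {s t e : ℝ} (hst : s < t)
    (h1 : ∀ x ∈ Icc s t, HasDerivAt g (g₁ x) x) (h2 : ∀ x ∈ Icc s t, HasDerivAt g₁ (g₂ x) x)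
    (b0 : ∀ x ∈ Icc s t, |g x| ≤ e) (b1 : ∀ x ∈ Icc s t, |g₁ x| ≤ e)
    (b2 : ∀ x ∈ Icc s t, |g₂ x| ≤ e) :
    cNorm 2 s t g ≤ ENNReal.ofReal (3 * e) := by
  have he : 0 ≤ e := (abs_nonneg _).trans (b0 s (left_mem_Icc.2 hst.le))
  have hc := cNorm_one_le hst (fun x hx => (h1 x hx).hasDerivWithinAt) b0 b1
  rw [cNorm] at hc ⊢
  rw [Finset.sum_range_succ, show 3 * e = 2 * e + e by ring,
    ENNReal.ofReal_add (by positivity) he]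
  refine add_le_add hc (iSup₂_le fun x hx => ?_)
  have hu := uniqueDiffOn_Icc hst
  have e1 : ∀ y ∈ Icc s t, derivWithin g (Icc s t) y = g₁ y := fun y hy =>
    (h1 y hy).hasDerivWithinAt.derivWithin (hu y hy)
  rw [iteratedDerivWithin_succ, Real.enorm_eq_ofReal_abs, derivWithin_congr (f := g₁)
    (fun y hy => by rw [iteratedDerivWithin_one]; exact e1 y hy)
    (by rw [iteratedDerivWithin_one]; exact e1 x hx),
    (h2 x hx).hasDerivWithinAt.derivWithin (hu x hx)]
  exact ENNReal.ofReal_le_ofReal (b2 x hx)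

/-! ### Rescaled solutions -/

/-- The derivative of the rescaled function `rescaled p m γ u`. -/
noncomputable def rescaledDeriv (p m γ : ℝ) (u : ℝ → ℝ) (x : ℝ) : ℝ :=
  p * m ^ (p - 1) * (γ * derivWithin u (Icc 0 1) (γ * x))

theorem mul_rescaledDeriv (p m γ : ℝ) (u : ℝ → ℝ) (x : ℝ) :
    x * rescaledDeriv p m γ u x = -(p * m ^ (p - 1) * flux u (γ * x)) := by
  unfold rescaledDeriv flux
  ring

namespace IsRadialSolution

variable {p : ℝ} {h : ℝ → ℝ} {lam mu : ℝ} {u : ℝ → ℝ}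

theorem hasDerivAt_rescaled (hu : IsRadialSolution p h lam mu u) (m : ℝ) {γ x : ℝ}
    (hx : γ * x ∈ Ioo (0 : ℝ) 1) :
    HasDerivAt (rescaled p m γ u) (rescaledDeriv p m γ u x) x := by
  have h1 : HasDerivAt (fun x => γ * x) (γ * 1) x := (hasDerivAt_id x).const_mul γ
  have h2 := (((hu.hasDerivAt hx).comp x h1).sub_const m).const_mul (p * m ^ (p - 1))
  refine h2.congr_deriv ?_
  simp only [rescaledDeriv]
  ring

theorem hasDerivAt_rescaledDeriv (hu : IsRadialSolution p h lam mu u) {m γ x : ℝ} (hγ : 0 < γ)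
    (hscale : γ ^ 2 * (p * lam * m ^ (p - 1) * nonlin p h m) = 1)
    (hx : γ * x ∈ Ioo (0 : ℝ) 1) :
    HasDerivAt (rescaledDeriv p m γ u)
      (-(rescaledDeriv p m γ u x / x) - nonlin p h (u (γ * x)) / nonlin p h m) x := by
  have h1 : HasDerivAt (fun x => γ * x) (γ * 1) x := (hasDerivAt_id x).const_mul γ
  have h2 := (((hu.hasDerivAt_derivWithin hx).comp x h1).const_mul γ).const_mul
    (p * m ^ (p - 1))
  refine h2.congr_deriv ?_
  have hf : nonlin p h m ≠ 0 := fun h0 => by simp [h0] at hscale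
  have hx0 : x ≠ 0 := fun h0 => by simp [h0] at hx
  have h3 : nonlin p h (u (γ * x)) / nonlin p h m =
      γ ^ 2 * (p * lam * m ^ (p - 1)) * nonlin p h (u (γ * x)) := by
    rw [div_eq_iff hf]
    calc nonlin p h (u (γ * x)) = γ ^ 2 * (p * lam * m ^ (p - 1) * nonlin p h m) *
          nonlin p h (u (γ * x)) := by rw [hscale, one_mul]
      _ = _ := by ring
  rw [h3]
  unfold rescaledDeriv
  field_simp

end IsRadialSolution

/-! ### Convergence to the singular profile -/

/-- On windows `[r/R, rR]` around the centre the flux stays bounded, uniformly in `R`. -/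
theorem IsNeckState.eventually_window {p : ℝ} {h : ℝ → ℝ} {lam mu : ℕ → ℝ} {u : ℕ → ℝ → ℝ}
    (hb : IsBlowup p h lam mu u) {d a R : ℝ} {s r : ℕ → ℝ} (hd : 0 < d) (ha : 0 < a) (ha2 : a < 2)
    (hs : IsNeckState p h lam mu u d (2 - a) s) (hr : ∀ n, r n ∈ Ioo (0 : ℝ) 1)
    (hvr : Tendsto (fun n => u n (r n) / mu n) atTop (𝓝 d))
    (hsr : Tendsto (fun n => s n / r n) atTop (𝓝 0)) (hR : 1 < R) :
    ∀ᶠ n in atTop, s n < r n / R ∧ r n * R < 1 ∧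
      p * u n (r n) ^ (p - 1) * flux (u n) (r n * R) ≤ 6 * 2 ^ (p - 1) := by
  have hp := hb.exponent
  have hh := hb.growth
  have hp0 : 0 < p := by linarith
  have hR0 : 0 < R := by linarith
  have hHs : Tendsto (fun n => hamiltonian p h (lam n) (u n) (s n)) atTop (𝓝 (a ^ 2 / 2)) := by
    have := (((hs.flux_tendsto.const_sub 2).pow 2).div_const 2).add hs.density_tendsto
    simpa [hamiltonian] using this
  have hH2 : a ^ 2 / 2 < 2 := by nlinarith
  obtain ⟨κ, hκ, T, hT, hA⟩ := exists_adiabatic hp hh hb.sub one_pos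
  set k := max κ (1 / 2) with hk
  have hk0 : 0 < k := hκ.1.trans_le (le_max_left _ _)
  have hk1 : k < 1 := max_lt hκ.2 (by norm_num)
  have hk2 : 1 / 2 ≤ k := le_max_right _ _
  -- the loss of height from `u(r)` to `k u(s)` takes logarithmic time of order `μ^p`
  have hlim : ∀ᶠ n in atTop, 0 < (u n (r n) / mu n - k * (u n (s n) / mu n)) *
      (p * k ^ (p - 1) * (u n (s n) ^ (p - 1) / mu n ^ (p - 1))) - 6 * Real.log R / mu n ^ p := by
    have h1 := ((hvr.sub (hs.value_tendsto.const_mul k)).mul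
      ((hb.tendsto_rpow_div (q := p - 1) hd hs.value_tendsto).const_mul (p * k ^ (p - 1)))).sub
      (tendsto_const_nhds.div_atTop (hb.rpow_tendsto hp0) :
        Tendsto (fun n => 6 * Real.log R / mu n ^ p) atTop (𝓝 0))
    refine h1.eventually (lt_mem_nhds ?_)
    have h2 : 0 < k ^ (p - 1) := Real.rpow_pos_of_pos hk0 _
    have h3 : 0 < d ^ (p - 1) := Real.rpow_pos_of_pos hd _
    have h4 : 0 < d - k * d := by nlinarith
    rw [sub_zero]
    positivity
  have hur : ∀ᶠ n in atTop, k * u n (s n) < u n (r n) := by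
    have h1 := hvr.sub (hs.value_tendsto.const_mul k)
    filter_upwards [h1.eventually (lt_mem_nhds (by nlinarith : 0 < d - k * d))] with n hn
    rw [← mul_div_assoc, ← sub_div] at hn
    have := (div_pos_iff_of_pos_right (hb.mu_pos n)).1 hn
    linarith
  filter_upwards [hlim, hur, hHs.eventually (gt_mem_nhds (by linarith : a ^ 2 / 2 < 3)),
    (hb.value_atTop hd hs.value_tendsto).eventually_ge_atTop (T / k),
    hsr.eventually (gt_mem_nhds (by positivity : 0 < 1 / R))] with n h1 h2 h3 h4 h5
  have hu := hb.sol n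
  obtain ⟨hs0, hs1⟩ := hs.mem n
  obtain ⟨hr0, hr1⟩ := hr n
  rw [div_lt_div_iff₀ hr0 hR0, one_mul] at h5
  have hsR : s n < r n / R := by rwa [lt_div_iff₀ hR0]
  have hrR : r n / R ≤ r n := div_le_self hr0.le hR.le
  have hus0 := hu.pos _ (hs.mem n)
  have hur0 := hu.pos _ (hr n)
  have husr := hu.le_of_le hh hs0.le (hsR.le.trans hrR) hr1.le
  rw [div_le_iff₀ hk0, mul_comm] at h4
  obtain ⟨t, ht, hut⟩ := hu.exists_eq hs0.le hs1.le (mul_pos hk0 hus0) (by nlinarith)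
  have hadi := hA hu hs0.le ht.2.le (hut ▸ h4)
    (by rw [hut]; exact mul_le_mul_of_nonneg_right (le_max_left _ _) hus0.le) h3.le
  have hrt : r n < t := by
    by_contra hc
    have := hu.le_of_le hh (hs0.le.trans ht.1.le) (not_lt.1 hc) hr1.le
    linarith
  have hRt : r n * R < t := by
    by_contra hc
    have hlog : Real.log t - Real.log (r n) ≤ Real.log R := by
      have := Real.log_le_log (hr0.trans hrt) (not_lt.1 hc)
      rw [Real.log_mul hr0.ne' hR0.ne'] at this
      linarith
    have hdrop := (hu.drop_bounds hh hr0 hrt.le ht.2.le).2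
    have hq := (hadi t (right_mem_Icc.2 ht.1.le)).1
    have hw := hu.flux_nonneg hh (r := t) ⟨(hs0.trans ht.1).le, ht.2.le⟩
    have hkp : 0 < p * u n t ^ (p - 1) :=
      mul_pos hp0 (Real.rpow_pos_of_pos (hu.pos t ⟨hs0.trans ht.1, ht.2⟩) _)
    have h6 : (u n (r n) - u n t) * (p * u n t ^ (p - 1)) ≤ 6 * Real.log R :=
      calc (u n (r n) - u n t) * (p * u n t ^ (p - 1))
          ≤ flux (u n) t * Real.log R * (p * u n t ^ (p - 1)) :=
            mul_le_mul_of_nonneg_right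
              (hdrop.trans (mul_le_mul_of_nonneg_left hlog hw)) hkp.le
        _ = scaledFlux p (u n) t * Real.log R := by unfold scaledFlux; ring
        _ ≤ _ := mul_le_mul_of_nonneg_right hq (Real.log_nonneg hR.le)
    rw [hut, Real.mul_rpow hk0.le hus0.le] at h6
    have hm := hb.mu_pos n
    have hm1 : 0 < mu n ^ (p - 1) := Real.rpow_pos_of_pos hm _
    have hmp : mu n ^ p = mu n ^ (p - 1) * mu n := by
      rw [Real.rpow_sub_one hm.ne']; field_simp
    have e : (u n (r n) / mu n - k * (u n (s n) / mu n)) *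
        (p * k ^ (p - 1) * (u n (s n) ^ (p - 1) / mu n ^ (p - 1))) - 6 * Real.log R / mu n ^ p =
        ((u n (r n) - k * u n (s n)) * (p * (k ^ (p - 1) * u n (s n) ^ (p - 1))) -
          6 * Real.log R) / mu n ^ p := by
      rw [hmp]; field_simp
    rw [e] at h1
    have := (div_pos_iff_of_pos_right (Real.rpow_pos_of_pos hm _)).1 h1
    linarith
  refine ⟨hsR, hRt.trans ht.2, ?_⟩
  have hR1 : r n ≤ r n * R := le_mul_of_one_le_right hr0.le hR.le
  have hRI : r n * R ∈ Icc (0 : ℝ) 1 := ⟨hr0.le.trans hR1, (hRt.trans ht.2).le⟩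
  have hq := (hadi (r n * R) ⟨(hsR.le.trans hrR).trans hR1, hRt.le⟩).1
  have huR := hu.le_of_le hh hRI.1 hRt.le ht.2.le
  have hle : u n (r n) ≤ 2 * u n (r n * R) := by
    rw [hut] at huR
    nlinarith
  have huR0 := hu.nonneg hRI
  have h7 : u n (r n) ^ (p - 1) ≤ 2 ^ (p - 1) * u n (r n * R) ^ (p - 1) := by
    rw [← Real.mul_rpow (by norm_num) huR0]
    exact Real.rpow_le_rpow hur0.le hle (by linarith)
  have hw := hu.flux_nonneg hh hRI
  have h2p : (0 : ℝ) < 2 ^ (p - 1) := Real.rpow_pos_of_pos (by norm_num) _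
  calc p * u n (r n) ^ (p - 1) * flux (u n) (r n * R)
      ≤ p * (2 ^ (p - 1) * u n (r n * R) ^ (p - 1)) * flux (u n) (r n * R) := by gcongr
    _ = scaledFlux p (u n) (r n * R) * 2 ^ (p - 1) := by unfold scaledFlux; ring
    _ ≤ _ := mul_le_mul_of_nonneg_right hq h2p.le

/-- In the scale of the bubble its centre converges to `a / √2`. -/
theorem tendsto_center_div_scale {p : ℝ} {h : ℝ → ℝ} {lam : ℕ → ℝ} {u : ℕ → ℝ → ℝ} {a : ℝ}
    {r γ : ℕ → ℝ} (ha : 0 < a) (hr : ∀ n, 0 < r n)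
    (hX : Tendsto (fun n => density p h (lam n) (u n) (r n)) atTop (𝓝 (a ^ 2 / 2)))
    (hγ : ∀ n, 0 < γ n)
    (hscale : ∀ n, γ n ^ 2 * (p * lam n * u n (r n) ^ (p - 1) * nonlin p h (u n (r n))) = 1) :
    Tendsto (fun n => r n / γ n) atTop (𝓝 (a / √2)) := by
  have h1 := hX.sqrt
  rw [Real.sqrt_div (by positivity), Real.sqrt_sq ha.le] at h1
  refine h1.congr fun n => ?_
  have h2 : density p h (lam n) (u n) (r n) = (r n / γ n) ^ 2 := by
    rw [div_pow, eq_div_iff (pow_ne_zero 2 (hγ n).ne')]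
    calc density p h (lam n) (u n) (r n) * γ n ^ 2 = r n ^ 2 *
          (γ n ^ 2 * (p * lam n * u n (r n) ^ (p - 1) * nonlin p h (u n (r n)))) := by
            unfold density; ring
      _ = r n ^ 2 := by rw [hscale, mul_one]
  rw [h2, Real.sqrt_sq (div_pos (hr n) (hγ n)).le]

/-- Closeness, on the window `[r/R, rR]`, of the rescaled solution, its derivative and the rescaled
right-hand side to those of the singular profile. -/
def IsCloseToProfile (p : ℝ) (h : ℝ → ℝ) (u : ℝ → ℝ) (a r R γ η : ℝ) : Prop :=
  ∀ x ∈ Icc (r / R / γ) (r * R / γ),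
    |rescaled p (u r) γ u x - singularProfile a x| ≤ η ∧
    |rescaledDeriv p (u r) γ u x - -profileFlux a x / x| ≤ η ∧
    |nonlin p h (u (γ * x)) / nonlin p h (u r) - Real.exp (singularProfile a x)| ≤ η

set_option maxHeartbeats 800000 in
/-- Convergence to the singular profile on windows around the centre: the data at the centre agree
in the limit, and the energy estimates propagate this in both directions. -/
theorem IsNeckState.eventually_close {p : ℝ} {h : ℝ → ℝ} {lam mu : ℕ → ℝ} {u : ℕ → ℝ → ℝ}
    (hb : IsBlowup p h lam mu u) {d a R η : ℝ} {s r γ : ℕ → ℝ} (hd : 0 < d) (ha : 0 < a)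
    (ha2 : a < 2)
    (hs : IsNeckState p h lam mu u d (2 - a) s) (hr : ∀ n, r n ∈ Ioo (0 : ℝ) 1)
    (hvr : Tendsto (fun n => u n (r n) / mu n) atTop (𝓝 d))
    (hsr : Tendsto (fun n => s n / r n) atTop (𝓝 0))
    (hX : Tendsto (fun n => density p h (lam n) (u n) (r n)) atTop (𝓝 (a ^ 2 / 2)))
    (hq : ∀ᶠ n in atTop, scaledFlux p (u n) (r n) = 2)
    (hγ : ∀ n, 0 < γ n)
    (hscale : ∀ n, γ n ^ 2 * (p * lam n * u n (r n) ^ (p - 1) * nonlin p h (u n (r n))) = 1)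
    (hR : 1 < R) (hη : 0 < η) :
    ∀ᶠ n in atTop, IsCloseToProfile p h (u n) a (r n) R (γ n) η := by
  have hp := hb.exponent
  have hh := hb.growth
  have hp0 : 0 < p := by linarith
  have hR0 : 0 < R := by linarith
  have hlogR : 0 < Real.log R := Real.log_pos hR
  set c := a / √2 with hc
  have hc0 : 0 < c := by positivity
  set α := c / (2 * R) with hα
  have hα0 : 0 < α := by positivity
  set β := 2 * c * R with hβ
  have hβ0 : 0 < β := by positivity
  have hx0 : Tendsto (fun n => r n / γ n) atTop (𝓝 c) :=
    tendsto_center_div_scale ha (fun n => (hr n).1) hX hγ hscale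
  -- bounds on the window
  have hcZ : ContinuousOn (singularProfile a) (Icc α β) := fun x hx =>
    (hasDerivAt_singularProfile ha (hα0.trans_le hx.1)).continuousAt.continuousWithinAt
  obtain ⟨B₁, hB₁⟩ := (isCompact_Icc.image_of_continuousOn hcZ).bddAbove
  set B₀ := 6 * 2 ^ (p - 1) * Real.log R with hB₀
  have h2p : (0 : ℝ) < 2 ^ (p - 1) := Real.rpow_pos_of_pos (by norm_num) _
  have hB₀0 : 0 < B₀ := by positivity
  set B := max B₀ B₁ with hB
  set L := Real.exp B with hL
  have hL0 : 0 < L := Real.exp_pos _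
  set K := 2 + L + 2 / α with hK
  have hK0 : 0 < K := by positivity
  set η' := min η (η / (2 * L)) with hη'
  have hη'0 : 0 < η' := lt_min hη (by positivity)
  set w := η' * Real.exp (-(K * β) / 2) / 2 with hw
  have hw0 : 0 < w := by positivity
  set e := min (η / 2) w with he
  have he0 : 0 < e := lt_min (by positivity) hw0
  have hw2 : 2 * w ^ 2 * Real.exp (K * β) ≤ η' ^ 2 := by
    have h1 : w ^ 2 = η' ^ 2 * Real.exp (-(K * β)) / 4 := by
      rw [hw, div_pow, mul_pow, ← Real.exp_nat_mul]
      norm_num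
      left
      ring
    rw [h1]
    have h2 : Real.exp (-(K * β)) * Real.exp (K * β) = 1 := by
      rw [← Real.exp_add]; simp
    nlinarith [sq_nonneg η']
  obtain ⟨T, hT⟩ := exists_nonlin_ratio hp hh hb.sub hB₀0 he0
  -- the data at the centre
  have hE0 : Tendsto (fun n => (0 - singularProfile a (r n / γ n)) ^ 2 +
      (-2 / (r n / γ n) - -profileFlux a (r n / γ n) / (r n / γ n)) ^ 2) atTop (𝓝 0) := by
    have h1 := ((hasDerivAt_singularProfile ha hc0).continuousAt.tendsto.comp hx0)
    have h2 := ((hasDerivAt_profileFlux ha hc0).continuousAt.tendsto.comp hx0)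
    have h3 := ((h1.const_sub 0).pow 2).add
      (((tendsto_const_nhds (x := (-2 : ℝ))).div hx0 hc0.ne').sub
        (h2.neg.div hx0 hc0.ne') |>.pow 2)
    simp only [hc] at h3
    rw [singularProfile_center ha, profileFlux_center ha] at h3
    simpa using h3
  filter_upwards [hs.eventually_window hb hd ha ha2 hr hvr hsr hR,
    hx0.eventually (lt_mem_nhds (by linarith : c / 2 < c)),
    hx0.eventually (gt_mem_nhds (by linarith : c < 2 * c)),
    hE0.eventually (gt_mem_nhds (by positivity : 0 < w ^ 2)), hq,
    (hb.value_atTop hd hvr).eventually_ge_atTop T] with n h1 h2 h3 h4 h5 h6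
  have hu := hb.sol n
  obtain ⟨hr0, hr1⟩ := hr n
  have hg := hγ n
  obtain ⟨hfm, hTn⟩ := hT _ h6
  set m := u n (r n) with hm
  have hm0 : 0 < m := hu.pos _ (hr n)
  set x₀ := r n / γ n with hx₀
  have hx₀0 : 0 < x₀ := div_pos hr0 hg
  have hγx₀ : γ n * x₀ = r n := by rw [hx₀]; field_simp
  set D : ℝ → ℝ := fun x => rescaled p m (γ n) (u n) x - singularProfile a x with hD
  set D₁ : ℝ → ℝ := fun x => rescaledDeriv p m (γ n) (u n) x - -profileFlux a x / x with hD₁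
  set G : ℝ → ℝ := fun x =>
    nonlin p h (u n (γ n * x)) / nonlin p h m - Real.exp (singularProfile a x) with hG
  set J := Icc (x₀ / R) (x₀ * R) with hJ
  have hJαβ : ∀ x ∈ J, x ∈ Icc α β := by
    intro x hx
    constructor
    · refine le_trans ?_ hx.1
      rw [hα, ← div_div]
      exact div_le_div_of_nonneg_right h2.le hR0.le
    · refine hx.2.trans ?_
      rw [hβ]
      exact mul_le_mul_of_nonneg_right h3.le hR0.le
  have hJγ : ∀ x ∈ J, γ n * x ∈ Icc (r n / R) (r n * R) := by
    intro x hx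
    have h7 := mul_le_mul_of_nonneg_left hx.1 hg.le
    have h8 := mul_le_mul_of_nonneg_left hx.2 hg.le
    rw [← mul_div_assoc, hγx₀] at h7
    rw [← mul_assoc, hγx₀] at h8
    exact ⟨h7, h8⟩
  have hJ01 : ∀ x ∈ J, γ n * x ∈ Ioo (0 : ℝ) 1 := fun x hx =>
    ⟨(div_pos hr0 hR0).trans_le (hJγ x hx).1, (hJγ x hx).2.trans_lt h1.2.1⟩
  have hJpos : ∀ x ∈ J, 0 < x := fun x hx => (div_pos hx₀0 hR0).trans_le hx.1
  have hzB : ∀ x ∈ J, p * m ^ (p - 1) * |u n (γ n * x) - m| ≤ B₀ := by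
    intro x hx
    have hmp : 0 < m ^ (p - 1) := Real.rpow_pos_of_pos hm0 _
    have hR1 : r n ≤ r n * R := le_mul_of_one_le_right hr0.le hR.le
    have h7 : |u n (γ n * x) - m| ≤ flux (u n) (r n * R) * Real.log R := by
      have hwR := hu.flux_nonneg hh ⟨hr0.le.trans hR1, h1.2.1.le⟩
      obtain ⟨hy0, hy1⟩ := hJ01 x hx
      rcases le_total (γ n * x) (r n) with hle | hle
      · have h8 := (hu.drop_bounds hh hy0 hle hr1.le).2
        have h9 := hu.le_of_le hh hy0.le hle hr1.le
        rw [abs_of_nonneg (sub_nonneg.2 h9)]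
        refine h8.trans (mul_le_mul (hu.flux_le hh hr0.le hR1 h1.2.1.le) ?_
          (sub_nonneg.2 (Real.log_le_log hy0 hle)) hwR)
        have := Real.log_le_log (div_pos hr0 hR0) (hJγ x hx).1
        rw [Real.log_div hr0.ne' hR0.ne'] at this
        linarith
      · have h8 := (hu.drop_bounds hh hr0 hle hy1.le).2
        have h9 := hu.le_of_le hh hr0.le hle hy1.le
        rw [abs_sub_comm, abs_of_nonneg (sub_nonneg.2 h9)]
        refine h8.trans (mul_le_mul (hu.flux_le hh hy0.le (hJγ x hx).2 h1.2.1.le) ?_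
          (sub_nonneg.2 (Real.log_le_log hr0 hle)) hwR)
        have := Real.log_le_log hy0 (hJγ x hx).2
        rw [Real.log_mul hr0.ne' hR0.ne'] at this
        linarith
    calc p * m ^ (p - 1) * |u n (γ n * x) - m|
        ≤ p * m ^ (p - 1) * (flux (u n) (r n * R) * Real.log R) :=
          mul_le_mul_of_nonneg_left h7 (by positivity)
      _ = p * m ^ (p - 1) * flux (u n) (r n * R) * Real.log R := by ring
      _ ≤ B₀ := mul_le_mul_of_nonneg_right h1.2.2 hlogR.le
  have hGb : ∀ x ∈ J, |G x| ≤ L * |D x| + e := by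
    intro x hx
    have h7 := (hTn _ (hzB x hx)).2
    have hz : rescaled p m (γ n) (u n) x ≤ B := by
      refine le_trans ?_ (le_max_left _ _)
      refine le_trans ?_ (hzB x hx)
      have : 0 < m ^ (p - 1) := Real.rpow_pos_of_pos hm0 _
      exact mul_le_mul_of_nonneg_left (le_abs_self _) (by positivity)
    have hZ : singularProfile a x ≤ B :=
      (hB₁ (mem_image_of_mem _ (hJαβ x hx))).trans (le_max_right _ _)
    have h8 := abs_exp_sub_exp_le hz hZ
    have h9 : |G x| ≤ _ := abs_sub_le _ (Real.exp (rescaled p m (γ n) (u n) x)) _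
    unfold rescaled at h8 h9
    simp only [hD, rescaled]
    linarith
  have hdD : ∀ x ∈ J, HasDerivAt D (D₁ x) x := fun x hx =>
    (hu.hasDerivAt_rescaled m (hJ01 x hx)).sub (hasDerivAt_singularProfile ha (hJpos x hx))
  have hdD₁ : ∀ x ∈ J, HasDerivAt D₁ (-(D₁ x / x) - G x) x := by
    intro x hx
    have hsc : γ n ^ 2 * (p * lam n * m ^ (p - 1) * nonlin p h m) = 1 := hscale n
    refine ((hu.hasDerivAt_rescaledDeriv hg hsc (hJ01 x hx)).sub
      (hasDerivAt_deriv_singularProfile ha (hJpos x hx))).congr_deriv ?_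
    simp only [hD₁, hG]
    ring
  have hcenter : D x₀ ^ 2 + D₁ x₀ ^ 2 ≤ w ^ 2 := by
    have e1 : rescaled p m (γ n) (u n) x₀ = 0 := by
      rw [rescaled, hγx₀, hm, sub_self, mul_zero]
    have e2 : rescaledDeriv p m (γ n) (u n) x₀ = -2 / x₀ := by
      rw [eq_div_iff hx₀0.ne', mul_comm, mul_rescaledDeriv, hγx₀]
      rw [scaledFlux] at h5
      rw [h5]
    simp only [hD, hD₁, e1, e2]
    exact h4.le
  have hx₀J : x₀ ∈ J := ⟨div_le_self hx₀0.le hR.le, le_mul_of_one_le_right hx₀0.le hR.le⟩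
  have hexp : ∀ K' l : ℝ, 0 ≤ K' → K' ≤ K → 0 ≤ l → l ≤ β →
      (D x₀ ^ 2 + D₁ x₀ ^ 2 + e ^ 2) * Real.exp (K' * l) ≤ η' ^ 2 := by
    intro K' l hK' hKK hl hlβ
    have he2 : e ^ 2 ≤ w ^ 2 := pow_le_pow_left₀ he0.le (min_le_right _ _) 2
    have h7 : K' * l ≤ K * β := mul_le_mul hKK hlβ hl hK0.le
    refine le_trans (mul_le_mul (by linarith : _ ≤ 2 * w ^ 2) (Real.exp_le_exp.2 h7)
      (Real.exp_pos _).le (by positivity)) hw2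
  have hE : ∀ x ∈ J, D x ^ 2 + D₁ x ^ 2 ≤ η' ^ 2 := by
    intro x hx
    have hxβ := (hJαβ x hx).2
    have hx₀β := (hJαβ x₀ hx₀J).2
    rcases le_total x₀ x with hle | hle
    · have hsubJ : Icc x₀ x ⊆ J := Icc_subset_Icc hx₀J.1 hx.2
      refine (stability_forward hL0.le hx₀0.le hle
        (fun y hy => (hdD y (hsubJ hy)).continuousAt.continuousWithinAt)
        (fun y hy => (hdD₁ y (hsubJ hy)).continuousAt.continuousWithinAt)
        (fun y hy => hdD y (hsubJ (Ioo_subset_Icc_self hy)))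
        (fun y hy => hdD₁ y (hsubJ (Ioo_subset_Icc_self hy)))
        (fun y hy => hGb y (hsubJ (Ioo_subset_Icc_self hy)))).trans
        (hexp _ _ (by positivity) ?_ (by linarith) (by linarith))
      have : 0 < 2 / α := by positivity
      linarith
    · have hsubJ : Icc x x₀ ⊆ J := Icc_subset_Icc hx.1 hx₀J.2
      have hx0 := hJpos x hx
      exact (stability_backward hL0.le hα0 (hJαβ x hx).1 hle
        (fun y hy => (hdD y (hsubJ hy)).continuousAt.continuousWithinAt)
        (fun y hy => (hdD₁ y (hsubJ hy)).continuousAt.continuousWithinAt)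
        (fun y hy => hdD y (hsubJ (Ioo_subset_Icc_self hy)))
        (fun y hy => hdD₁ y (hsubJ (Ioo_subset_Icc_self hy)))
        (fun y hy => hGb y (hsubJ (Ioo_subset_Icc_self hy)))).trans
        (hexp _ _ hK0.le le_rfl (by linarith) (by linarith))
  intro x hx
  have hxJ : x ∈ J := by
    rw [hJ, hx₀]
    rw [div_right_comm, mul_div_right_comm] at hx
    exact hx
  have h7 := hE x hxJ
  have h8 : |D x| ≤ η' := abs_le_of_sq_le_sq (by nlinarith [sq_nonneg (D₁ x)]) hη'0.le
  have h9 : |D₁ x| ≤ η' := abs_le_of_sq_le_sq (by nlinarith [sq_nonneg (D x)]) hη'0.le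
  refine ⟨h8.trans (min_le_left _ _), h9.trans (min_le_left _ _), (hGb x hxJ).trans ?_⟩
  have h10 : η' * (2 * L) ≤ η := (le_div_iff₀ (by positivity)).1 (min_le_right _ _)
  have h11 : e ≤ η / 2 := min_le_left _ _
  nlinarith [mul_le_mul_of_nonneg_left h8 hL0.le]

/-! ### The bubble and the following neck -/

theorem tendsto_value_center_window {p : ℝ} {h : ℝ → ℝ} {lam mu : ℕ → ℝ} {u : ℕ → ℝ → ℝ}
    (hb : IsBlowup p h lam mu u) {d C R : ℝ} {r : ℕ → ℝ} (hd : 0 < d) (hR : 1 < R)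
    (hr : ∀ n, r n ∈ Ioo (0 : ℝ) 1)
    (hvr : Tendsto (fun n => u n (r n) / mu n) atTop (𝓝 d))
    (hw : ∀ᶠ n in atTop, r n * R < 1 ∧ p * u n (r n) ^ (p - 1) * flux (u n) (r n * R) ≤ C) :
    Tendsto (fun n => u n (r n * R) / mu n) atTop (𝓝 d) := by
  have hp := hb.exponent
  have hp0 : 0 < p := by linarith
  have hur := hb.value_atTop hd hvr
  have h0 : Tendsto (fun n => u n (r n) / mu n -
      C * Real.log R / (p * (u n (r n) ^ (p - 1) * mu n))) atTop (𝓝 d) := by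
    have h1 : Tendsto (fun n => p * (u n (r n) ^ (p - 1) * mu n)) atTop atTop :=
      (((tendsto_rpow_atTop (by linarith : 0 < p - 1)).comp hur).atTop_mul_atTop₀
        hb.mu_tendsto).const_mul_atTop hp0
    have h2 := hvr.sub ((tendsto_const_nhds (x := C * Real.log R)).div_atTop h1)
    rwa [sub_zero] at h2
  refine tendsto_of_tendsto_of_tendsto_of_le_of_le' h0 hvr ?_ ?_
  · filter_upwards [hw] with n h1
    have hu := hb.sol n
    obtain ⟨hr0, hr1⟩ := hr n
    have hRr : r n ≤ r n * R := le_mul_of_one_le_right hr0.le hR.le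
    have h2 := (hu.drop_bounds hb.growth hr0 hRr h1.1.le).2
    rw [Real.log_mul hr0.ne' (by linarith), add_sub_cancel_left] at h2
    have hup : 0 < u n (r n) ^ (p - 1) := Real.rpow_pos_of_pos (hu.pos _ (hr n)) _
    have hm := hb.mu_pos n
    have h3 := mul_le_mul_of_nonneg_right h1.2 (Real.log_nonneg hR.le)
    have e : u n (r n) / mu n - C * Real.log R / (p * (u n (r n) ^ (p - 1) * mu n)) =
      (u n (r n) - C * Real.log R / (p * u n (r n) ^ (p - 1))) / mu n := by
      field_simp
    rw [e]
    refine div_le_div_of_nonneg_right ?_ hm.le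
    have h4 : flux (u n) (r n * R) * Real.log R ≤ C * Real.log R / (p * u n (r n) ^ (p - 1)) := by
      rw [le_div_iff₀ (by positivity)]
      linarith
    linarith
  · filter_upwards [hw] with n h1
    obtain ⟨hr0, hr1⟩ := hr n
    exact div_le_div_of_nonneg_right ((hb.sol n).le_of_le hb.growth hr0.le
      (le_mul_of_one_le_right hr0.le hR.le) h1.1.le) (hb.mu_pos n).le

/-- Closeness to the profile in the sense of the `C²` norm, the second derivatives being
controlled by the equations. -/
theorem IsRadialSolution.cNorm_two_le {p : ℝ} {h : ℝ → ℝ} {lam mu : ℝ} {u : ℝ → ℝ}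
    (hu : IsRadialSolution p h lam mu u) {a r R γ η α : ℝ} (ha : 0 < a) (hγ : 0 < γ) (hr : 0 < r)
    (hR : 1 < R) (hrR : r * R < 1)
    (hscale : γ ^ 2 * (p * lam * u r ^ (p - 1) * nonlin p h (u r)) = 1)
    (hη : 0 ≤ η) (hα : 0 < α) (hα1 : α ≤ r / R / γ)
    (hc : IsCloseToProfile p h u a r R γ η) :
    cNorm 2 (r / R / γ) (r * R / γ)
      (fun x => rescaled p (u r) γ u x - singularProfile a x) ≤
      ENNReal.ofReal (3 * (η * (1 + 1 / α))) := by
  have hR0 : 0 < R := by linarith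
  have hpos : ∀ x ∈ Icc (r / R / γ) (r * R / γ), 0 < x := fun x hx =>
    (div_pos (div_pos hr hR0) hγ).trans_le hx.1
  have h01 : ∀ x ∈ Icc (r / R / γ) (r * R / γ), γ * x ∈ Ioo (0 : ℝ) 1 := fun x hx => by
    refine ⟨mul_pos hγ (hpos x hx), ?_⟩
    have := (le_div_iff₀ hγ).1 hx.2
    linarith
  have hlt : r / R / γ < r * R / γ := by
    refine div_lt_div_of_pos_right ?_ hγ
    exact (div_lt_self hr hR).trans (lt_mul_of_one_lt_right hr hR)
  have h1α : 0 ≤ 1 / α := by positivity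
  have hηα : 0 ≤ η * (1 / α) := by positivity
  refine _root_.cNorm_two_le hlt
    (g₁ := fun x => rescaledDeriv p (u r) γ u x - -profileFlux a x / x)
    (g₂ := fun x => -((rescaledDeriv p (u r) γ u x - -profileFlux a x / x) / x) -
      (nonlin p h (u (γ * x)) / nonlin p h (u r) - Real.exp (singularProfile a x)))
    (fun x hx => (hu.hasDerivAt_rescaled _ (h01 x hx)).sub
      (hasDerivAt_singularProfile ha (hpos x hx)))
    (fun x hx => by
      refine ((hu.hasDerivAt_rescaledDeriv hγ hscale (h01 x hx)).sub
        (hasDerivAt_deriv_singularProfile ha (hpos x hx))).congr_deriv ?_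
      ring) (fun x hx => (hc x hx).1.trans (by nlinarith))
    (fun x hx => (hc x hx).2.1.trans (by nlinarith)) (fun x hx => ?_)
  obtain ⟨-, h2, h3⟩ := hc x hx
  have h4 : |(rescaledDeriv p (u r) γ u x - -profileFlux a x / x) / x| ≤ η * (1 / α) := by
    rw [abs_div, abs_of_pos (hpos x hx), div_eq_mul_one_div]
    exact mul_le_mul h2 (one_div_le_one_div_of_le hα (hα1.trans hx.1))
      (one_div_pos.2 (hpos x hx)).le hη
  refine (abs_sub _ _).trans ?_
  rw [abs_neg]
  linarith

/-- Before a bubble, a neck state with `q → 2 - a`: then there is a bubble centre, and the window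
around it can be widened slowly so that it exhausts the bubble. -/
theorem IsNeckState.exists_window {p : ℝ} {h : ℝ → ℝ} {lam mu : ℕ → ℝ} {u : ℕ → ℝ → ℝ}
    (hb : IsBlowup p h lam mu u) {d a : ℝ} {s r γ : ℕ → ℝ} (hd : 0 < d) (ha : 0 < a) (ha2 : a < 2)
    (hs : IsNeckState p h lam mu u d (2 - a) s) (hr : ∀ n, r n ∈ Ioo (0 : ℝ) 1)
    (hvr : Tendsto (fun n => u n (r n) / mu n) atTop (𝓝 d))
    (hsr : Tendsto (fun n => s n / r n) atTop (𝓝 0))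
    (hX : Tendsto (fun n => density p h (lam n) (u n) (r n)) atTop (𝓝 (a ^ 2 / 2)))
    (hq : ∀ᶠ n in atTop, scaledFlux p (u n) (r n) = 2)
    (hγ : ∀ n, 0 < γ n)
    (hscale : ∀ n, γ n ^ 2 * (p * lam n * u n (r n) ^ (p - 1) * nonlin p h (u n (r n))) = 1) :
    ∃ ρbar ρ : ℕ → ℝ, (∀ n, ρbar n ∈ Ioo (0 : ℝ) 1) ∧ (∀ n, ρ n ∈ Ioo (0 : ℝ) 1) ∧
      (∀ᶠ n in atTop, s n ≤ ρbar n ∧ ρbar n ≤ r n ∧ r n ≤ ρ n) ∧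
      Tendsto (fun n => s n / ρbar n) atTop (𝓝 0) ∧
      Tendsto (fun n => ρbar n / r n) atTop (𝓝 0) ∧
      Tendsto (fun n => r n / ρ n) atTop (𝓝 0) ∧
      Tendsto (fun n => u n (ρ n) / mu n) atTop (𝓝 d) ∧
      Tendsto (fun n => p * u n (r n) ^ (p - 1) * flux (u n) (ρbar n)) atTop (𝓝 (2 - a)) ∧
      Tendsto (fun n => p * u n (r n) ^ (p - 1) * flux (u n) (ρ n)) atTop (𝓝 (2 + a)) ∧
      Tendsto (fun n => cNorm 2 (ρbar n / γ n) (ρ n / γ n)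
        (fun x => rescaled p (u n (r n)) (γ n) (u n) x - singularProfile a x)) atTop (𝓝 0) := by
  have hp := hb.exponent
  set c := a / √2 with hc
  have hc0 : 0 < c := by positivity
  have hx0 : Tendsto (fun n => r n / γ n) atTop (𝓝 c) :=
    tendsto_center_div_scale ha (fun n => (hr n).1) hX hγ hscale
  obtain ⟨x, e, hD, he0, he, hP⟩ := exists_diagonal (α := ℝ × ℝ)
    (D := fun n x => x.1 ∈ Ioo (0 : ℝ) 1 ∧ x.2 ∈ Ioo (0 : ℝ) 1)
    (P := fun ε n x => (s n ≤ x.1 ∧ x.1 ≤ r n ∧ r n ≤ x.2) ∧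
      |s n / x.1 - 0| ≤ ε ∧ |x.1 / r n - 0| ≤ ε ∧ |r n / x.2 - 0| ≤ ε ∧
      |u n x.2 / mu n - d| ≤ ε ∧
      |p * u n (r n) ^ (p - 1) * flux (u n) x.1 - (2 - a)| ≤ ε ∧
      |p * u n (r n) ^ (p - 1) * flux (u n) x.2 - (2 + a)| ≤ ε ∧
      cNorm 2 (x.1 / γ n) (x.2 / γ n)
        (fun y => rescaled p (u n (r n)) (γ n) (u n) y - singularProfile a y) ≤ ENNReal.ofReal ε)
    (fun n => ⟨(1 / 2, 1 / 2), by norm_num⟩) (by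
      intro ε hε
      -- the flux of the profile is almost `2 ± a` at the ends of a long window
      have hinf : ∀ᶠ y in atTop, |profileFlux a y - (2 + a)| < ε / 2 := by
        have := Metric.tendsto_nhds.1 (tendsto_profileFlux ha) (ε / 2) (half_pos hε)
        simpa [Real.dist_eq] using this
      have hzero : ∀ᶠ y in 𝓝 (0 : ℝ), |profileFlux a y - (2 - a)| < ε / 2 := by
        have := Metric.tendsto_nhds.1 (continuousAt_profileFlux_zero ha) (ε / 2) (half_pos hε)
        simpa only [Real.dist_eq, profileFlux_zero ha] using this
      obtain ⟨Y, hY⟩ := eventually_atTop.1 hinf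
      obtain ⟨δ, hδ, hball⟩ := Metric.eventually_nhds_iff.1 hzero
      set R := max 2 (max (1 / ε) (max (2 * Y / c) (4 * c / δ))) with hRdef
      have hR2 : 2 ≤ R := le_max_left _ _
      have hRε : 1 / ε ≤ R := (le_max_left _ _).trans (le_max_right _ _)
      have hRY : 2 * Y / c ≤ R :=
        (le_max_left _ _).trans ((le_max_right _ _).trans (le_max_right _ _))
      have hRδ : 4 * c / δ ≤ R :=
        (le_max_right _ _).trans ((le_max_right _ _).trans (le_max_right _ _))
      have hR1 : 1 < R := by linarith
      have hR0 : 0 < R := by linarith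
      have hRinv : 1 / R ≤ ε := by
        rw [div_le_iff₀ hR0]
        rw [div_le_iff₀ hε] at hRε
        linarith
      set α := c / (2 * R) with hα
      have hα0 : 0 < α := by positivity
      set β := 2 * c * R with hβ
      have hβ0 : 0 < β := by positivity
      set η := min (ε / (2 * β)) (ε / (3 * (1 + 1 / α))) with hη
      have hη0 : 0 < η := lt_min (by positivity) (by positivity)
      have hη1 : β * η ≤ ε / 2 := by
        have := (le_div_iff₀ (by positivity)).1 (min_le_left (ε / (2 * β)) (ε / (3 * (1 + 1 / α))))
        rw [← hη] at this
        linarith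
      have hη2 : 3 * (η * (1 + 1 / α)) ≤ ε := by
        have := (le_div_iff₀ (by positivity)).1 (min_le_right (ε / (2 * β)) (ε / (3 * (1 + 1 / α))))
        rw [← hη] at this
        linarith
      have hwin := hs.eventually_window hb hd ha ha2 hr hvr hsr hR1
      filter_upwards [hwin, hs.eventually_close hb hd ha ha2 hr hvr hsr hX hq hγ hscale hR1 hη0,
        hx0.eventually (lt_mem_nhds (by linarith : c / 2 < c)),
        hx0.eventually (gt_mem_nhds (by linarith : c < 2 * c)),
        eventually_abs_sub_le (tendsto_value_center_window hb hd hR1 hr hvr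
          (hwin.mono fun n hn => hn.2)) hε,
        eventually_abs_sub_le hsr (by positivity : 0 < ε / R)] with n h1 h2 h3 h4 h5 h6
      have hu := hb.sol n
      obtain ⟨hr0, hr1⟩ := hr n
      have hg := hγ n
      obtain ⟨hs0, -⟩ := hs.mem n
      have hRr : r n ≤ r n * R := le_mul_of_one_le_right hr0.le hR1.le
      have hrR : r n / R ≤ r n := div_le_self hr0.le hR1.le
      have hrR0 : 0 < r n / R := div_pos hr0 hR0
      have hlo : α ≤ r n / R / γ n := by
        rw [div_right_comm, hα, ← div_div]
        exact div_le_div_of_nonneg_right h3.le hR0.le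
      have hhi : r n * R / γ n ≤ β := by
        rw [mul_div_right_comm, hβ]
        exact mul_le_mul_of_nonneg_right h4.le hR0.le
      have hle : r n / R / γ n ≤ r n * R / γ n :=
        div_le_div_of_nonneg_right (hrR.trans hRr) hg.le
      have hfl : ∀ y ∈ Icc (r n / R / γ n) (r n * R / γ n),
          |p * u n (r n) ^ (p - 1) * flux (u n) (γ n * y) - profileFlux a y| ≤ ε / 2 := by
        intro y hy
        have hy0 : 0 < y := hα0.trans_le (hlo.trans hy.1)
        have h7 := (h2 y hy).2.1
        have e1 : p * u n (r n) ^ (p - 1) * flux (u n) (γ n * y) - profileFlux a y =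
            -(y * (rescaledDeriv p (u n (r n)) (γ n) (u n) y - -profileFlux a y / y)) := by
          rw [mul_sub, mul_rescaledDeriv]
          field_simp
          ring
        rw [e1, abs_neg, abs_mul, abs_of_pos hy0]
        exact (mul_le_mul (hy.2.trans hhi) h7 (abs_nonneg _) hβ0.le).trans hη1
      refine ⟨(r n / R, r n * R), ⟨⟨hrR0, hrR.trans_lt hr1⟩, ⟨hr0.trans_le hRr, h1.2.1⟩⟩,
        ⟨h1.1.le, hrR, hRr⟩, ?_, ?_, ?_, h5, ?_, ?_, ?_⟩
      · rw [sub_zero, abs_of_pos (div_pos hs0 hr0), le_div_iff₀ hR0] at h6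
        rw [sub_zero, abs_of_pos (div_pos hs0 hrR0), div_div_eq_mul_div, mul_div_right_comm]
        exact h6
      · have e1 : r n / R / r n = 1 / R := by field_simp
        simp only [sub_zero]
        rw [e1, abs_of_pos (by positivity)]
        exact hRinv
      · have e1 : r n / (r n * R) = 1 / R := by field_simp
        simp only [sub_zero]
        rw [e1, abs_of_pos (by positivity)]
        exact hRinv
      · have h7 := hfl _ (left_mem_Icc.2 hle)
        have e1 : γ n * (r n / R / γ n) = r n / R := by field_simp
        rw [e1] at h7
        have h8 : |profileFlux a (r n / R / γ n) - (2 - a)| < ε / 2 := by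
          refine hball ?_
          rw [dist_zero_right, Real.norm_eq_abs, abs_of_pos (hα0.trans_le hlo), div_right_comm,
            div_lt_iff₀ hR0]
          rw [div_le_iff₀ hδ] at hRδ
          nlinarith
        have := abs_sub_le (p * u n (r n) ^ (p - 1) * flux (u n) (r n / R))
          (profileFlux a (r n / R / γ n)) (2 - a)
        simp only
        linarith
      · have h7 := hfl _ (right_mem_Icc.2 hle)
        have e1 : γ n * (r n * R / γ n) = r n * R := by field_simp
        rw [e1] at h7
        have h8 : |profileFlux a (r n * R / γ n) - (2 + a)| < ε / 2 := by
          refine hY _ ?_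
          rw [mul_div_right_comm]
          rw [div_le_iff₀ hc0] at hRY
          nlinarith
        have := abs_sub_le (p * u n (r n) ^ (p - 1) * flux (u n) (r n * R))
          (profileFlux a (r n * R / γ n)) (2 + a)
        simp only
        linarith
      · exact (hu.cNorm_two_le ha hg hr0 hR1 h1.2.1 (hscale n) hη0.le hα0 hlo h2).trans
          (ENNReal.ofReal_le_ofReal hη2))
  refine ⟨fun n => (x n).1, fun n => (x n).2, fun n => (hD n).1, fun n => (hD n).2,
    hP.mono fun n hn => hn.1, tendsto_of_abs_sub_le he (hP.mono fun n hn => hn.2.1),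
    tendsto_of_abs_sub_le he (hP.mono fun n hn => hn.2.2.1),
    tendsto_of_abs_sub_le he (hP.mono fun n hn => hn.2.2.2.1),
    tendsto_of_abs_sub_le he (hP.mono fun n hn => hn.2.2.2.2.1),
    tendsto_of_abs_sub_le he (hP.mono fun n hn => hn.2.2.2.2.2.1),
    tendsto_of_abs_sub_le he (hP.mono fun n hn => hn.2.2.2.2.2.2.1), ?_⟩
  have h0 : Tendsto (fun n => ENNReal.ofReal (e n)) atTop (𝓝 0) := by
    have := ENNReal.tendsto_ofReal he
    rwa [ENNReal.ofReal_zero] at this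
  exact tendsto_of_tendsto_of_tendsto_of_le_of_le' tendsto_const_nhds h0
    (Eventually.of_forall fun n => bot_le) (hP.mono fun n hn => hn.2.2.2.2.2.2.2)

/-- The induction step: from the neck state after one bubble to the next bubble and the neck state
after it. -/
theorem IsNeckState.exists_bubble {p : ℝ} {h : ℝ → ℝ} {lam mu : ℕ → ℝ} {u : ℕ → ℝ → ℝ}
    (hb : IsBlowup p h lam mu u) {d₀ a₀ d a : ℝ} {ρprev : ℕ → ℝ} (hd₀ : 0 < d₀) (ha₀ : 0 < a₀)
    (hprev : IsNeckState p h lam mu u d₀ (2 + a₀) ρprev) (hd : d ∈ Ioo 0 d₀)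
    (ha : a ∈ Ioo (0 : ℝ) 2)
    (hdelta : 2 * p / (2 + a₀) * (1 - d / d₀) - 1 + (d / d₀) ^ p = 0)
    (haeq : a = 2 - (d / d₀) ^ (p - 1) * (2 + a₀)) :
    ∃ r ρbar ρ γ : ℕ → ℝ, IsBubble p h lam mu u a d ρprev r ρbar ρ γ ∧
      IsNeckState p h lam mu u d (2 + a) ρ := by
  have hp := hb.exponent
  have hh := hb.growth
  have hp0 : 0 < p := by linarith
  obtain ⟨hd0, hdd⟩ := hd
  obtain ⟨ha0, ha2⟩ := ha
  obtain ⟨s, hs, hps⟩ := hprev.exists_next hb hd₀ ha₀ ⟨hd0, hdd⟩ hdelta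
  have hQ : (d / d₀) ^ (p - 1) * (2 + a₀) = 2 - a := by linarith
  rw [hQ] at hs
  obtain ⟨r, hr, hsr1, hvr, hX, hsr⟩ := hs.exists_center hb hd0 ha0 ha2
  have hdenpos : ∀ n, 0 < p * lam n * u n (r n) ^ (p - 1) * nonlin p h (u n (r n)) := fun n => by
    have h1 := (hb.sol n).lam_pos
    have h2 : 0 < u n (r n) ^ (p - 1) := Real.rpow_pos_of_pos ((hb.sol n).pos _ (hr n).1) _
    have h3 := (hr n).2
    positivity
  set γ : ℕ → ℝ := fun n => (√(p * lam n * u n (r n) ^ (p - 1) * nonlin p h (u n (r n))))⁻¹ with hγd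
  have hγ : ∀ n, 0 < γ n := fun n => inv_pos.2 (Real.sqrt_pos.2 (hdenpos n))
  have hscale : ∀ n, γ n ^ 2 * (p * lam n * u n (r n) ^ (p - 1) * nonlin p h (u n (r n))) = 1 :=
    fun n => by
      rw [hγd, inv_pow, Real.sq_sqrt (hdenpos n).le, inv_mul_cancel₀ (hdenpos n).ne']
  obtain ⟨ρbar, ρ, hbar, hρ, hord, hsb, hbr, hrρ, hvρ, hfb, hfρ, hC⟩ :=
    hs.exists_window hb hd0 ha0 ha2 (fun n => (hr n).1) hvr hsr hX (hsr1.mono fun n hn => hn.2)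
      hγ hscale
  have hvb : Tendsto (fun n => u n (ρbar n) / mu n) atTop (𝓝 d) := by
    refine tendsto_of_tendsto_of_tendsto_of_le_of_le' hvr hs.value_tendsto ?_ ?_
    · filter_upwards [hord] with n hn
      exact div_le_div_of_nonneg_right ((hb.sol n).le_of_le hh (hbar n).1.le hn.2.1
        (hr n).1.2.le) (hb.mu_pos n).le
    · filter_upwards [hord] with n hn
      exact div_le_div_of_nonneg_right ((hb.sol n).le_of_le hh (hs.mem n).1.le hn.1
        (hbar n).2.le) (hb.mu_pos n).le
  have hdp : 0 < d ^ (p - 1) := Real.rpow_pos_of_pos hd0 _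
  -- pass from the height `u(r)` to `μ` in the flux limits
  have hflux : ∀ {t : ℕ → ℝ} {Q : ℝ},
      Tendsto (fun n => p * u n (r n) ^ (p - 1) * flux (u n) (t n)) atTop (𝓝 Q) →
      Tendsto (fun n => p * mu n ^ (p - 1) * flux (u n) (t n)) atTop (𝓝 (Q / d ^ (p - 1))) := by
    intro t Q ht
    refine (ht.div (hb.tendsto_rpow_div (q := p - 1) hd0 hvr) hdp.ne').congr fun n => ?_
    have h1 : u n (r n) ^ (p - 1) ≠ 0 :=
      (Real.rpow_pos_of_pos ((hb.sol n).pos _ (hr n).1) _).ne'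
    have h2 : mu n ^ (p - 1) ≠ 0 := (Real.rpow_pos_of_pos (hb.mu_pos n) _).ne'
    simp only [Pi.div_apply]
    field_simp
  have hEb := hflux hfb
  have hEρ := hflux hfρ
  have hqρ : Tendsto (fun n => scaledFlux p (u n) (ρ n)) atTop (𝓝 (2 + a)) := by
    have := hb.tendsto_scaledFlux hd0 hvρ hEρ
    rwa [mul_div_cancel₀ _ hdp.ne'] at this
  have hEp := hb.tendsto_mul_flux hd₀ hprev.value_tendsto hprev.flux_tendsto
  have hEeq : (2 + a₀) / d₀ ^ (p - 1) = (2 - a) / d ^ (p - 1) := by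
    rw [← hQ, Real.div_rpow hd0.le hd₀.le]
    field_simp
  have hH2 : a ^ 2 / 2 ≤ 2 := by nlinarith
  have hHs : Tendsto (fun n => hamiltonian p h (lam n) (u n) (s n)) atTop (𝓝 (a ^ 2 / 2)) := by
    have := (((hs.flux_tendsto.const_sub 2).pow 2).div_const 2).add hs.density_tendsto
    simpa [hamiltonian] using this
  have hHρ := hb.tendsto_hamiltonian hd0 (fun n => (hs.mem n).1.le)
    (hord.mono fun n hn => hn.1.trans (hn.2.1.trans hn.2.2))
    (Eventually.of_forall fun n => (hρ n).2.le) hs.value_tendsto hvρ hHs hH2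
  have hXρ : Tendsto (fun n => density p h (lam n) (u n) (ρ n)) atTop (𝓝 0) := by
    have := hHρ.sub (((hqρ.const_sub 2).pow 2).div_const 2)
    rw [show a ^ 2 / 2 - (2 - (2 + a)) ^ 2 / 2 = 0 by ring] at this
    refine this.congr fun n => ?_
    unfold hamiltonian
    ring
  obtain ⟨T, hT⟩ := (eventually_tailBound hp hh hb.sub one_pos).exists
  have hstate : IsNeckState p h lam mu u d (2 + a) ρ := by
    refine ⟨hρ, hvρ, hqρ, hXρ, ?_⟩
    have hlow : Tendsto (fun n => Real.log (density p h (lam n) (u n) (r n)) / mu n ^ p +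
        (p - 1) * (Real.log (u n (ρ n) / mu n / (u n (r n) / mu n)) / mu n ^ p) +
        (Real.log (nonlin p h (u n (ρ n))) / mu n ^ p -
          Real.log (nonlin p h (u n (r n))) / mu n ^ p)) atTop (𝓝 0) := by
      have h1 : Tendsto (fun n => Real.log (density p h (lam n) (u n) (r n)) / mu n ^ p)
          atTop (𝓝 0) := (hX.log (by positivity)).div_atTop (hb.rpow_tendsto hp0)
      have h2 : Tendsto (fun n => Real.log (u n (ρ n) / mu n / (u n (r n) / mu n)) / mu n ^ p)
          atTop (𝓝 0) :=
        ((hvρ.div hvr hd0.ne').log (by rw [div_self hd0.ne']; exact one_ne_zero)).div_atTop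
          (hb.rpow_tendsto hp0)
      have h3 := (hb.tendsto_log_nonlin_div hd0 hvρ).sub (hb.tendsto_log_nonlin_div hd0 hvr)
      have := (h1.add (h2.const_mul (p - 1))).add h3
      simpa using this
    refine tendsto_of_tendsto_of_tendsto_of_le_of_le' hlow tendsto_const_nhds ?_ ?_
    · filter_upwards [hord, (hb.value_atTop hd0 hvρ).eventually_ge_atTop T] with n h1 h2
      have hu := hb.sol n
      have hm := hb.mu_pos n
      have h3 := Real.log_le_log (hr n).1.1 h1.2.2
      rw [div_div_div_cancel_right₀ hm.ne', Real.log_div (hu.pos _ (hρ n)).ne'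
        (hu.pos _ (hr n).1).ne', ← mul_div_assoc, ← sub_div, ← add_div, ← add_div,
        hu.log_density_eq hp (hr n).1 (hr n).2, hu.log_density_eq hp (hρ n) (hT.nonlin_pos h2)]
      refine div_le_div_of_nonneg_right ?_ (Real.rpow_pos_of_pos hm _).le
      linarith
    · filter_upwards [hXρ.eventually (gt_mem_nhds one_pos)] with n h1
      exact div_nonpos_of_nonpos_of_nonneg (Real.log_nonpos
        ((hb.sol n).density_nonneg hp hh (Ioo_subset_Icc_self (hρ n))) h1.le)
        (Real.rpow_pos_of_pos (hb.mu_pos n) _).le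
  have hpb : ∀ᶠ n in atTop, ρprev n ≤ ρbar n := by
    filter_upwards [hps, hord] with n h1 h2 using h1.trans h2.1
  have hneck : Tendsto (fun n => energy p h (lam n) (mu n) (u n) (ρprev n) (ρbar n)) atTop
      (𝓝 0) := by
    have h1 := hEb.sub hEp
    rw [hEeq, sub_self] at h1
    refine h1.congr' ?_
    filter_upwards [hpb] with n hn
    rw [(hb.sol n).energy_eq hp hh (hprev.mem n).1.le hn (hbar n).2.le]
    ring
  have hbub : Tendsto (fun n => energy p h (lam n) (mu n) (u n) (ρbar n) (ρ n)) atTop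
      (𝓝 (2 * a / d ^ (p - 1))) := by
    have h1 := hEρ.sub hEb
    rw [← sub_div, show 2 + a - (2 - a) = 2 * a by ring] at h1
    refine h1.congr' ?_
    filter_upwards [hord] with n hn
    rw [(hb.sol n).energy_eq hp hh (hbar n).1.le (hn.2.1.trans hn.2.2) (hρ n).2.le]
    ring
  have hx0 := tendsto_center_div_scale ha0 (fun n => (hr n).1.1) hX hγ hscale
  have hr0 : Tendsto r atTop (𝓝 0) := by
    refine tendsto_of_tendsto_of_tendsto_of_le_of_le tendsto_const_nhds hrρ
      (fun n => (hr n).1.1.le) fun n => ?_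
    rw [le_div_iff₀ (hρ n).1]
    exact mul_le_of_le_one_right (hr n).1.1.le (hρ n).2.le
  have hγ0 : Tendsto γ atTop (𝓝 0) := by
    have h1 := hr0.div hx0 (by positivity)
    rw [zero_div] at h1
    refine h1.congr fun n => ?_
    have := (hr n).1.1.ne'
    simp only [Pi.div_apply]
    rw [div_div_eq_mul_div, mul_div_cancel_left₀ _ this]
  refine ⟨r, ρbar, ρ, γ, ⟨fun n => (hr n).1, hbar, hρ, hvr, hX, hvρ, hvb, ?_, hbr, hrρ, hγ, hscale,
    hγ0, hC, hneck, hbub, ?_, ?_⟩, hstate⟩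
  · refine tendsto_of_tendsto_of_tendsto_of_le_of_le' tendsto_const_nhds hsb
      (Eventually.of_forall fun n => (div_pos (hprev.mem n).1 (hbar n).1).le) ?_
    filter_upwards [hps] with n hn using div_le_div_of_nonneg_right hn (hbar n).1.le
  · refine tendsto_of_tendsto_of_tendsto_of_le_of_le' tendsto_const_nhds hneck ?_ ?_
    · filter_upwards [hpb] with n hn
      refine le_trans ?_ ((hb.sol n).weightedEnergy_bounds hp hh (hprev.mem n).1.le hn
        (hbar n).2.le).1
      have h1 := (hb.sol n).flux_le hh (hprev.mem n).1.le hn (hbar n).2.le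
      have h2 := Real.rpow_nonneg ((hb.sol n).pos _ (hbar n)).le (p - 1)
      have h3 := sub_nonneg.2 h1
      positivity
    · filter_upwards [hpb] with n hn
      have hu := hb.sol n
      refine (hu.weightedEnergy_bounds hp hh (hprev.mem n).1.le hn (hbar n).2.le).2.trans ?_
      rw [hu.energy_eq hp hh (hprev.mem n).1.le hn (hbar n).2.le]
      refine mul_le_mul_of_nonneg_right (mul_le_mul_of_nonneg_left (Real.rpow_le_rpow
        (hu.pos _ (hprev.mem n)).le (hu.le_mu hh (Ioo_subset_Icc_self (hprev.mem n)))
        (by linarith)) hp0.le)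
        (sub_nonneg.2 (hu.flux_le hh (hprev.mem n).1.le hn (hbar n).2.le))
  · have key : ∀ {v : ℕ → ℝ}, Tendsto (fun n => v n / mu n) atTop (𝓝 d) →
        Tendsto (fun n => p * v n ^ (p - 1) * (flux (u n) (ρ n) - flux (u n) (ρbar n))) atTop
          (𝓝 (2 * a)) := by
      intro v hv
      have h1 := (hb.tendsto_rpow_div (q := p - 1) hd0 hv).mul (hEρ.sub hEb)
      rw [← sub_div, show 2 + a - (2 - a) = 2 * a by ring, mul_div_cancel₀ _ hdp.ne'] at h1
      refine h1.congr fun n => ?_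
      have h2 : mu n ^ (p - 1) ≠ 0 := (Real.rpow_pos_of_pos (hb.mu_pos n) _).ne'
      field_simp
    refine tendsto_of_tendsto_of_tendsto_of_le_of_le' (key hvρ) (key hvb) ?_ ?_
    · filter_upwards [hord] with n hn
      exact ((hb.sol n).weightedEnergy_bounds hp hh (hbar n).1.le (hn.2.1.trans hn.2.2)
        (hρ n).2.le).1
    · filter_upwards [hord] with n hn
      exact ((hb.sol n).weightedEnergy_bounds hp hh (hbar n).1.le (hn.2.1.trans hn.2.2)
        (hρ n).2.le).2

/-! ### The first bubble -/

/-- The derivative `-4x / (8 + x²)` of the regular profile. -/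
theorem hasDerivAt_regularProfile (x : ℝ) :
    HasDerivAt regularProfile (-(4 * x) / (8 + x ^ 2)) x := by
  have h8 : (8 : ℝ) + x ^ 2 ≠ 0 := by positivity
  have h1 := ((hasDerivAt_const x (64 : ℝ)).div (((hasDerivAt_pow 2 x).const_add 8).pow 2)
    (pow_ne_zero 2 h8)).log (show (64 : ℝ) / (8 + x ^ 2) ^ 2 ≠ 0 by positivity)
  refine h1.congr_deriv ?_
  simp only [Pi.pow_apply, Pi.div_apply]
  field_simp
  push_cast
  ring

theorem exp_regularProfile (x : ℝ) : Real.exp (regularProfile x) = 64 / (8 + x ^ 2) ^ 2 :=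
  Real.exp_log (by positivity)

theorem hasDerivAt_deriv_regularProfile {x : ℝ} (hx : x ≠ 0) :
    HasDerivAt (fun x => -(4 * x) / (8 + x ^ 2))
      (-(-(4 * x) / (8 + x ^ 2) / x) - Real.exp (regularProfile x)) x := by
  have h8 : (8 : ℝ) + x ^ 2 ≠ 0 := by positivity
  refine ((((hasDerivAt_id x).const_mul 4).neg).div ((hasDerivAt_pow 2 x).const_add 8)
    h8).congr_deriv ?_
  rw [exp_regularProfile]
  simp only [id, Pi.neg_apply]
  field_simp
  push_cast
  ring

theorem regularProfile_zero : regularProfile 0 = 0 := by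
  norm_num [regularProfile]

theorem regularProfile_nonpos (x : ℝ) : regularProfile x ≤ 0 := by
  refine Real.log_nonpos (by positivity) ?_
  rw [div_le_one (by positivity)]
  nlinarith [sq_nonneg x]

namespace IsRadialSolution

variable {p : ℝ} {h : ℝ → ℝ} {lam mu : ℝ} {u : ℝ → ℝ}

theorem hasDerivWithinAt_rescaled (hu : IsRadialSolution p h lam mu u) (m : ℝ) {γ x : ℝ}
    {s : Set ℝ} (hs : MapsTo (fun x => γ * x) s (Icc 0 1)) (hx : x ∈ s) :
    HasDerivWithinAt (rescaled p m γ u) (rescaledDeriv p m γ u x) s x := by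
  have h1 : HasDerivWithinAt (fun x => γ * x) (γ * 1) s x :=
    ((hasDerivAt_id x).const_mul γ).hasDerivWithinAt
  have h0 := ((hu.contDiffOn.differentiableOn (by norm_num)) (γ * x) (hs hx)).hasDerivWithinAt
  have h2 := ((h0.comp x h1 hs).sub_const m).const_mul (p * m ^ (p - 1))
  refine h2.congr_deriv ?_
  simp only [rescaledDeriv]
  ring

/-- Distance of the rescaled solution to the regular profile, from an error bound for the
nonlinearity. -/
theorem sq_sub_regularProfile_le (hp : 2 < p) (hu : IsRadialSolution p h lam mu u)
    (hh : IsGrowthFactor h) (hmax : ∀ t, 0 ≤ t → t ≤ mu → nonlin p h t ≤ nonlin p h mu)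
    {γ R e : ℝ} (hγ : 0 < γ) (hscale : γ ^ 2 * (p * lam * mu ^ (p - 1) * nonlin p h mu) = 1)
    (hR : γ * R < 1)
    (hf : ∀ v, p * mu ^ (p - 1) * |v - mu| ≤ R ^ 2 / 4 →
      |nonlin p h v / nonlin p h mu - Real.exp (p * mu ^ (p - 1) * (v - mu))| ≤ e)
    {x : ℝ} (hx : x ∈ Icc 0 R) :
    p * mu ^ (p - 1) * (mu - u (γ * x)) ≤ R ^ 2 / 4 ∧
    (rescaled p mu γ u x - regularProfile x) ^ 2 +
      (rescaledDeriv p mu γ u x - -(4 * x) / (8 + x ^ 2)) ^ 2 ≤ e ^ 2 * Real.exp (3 * R) := by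
  have hmu := hu.mu_pos hh
  have hmp : 0 < mu ^ (p - 1) := Real.rpow_pos_of_pos hmu _
  have hp0 : 0 < p := by linarith
  have h01 : ∀ y ∈ Icc 0 R, γ * y ∈ Icc (0 : ℝ) 1 := fun y hy =>
    ⟨mul_nonneg hγ.le hy.1, (mul_le_mul_of_nonneg_left hy.2 hγ.le).trans hR.le⟩
  have hdrop : ∀ y ∈ Icc 0 R, p * mu ^ (p - 1) * (mu - u (γ * y)) ≤ R ^ 2 / 4 := by
    intro y hy
    have h1 := (hu.flux_le_sq hh hmax (h01 y hy)).2
    calc p * mu ^ (p - 1) * (mu - u (γ * y))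
        ≤ p * mu ^ (p - 1) * (lam * nonlin p h mu * (γ * y) ^ 2 / 4) :=
          mul_le_mul_of_nonneg_left h1 (by positivity)
      _ = γ ^ 2 * (p * lam * mu ^ (p - 1) * nonlin p h mu) * y ^ 2 / 4 := by ring
      _ = y ^ 2 / 4 := by rw [hscale, one_mul]
      _ ≤ R ^ 2 / 4 := by
          have := pow_le_pow_left₀ hy.1 hy.2 2
          linarith
  refine ⟨hdrop x hx, ?_⟩
  have hsub : Icc 0 x ⊆ Icc 0 R := Icc_subset_Icc_right hx.2
  have hmaps : MapsTo (fun y => γ * y) (Icc 0 x) (Icc 0 1) := fun y hy => h01 y (hsub hy)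
  have hIoo : ∀ y ∈ Ioo 0 x, γ * y ∈ Ioo (0 : ℝ) 1 := fun y hy =>
    ⟨mul_pos hγ hy.1, (mul_le_mul_of_nonneg_left (hy.2.le.trans hx.2) hγ.le).trans_lt hR⟩
  have hstab := stability_forward (D := fun y => rescaled p mu γ u y - regularProfile y)
    (D₁ := fun y => rescaledDeriv p mu γ u y - -(4 * y) / (8 + y ^ 2))
    (G := fun y => nonlin p h (u (γ * y)) / nonlin p h mu - Real.exp (regularProfile y))
    (C := 1) (e := e) zero_le_one le_rfl hx.1
    (fun y hy => (hu.hasDerivWithinAt_rescaled mu hmaps hy).continuousWithinAt.sub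
      (hasDerivAt_regularProfile y).continuousAt.continuousWithinAt)
    (by
      have h1 : ContinuousOn (fun y => derivWithin u (Icc 0 1) (γ * y)) (Icc 0 x) :=
        hu.contDiffOn_derivWithin.continuousOn.comp (by fun_prop) hmaps
      refine (continuousOn_const.mul (continuousOn_const.mul h1)).sub ?_
      refine ContinuousOn.div (by fun_prop) (by fun_prop) fun y _ => ?_
      positivity)
    (fun y hy => (hu.hasDerivAt_rescaled mu (hIoo y hy)).sub (hasDerivAt_regularProfile y))
    (fun y hy => by
      refine ((hu.hasDerivAt_rescaledDeriv hγ hscale (hIoo y hy)).sub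
        (hasDerivAt_deriv_regularProfile hy.1.ne')).congr_deriv ?_
      ring)
    (fun y hy => by
      have hyI := hsub (Ioo_subset_Icc_self hy)
      have hle := hu.le_mu hh (h01 y hyI)
      have h1 := hf (u (γ * y)) (by
        rw [abs_sub_comm, abs_of_nonneg (sub_nonneg.2 hle)]
        exact hdrop y hyI)
      have hz : rescaled p mu γ u y ≤ 0 := by
        unfold rescaled
        exact mul_nonpos_of_nonneg_of_nonpos (by positivity) (by linarith)
      have h2 := abs_exp_sub_exp_le hz (regularProfile_nonpos y)
      rw [Real.exp_zero] at h2
      have h3 := abs_sub_le (nonlin p h (u (γ * y)) / nonlin p h mu)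
        (Real.exp (rescaled p mu γ u y)) (Real.exp (regularProfile y))
      unfold rescaled at h2 h3
      simp only [rescaled]
      linarith)
  have e1 : rescaled p mu γ u 0 = 0 := by simp [rescaled, hu.value_zero]
  have e2 : rescaledDeriv p mu γ u 0 = 0 := by simp [rescaledDeriv, hu.deriv_zero]
  simp only [e1, e2, regularProfile_zero] at hstab
  norm_num at hstab
  refine hstab.trans (mul_le_mul_of_nonneg_left (Real.exp_le_exp.2 ?_) (sq_nonneg _))
  linarith [hx.2]

end IsRadialSolution

theorem exists_isFirstBubble {p : ℝ} {h : ℝ → ℝ} {lam mu : ℕ → ℝ} {u : ℕ → ℝ → ℝ}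
    (hb : IsBlowup p h lam mu u) : ∃ γ₀ ρ₀ : ℕ → ℝ, IsFirstBubble p h lam mu u γ₀ ρ₀ := by
  have hp := hb.exponent
  have hh := hb.growth
  have hp0 : 0 < p := by linarith
  have hmp : ∀ n, 0 < mu n ^ (p - 1) := fun n => Real.rpow_pos_of_pos (hb.mu_pos n) _
  have hmpp : ∀ n, mu n ^ p = mu n ^ (p - 1) * mu n := fun n => by
    rw [Real.rpow_sub_one (hb.mu_pos n).ne']
    have := (hb.mu_pos n).ne'
    field_simp
  have hden : ∀ n, 0 < p * lam n * mu n ^ (p - 1) * nonlin p h (mu n) := fun n => by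
    have h1 := (hb.sol n).lam_pos
    have h2 := (hb.sol n).nonlin_mu_pos hh
    have h3 := hmp n
    positivity
  set γ : ℕ → ℝ := fun n => (√(p * lam n * mu n ^ (p - 1) * nonlin p h (mu n)))⁻¹ with hγd
  have hγ : ∀ n, 0 < γ n := fun n => inv_pos.2 (Real.sqrt_pos.2 (hden n))
  have hscale : ∀ n, γ n ^ 2 * (p * lam n * mu n ^ (p - 1) * nonlin p h (mu n)) = 1 :=
    fun n => by
      rw [hγd, inv_pow, Real.sq_sqrt (hden n).le, inv_mul_cancel₀ (hden n).ne']
  have hmax := hb.mu_tendsto.eventually (eventually_nonlin_le hp hh hb.sub)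
  -- `0 = u(1) ≥ μ - λ f(μ) / 4` bounds the scale
  have hγ0 : Tendsto γ atTop (𝓝 0) := by
    have h1 : Tendsto (fun n => √(1 / (4 * p * mu n ^ p))) atTop (𝓝 0) := by
      have := (tendsto_const_nhds (x := (1 : ℝ))).div_atTop
        ((hb.rpow_tendsto hp0).const_mul_atTop (by positivity : 0 < 4 * p))
      have h2 := this.sqrt
      rwa [Real.sqrt_zero] at h2
    refine tendsto_of_tendsto_of_tendsto_of_le_of_le' tendsto_const_nhds h1
      (Eventually.of_forall fun n => (hγ n).le) ?_
    filter_upwards [hmax] with n hn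
    have h2 := ((hb.sol n).flux_le_sq hh hn (right_mem_Icc.2 zero_le_one)).2
    rw [(hb.sol n).value_one] at h2
    refine Real.le_sqrt_of_sq_le ?_
    have hm := hb.mu_pos n
    have hm1 := hmp n
    rw [hmpp n, le_div_iff₀ (by positivity)]
    have h3 := mul_le_mul_of_nonneg_left h2
      (by have := hγ n; positivity : 0 ≤ γ n ^ 2 * (4 * p * mu n ^ (p - 1)))
    have h4 := hscale n
    nlinarith
  obtain ⟨ρ, e, hD, he0, he, hP⟩ := exists_diagonal (α := ℝ) (D := fun _ x => x ∈ Ioo (0 : ℝ) 1)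
    (P := fun ε n x => |x - 0| ≤ ε ∧ 1 / ε ≤ x / γ n ∧ |u n x / mu n - 1| ≤ ε ∧
      |p * mu n ^ (p - 1) * flux (u n) x - 4| ≤ ε ∧
      cNorm 1 0 (x / γ n) (fun y => rescaled p (mu n) (γ n) (u n) y - regularProfile y) ≤
        ENNReal.ofReal ε)
    (fun _ => ⟨1 / 2, by norm_num⟩) (by
      intro ε hε
      set R := max 1 (max (1 / ε) (64 / ε)) with hR
      have hR1 : 1 ≤ R := le_max_left _ _
      have hRε : 1 / ε ≤ R := (le_max_left _ _).trans (le_max_right _ _)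
      have hRε' : 64 / ε ≤ R := (le_max_right _ _).trans (le_max_right _ _)
      have hR0 : 0 < R := by linarith
      set η := min (ε / 2) (ε / (2 * R)) with hη
      have hη0 : 0 < η := lt_min (by positivity) (by positivity)
      have hηR : R * η ≤ ε / 2 := by
        have := (le_div_iff₀ (by positivity)).1 (min_le_right (ε / 2) (ε / (2 * R)))
        rw [← hη] at this
        linarith
      set w := η * Real.exp (-(3 * R) / 2) with hw
      have hw0 : 0 < w := by positivity
      have hw2 : w ^ 2 * Real.exp (3 * R) = η ^ 2 := by
        rw [hw, mul_pow, ← Real.exp_nat_mul, mul_assoc, ← Real.exp_add]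
        have : ((2 : ℕ) : ℝ) * (-(3 * R) / 2) + 3 * R = 0 := by push_cast; ring
        rw [this, Real.exp_zero, mul_one]
      obtain ⟨T, hT⟩ := exists_nonlin_ratio hp hh hb.sub (by positivity : 0 < R ^ 2 / 4) hw0
      have hlarge : ∀ᶠ n in atTop, R ^ 2 / (4 * p * ε) ≤ mu n ^ p :=
        (hb.rpow_tendsto hp0).eventually_ge_atTop _
      filter_upwards [hmax, hb.mu_tendsto.eventually_ge_atTop T, hlarge,
        hγ0.eventually (gt_mem_nhds (by positivity : 0 < 1 / R)),
        hγ0.eventually (gt_mem_nhds (by positivity : 0 < ε / R))] with n h1 h2 h3 h4 h5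
      have hu := hb.sol n
      have hg := hγ n
      have hm := hb.mu_pos n
      rw [lt_div_iff₀ hR0] at h4 h5
      have hclose := fun {x : ℝ} (hx : x ∈ Icc 0 R) => hu.sq_sub_regularProfile_le hp hh h1 hg
        (hscale n) h4 (fun v hv => ((hT _ h2).2 v hv).2) hx
      have hx0 : 0 < γ n * R := mul_pos hg hR0
      have e1 : γ n * R / γ n = R := by field_simp
      have b0 : ∀ x ∈ Icc 0 R, |rescaled p (mu n) (γ n) (u n) x - regularProfile x| ≤ η :=
        fun x hx => abs_le_of_sq_le_sq (by
          have := (hclose hx).2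
          rw [hw2] at this
          nlinarith [sq_nonneg (rescaledDeriv p (mu n) (γ n) (u n) x - -(4 * x) / (8 + x ^ 2))])
          hη0.le
      have b1 : ∀ x ∈ Icc 0 R,
          |rescaledDeriv p (mu n) (γ n) (u n) x - -(4 * x) / (8 + x ^ 2)| ≤ η :=
        fun x hx => abs_le_of_sq_le_sq (by
          have := (hclose hx).2
          rw [hw2] at this
          nlinarith [sq_nonneg (rescaled p (mu n) (γ n) (u n) x - regularProfile x)])
          hη0.le
      refine ⟨γ n * R, ⟨hx0, h4⟩, ?_, ?_, ?_, ?_, ?_⟩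
      · rw [sub_zero, abs_of_pos hx0]
        exact h5.le
      · rw [e1]
        exact hRε
      · have h6 := (hclose (right_mem_Icc.2 hR0.le)).1
        have h7 := hu.le_mu hh ⟨hx0.le, h4.le⟩
        rw [div_sub_one hm.ne', abs_div, abs_of_pos hm, abs_sub_comm,
          abs_of_nonneg (sub_nonneg.2 h7), div_le_iff₀ hm]
        have hm1 := hmp n
        rw [div_le_iff₀ (by positivity), hmpp n] at h3
        have h8 : p * mu n ^ (p - 1) * (mu n - u n (γ n * R)) ≤
            p * mu n ^ (p - 1) * (ε * mu n) := by linarith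
        exact le_of_mul_le_mul_left h8 (by positivity)
      · have h6 := b1 R (right_mem_Icc.2 hR0.le)
        have e2 : p * mu n ^ (p - 1) * flux (u n) (γ n * R) - 4 =
            -(R * (rescaledDeriv p (mu n) (γ n) (u n) R - -(4 * R) / (8 + R ^ 2))) -
              32 / (8 + R ^ 2) := by
          rw [mul_sub, mul_rescaledDeriv]
          field_simp
          ring
        rw [e2]
        refine (abs_sub _ _).trans ?_
        rw [abs_neg, abs_mul, abs_of_pos hR0, abs_of_pos (by positivity : 0 < 32 / (8 + R ^ 2))]
        have h7 : 32 / (8 + R ^ 2) ≤ ε / 2 := by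
          rw [div_le_iff₀ (by positivity)]
          rw [div_le_iff₀ hε] at hRε'
          nlinarith
        have h8 := mul_le_mul_of_nonneg_left h6 hR0.le
        linarith
      · rw [e1]
        refine (cNorm_one_le hR0 (fun x hx => (hu.hasDerivWithinAt_rescaled (mu n)
          (fun y hy => ⟨mul_nonneg hg.le hy.1,
            (mul_le_mul_of_nonneg_left hy.2 hg.le).trans h4.le⟩) hx).sub
          (hasDerivAt_regularProfile x).hasDerivWithinAt) b0 b1).trans
          (ENNReal.ofReal_le_ofReal ?_)
        have := min_le_left (ε / 2) (ε / (2 * R))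
        rw [← hη] at this
        linarith)
  refine ⟨γ, ρ, hγ, fun n => ?_, hD, hγ0,
    tendsto_of_abs_sub_le he (hP.mono fun n hn => hn.1), ?_,
    tendsto_of_abs_sub_le he (hP.mono fun n hn => hn.2.2.1), ?_, ?_⟩
  · have := hscale n
    linarith
  · have h1 : Tendsto (fun n => 1 / e n) atTop atTop := by
      simp only [one_div]
      exact (tendsto_nhdsWithin_iff.2 ⟨he, Eventually.of_forall he0⟩).inv_tendsto_nhdsGT_zero
    exact tendsto_atTop_mono' _ (hP.mono fun n hn => hn.2.1) h1
  · have h0 : Tendsto (fun n => ENNReal.ofReal (e n)) atTop (𝓝 0) := by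
      have := ENNReal.tendsto_ofReal he
      rwa [ENNReal.ofReal_zero] at this
    exact tendsto_of_tendsto_of_tendsto_of_le_of_le' tendsto_const_nhds h0
      (Eventually.of_forall fun n => bot_le) (hP.mono fun n hn => hn.2.2.2.2)
  · have h1 : Tendsto (fun n => p * mu n ^ (p - 1) * flux (u n) (ρ n)) atTop (𝓝 4) :=
      tendsto_of_abs_sub_le he (hP.mono fun n hn => hn.2.2.2.1)
    refine h1.congr fun n => ?_
    rw [(hb.sol n).energy_eq hp hh le_rfl (hD n).1.le (hD n).2.le, IsRadialSolution.flux_zero,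
      sub_zero]

/-! ### The infinite sequence of bubbles -/

/-- Iteration of the induction step. -/
theorem exists_bubbles {p : ℝ} {h : ℝ → ℝ} {lam mu : ℕ → ℝ} {u : ℕ → ℝ → ℝ}
    (hb : IsBlowup p h lam mu u) {a δ : ℕ → ℝ} (hrec : IsBubbleRecurrence p a δ) {γ₀ ρ₀ : ℕ → ℝ}
    (hf : IsFirstBubble p h lam mu u γ₀ ρ₀) :
    ∃ r ρbar ρ γ : ℕ → ℕ → ℝ, ρ 0 = ρ₀ ∧
      ∀ k, IsBubble p h lam mu u (a (k + 1)) (δ (k + 1))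
        (ρ k) (r (k + 1)) (ρbar (k + 1)) (ρ (k + 1)) (γ (k + 1)) := by
  have hstep : ∀ k (ρ' : ℕ → ℝ), ∃ r ρbar ρ γ : ℕ → ℝ,
      IsNeckState p h lam mu u (δ k) (2 + a k) ρ' →
        IsBubble p h lam mu u (a (k + 1)) (δ (k + 1)) ρ' r ρbar ρ γ ∧
          IsNeckState p h lam mu u (δ (k + 1)) (2 + a (k + 1)) ρ := by
    intro k ρ'
    by_cases hs : IsNeckState p h lam mu u (δ k) (2 + a k) ρ'
    · obtain ⟨r, ρbar, ρ, γ, h1⟩ := hs.exists_bubble hb (hrec.delta_pos k) (hrec.a_bounds k).1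
        (hrec.delta_mem k) (hrec.a_mem k) (hrec.delta_eq k) (hrec.a_eq k)
      exact ⟨r, ρbar, ρ, γ, fun _ => h1⟩
    · exact ⟨0, 0, 0, 0, fun h1 => absurd h1 hs⟩
  choose R Pbar P Γ hR using hstep
  let ρ : ℕ → ℕ → ℝ := fun k => Nat.rec ρ₀ (fun k ρ' => P k ρ') k
  have hstate : ∀ k, IsNeckState p h lam mu u (δ k) (2 + a k) (ρ k) := by
    intro k
    induction k with
    | zero =>
      rw [hrec.a_zero, hrec.delta_zero, show (2 : ℝ) + 2 = 4 by norm_num]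
      exact hf.isNeckState hb
    | succ k ih => exact (hR k (ρ k) ih).2
  exact ⟨fun k => R (k - 1) (ρ (k - 1)), fun k => Pbar (k - 1) (ρ (k - 1)), ρ,
    fun k => Γ (k - 1) (ρ (k - 1)), rfl, fun k => (hR k (ρ k) (hstate k)).1⟩

theorem theorem1p4 (p : ℝ) (hp : 2 < p) (h : ℝ → ℝ) (hh : IsGrowthFactor h)
    (hsub : SubordinateGrowth p h) (lam mu : ℕ → ℝ) (u : ℕ → ℝ → ℝ)
    (hu : ∀ n, IsRadialSolution p h (lam n) (mu n) (u n)) (hmu : Tendsto mu atTop atTop) :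
    (∃! s : (ℕ → ℝ) × (ℕ → ℝ), IsBubbleRecurrence p s.1 s.2) ∧
    (∃ γ₀ ρ₀ : ℕ → ℝ, IsFirstBubble p h lam mu u γ₀ ρ₀) ∧
    ∀ a δ : ℕ → ℝ, IsBubbleRecurrence p a δ →
      (∀ k, IsSingularLiouville (a (k + 1)) (singularProfile (a (k + 1)))) ∧
      ∀ γ₀ ρ₀ : ℕ → ℝ, IsFirstBubble p h lam mu u γ₀ ρ₀ →
        ∃ r ρbar ρ γ : ℕ → ℕ → ℝ, ρ 0 = ρ₀ ∧
          ∀ k, IsBubble p h lam mu u (a (k + 1)) (δ (k + 1))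
            (ρ k) (r (k + 1)) (ρbar (k + 1)) (ρ (k + 1)) (γ (k + 1)) := by
  have hb : IsBlowup p h lam mu u := ⟨hp, hh, hsub, hu, hmu⟩
  exact ⟨existsUnique_bubbleRecurrence hp, exists_isFirstBubble hb, fun a δ hrec =>
    ⟨fun k => isSingularLiouville_singularProfile (hrec.a_mem k).1, fun γ₀ ρ₀ hf =>
      exists_bubbles hb hrec hf⟩⟩
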